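/- **Setting.** Let $({\cal M},g)$ be an $(m+1)$-dimensional smooth manifold with a $C^2$ metric of signature $\{-,+,\dots,+\}$, and let $\Sigma$ be a smooth $m$-dimensional manifold. *Hypersurface data* on $\Sigma$ consist of a symmetric tensor $\gamma_{ab}$, a one-form $\ell_a$, a scalar $\ell^{(2)}$ (all $C^2$) and a symmetric tensor $Y_{ab}$ ($C^1$) such that the matrix $\mathbb A=\begin{bmatrix}\gamma_{ab}&\ell_a\\ \ell_b&\ell^{(2)}\end{bmatrix}$ has Lorentzian signature at every point; $\gamma$ may be degenerate and its signature may vary from point to point. Put $$\begin{bmatrix}P^{ab}&n^a\\ n^b&n^{(2)}\end{bmatrix}:=\mathbb A^{-1},\qquad \hat n=n^a\hat e_a,\qquad F:=\tfrac12\, d(\ell_a),\qquad U_{ab}:=\tfrac12\left(\pounds_{\hat n}\gamma_{ab}+\ell_a\partial_b n^{(2)}+\ell_b\partial_a n^{(2)}\right).$$ The *metric hypersurface connection* $\mathring\nabla$ is the torsion-free connection on $\Sigma$ whose coefficients in any coordinate basis are $$\mathring\Gamma^c_{ab}:=\tfrac12P^{cd}\left(\partial_a\gamma_{bd}+\partial_b\gamma_{ad}-\partial_d\gamma_{ab}\right)+\tfrac12n^c\left(\partial_a\ell_b+\partial_b\ell_a\right);$$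 it depends only on $(\gamma_{ab},\ell_a,\ell^{(2)})$. Its curvature $\mathring R^a{}_{bcd}$ has the sign $(\mathring\nabla_c\mathring\nabla_d-\mathring\nabla_d\mathring\nabla_c)V^a=\mathring R^a{}_{bcd}V^b$; the same convention is used for $g$, with Ricci tensor $R_{\beta\delta}=R^\alpha{}_{\beta\alpha\delta}$ and Einstein tensor $G^\mu{}_\nu=R^\mu{}_\nu-\frac12R\,\delta^\mu_\nu$. The data are *embedded* in $({\cal M},g)$ with embedding $\Phi:\Sigma\to{\cal M}$ (smooth) and rigging $\ell$ (a smooth vector field along $\Phi$, nowhere tangent to $\Phi(\Sigma)$) if $\Phi^\star g=\gamma$, $\Phi^\star(g(\ell,\cdot))=\ell_a$, $g(\ell,\ell)=\ell^{(2)}$ and $\frac12\Phi^\star(\pounds_\ell g)=Y$ (the last one is independent of the extension of $\ell$ off $\Phi(\Sigma)$). Let $\bm n$ be the normal one-form with $\bm n(\Phi_\star X)=0$ for all $X\in T\Sigma$ and $\bm n(\ell)=1$. **Theorem.** Let hypersurface data be embedded in $({\cal M},g)$ with embedding $\Phi$ and rigging $\ell$, let $\{\hat e_a\}$ be a basis of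 $T\Sigma$ and $e_a:=\Phi_\star(\hat e_a)$. Then at every point of $\Sigma$ \begin{align*} -G^\mu{}_\nu n_\mu\ell^\nu={}&\tfrac12\mathring R^c{}_{bcd}P^{bd}+\tfrac12\ell_a\mathring R^a{}_{bcd}P^{bd}n^c+\mathring\nabla_d\left((P^{bd}n^c-P^{bc}n^d)Y_{bc}\right)+\tfrac12n^{(2)}P^{bd}P^{ac}\left(Y_{bc}Y_{da}-Y_{bd}Y_{ca}\right)\\ &+\tfrac12\left(P^{bd}n^c-P^{bc}n^d\right)\left[\ell^{(2)}\mathring\nabla_dU_{bc}+\left(U_{bc}+n^{(2)}Y_{bc}\right)\partial_d\ell^{(2)}+2Y_{bc}\left(F_{df}-Y_{df}\right)n^f\right],\\ G^\mu{}_\nu n_\mu e_c^\nu={}&-\ell_a\mathring R^a{}_{bcd}n^bn^d+\mathring\nabla_f\left[\left(n^{(2)}P^{bd}-n^bn^d\right)\left(\delta^f_dY_{bc}-\delta^f_cY_{bd}\right)\right]+\left(P^{bd}-\ell^{(2)}n^bn^d\right)\left(\mathring\nabla_dU_{bc}-\mathring\nabla_cU_{bd}\right)\\ &+\left(n^{(2)}P^{bd}-n^bn^d\right)\left[\tfrac12\left(U_{bc}+n^{(2)}Y_{bc}\right)\partial_d\ell^{(2)}-\tfrac12\left(U_{bd}+n^{(2)}Y_{bd}\right)\partial_c\ell^{(2)}+\left(Y_{bc}F_{df}-Y_{bd}F_{cf}\right)n^f\right]\\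 &+\left(P^{bd}n^f-P^{bf}n^d\right)Y_{bd}U_{cf}+P^{bd}n^f\left(U_{bc}F_{df}-U_{bd}F_{cf}\right). \end{align*} In particular these are explicit formulas for the energy along $\ell$, $\rho_\ell:=-G^\mu{}_\nu n_\mu\ell^\nu$, and the energy flux, $J_c:=-G^\mu{}_\nu n_\mu e^\nu_c$, in which all the dependence on $Y_{ab}$ is explicit. -/

import Mathlib

open Set Filter Topology Manifold Module
open scoped ContDiff Matrix

noncomputable section

/-! ### Calculus in coordinates on `ℝᵏ` -/

/-- The partial derivative `∂ₐ f` at `x`. -/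
def pd {k : ℕ} (f : EuclideanSpace ℝ (Fin k) → ℝ) (a : Fin k)
    (x : EuclideanSpace ℝ (Fin k)) : ℝ :=
  fderiv ℝ f x (EuclideanSpace.single a 1)

/-- Components `R^a_{bcd}` of the curvature of the connection with coefficients
`C x c a b = Γ^c_{ab}(x)`, where `∇_a V^c = ∂_a V^c + Γ^c_{ab} V^b`.  The sign is fixed by
`(∇_c ∇_d - ∇_d ∇_c) V^a = R^a_{bcd} V^b`. -/
def curvatureCoeff {k : ℕ} (C : EuclideanSpace ℝ (Fin k) → Fin k → Fin k → Fin k → ℝ)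
    (x : EuclideanSpace ℝ (Fin k)) (a b c d : Fin k) : ℝ :=
  pd (fun y => C y a d b) c x - pd (fun y => C y a c b) d x
    + ∑ f, (C x a c f * C x f d b - C x a d f * C x f c b)

/-! ### Components with respect to a chart -/

section Charts

variable {k : ℕ} {X : Type*} [TopologicalSpace X] [ChartedSpace (EuclideanSpace ℝ (Fin k)) X]

/-- The component `v^a` in the chart `φ` of a tangent vector `v` at `q`. -/
def vecComp (φ : OpenPartialHomeomorph X (EuclideanSpace ℝ (Fin k))) (q : X)
    (v : TangentSpace (𝓡 k) q) (a : Fin k) : ℝ :=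
  (EuclideanSpace.proj a : EuclideanSpace ℝ (Fin k) →L[ℝ] ℝ) (mfderiv (𝓡 k) (𝓡 k) φ q v)

/-- The coordinate vector `∂ₐ` of the chart `φ` at `q`. -/
def coordVec (φ : OpenPartialHomeomorph X (EuclideanSpace ℝ (Fin k))) (q : X) (a : Fin k) :
    TangentSpace (𝓡 k) q :=
  (mfderiv (𝓡 k) (𝓡 k) φ q).inverse (EuclideanSpace.single a (1 : ℝ))

/-- The components, as functions of the coordinates of the chart `φ`, of a field of bilinear forms
on the tangent spaces. -/
def bilinComp (T : ∀ q : X, TangentSpace (𝓡 k) q →L[ℝ] TangentSpace (𝓡 k) q →L[ℝ] ℝ)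
    (φ : OpenPartialHomeomorph X (EuclideanSpace ℝ (Fin k)))
    (x : EuclideanSpace ℝ (Fin k)) (a b : Fin k) : ℝ :=
  T (φ.symm x) (coordVec φ (φ.symm x) a) (coordVec φ (φ.symm x) b)

/-- The components of a one-form in the chart `φ`. -/
def formComp (α : ∀ q : X, TangentSpace (𝓡 k) q →L[ℝ] ℝ)
    (φ : OpenPartialHomeomorph X (EuclideanSpace ℝ (Fin k)))
    (x : EuclideanSpace ℝ (Fin k)) (a : Fin k) : ℝ :=
  α (φ.symm x) (coordVec φ (φ.symm x) a)

/-- The components of a vector field in the chart `φ`. -/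
def fieldComp (V : ∀ q : X, TangentSpace (𝓡 k) q)
    (φ : OpenPartialHomeomorph X (EuclideanSpace ℝ (Fin k)))
    (x : EuclideanSpace ℝ (Fin k)) (a : Fin k) : ℝ :=
  vecComp φ (φ.symm x) (V (φ.symm x)) a

/-- A field of bilinear forms is of class `C^r`: its components in every chart of the smooth
structure are of class `C^r`. -/
def IsBilinCr (r : ℕ) (T : ∀ q : X, TangentSpace (𝓡 k) q →L[ℝ] TangentSpace (𝓡 k) q →L[ℝ] ℝ) :
    Prop :=
  ∀ φ ∈ IsManifold.maximalAtlas (𝓡 k) ∞ X, ∀ a b,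
    ContDiffOn ℝ r (fun x => bilinComp T φ x a b) φ.target

/-- A one-form is of class `C^r`: its components in every chart are of class `C^r`. -/
def IsFormCr (r : ℕ) (α : ∀ q : X, TangentSpace (𝓡 k) q →L[ℝ] ℝ) : Prop :=
  ∀ φ ∈ IsManifold.maximalAtlas (𝓡 k) ∞ X, ∀ a,
    ContDiffOn ℝ r (fun x => formComp α φ x a) φ.target

end Charts

/-- A bilinear form on an `(m+1)`-dimensional space has signature `{-,+,…,+}`. -/
def IsLorentzian (m : ℕ) {V : Type*} [AddCommGroup V] [Module ℝ V] (B : V → V → ℝ) : Prop :=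
  ∃ b : Basis (Fin (m + 1)) ℝ V, ∀ i j,
    B (b i) (b j) = if i = j then (if i = 0 then -1 else 1) else 0

/-! ### The ambient spacetime -/

/-- A `C²` metric of signature `{-,+,…,+}` on an `(m+1)`-dimensional manifold. -/
structure SpacetimeMetric (m : ℕ) (M : Type*) [TopologicalSpace M]
    [ChartedSpace (EuclideanSpace ℝ (Fin (m + 1))) M] where
  val : ∀ q : M, TangentSpace (𝓡 (m + 1)) q →L[ℝ] TangentSpace (𝓡 (m + 1)) q →L[ℝ] ℝ
  symm : ∀ q v w, val q v w = val q w v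
  lorentzian : ∀ q, IsLorentzian m (fun v w : TangentSpace (𝓡 (m + 1)) q => val q v w)
  contDiff : IsBilinCr 2 val

namespace SpacetimeMetric

variable {m : ℕ} {M : Type*} [TopologicalSpace M]
  [ChartedSpace (EuclideanSpace ℝ (Fin (m + 1))) M] (g : SpacetimeMetric m M)

/-- The components `g^{μν}` of the inverse metric in the chart `ψ`. -/
def invComp (ψ : OpenPartialHomeomorph M (EuclideanSpace ℝ (Fin (m + 1))))
    (x : EuclideanSpace ℝ (Fin (m + 1))) (μ ν : Fin (m + 1)) : ℝ :=
  (Matrix.of fun α β => bilinComp g.val ψ x α β)⁻¹ μ ν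

/-- The Christoffel symbols `Γ^μ_{αβ}` of the Levi-Civita connection in the chart `ψ`. -/
def christoffel (ψ : OpenPartialHomeomorph M (EuclideanSpace ℝ (Fin (m + 1))))
    (x : EuclideanSpace ℝ (Fin (m + 1))) (μ α β : Fin (m + 1)) : ℝ :=
  ∑ ν, (1 / 2) * g.invComp ψ x μ ν *
    (pd (fun y => bilinComp g.val ψ y β ν) α x + pd (fun y => bilinComp g.val ψ y α ν) β x
      - pd (fun y => bilinComp g.val ψ y α β) ν x)

/-- The Ricci tensor `R_{βδ} = R^α_{βαδ}` in the chart `ψ`. -/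
def ricciComp (ψ : OpenPartialHomeomorph M (EuclideanSpace ℝ (Fin (m + 1))))
    (x : EuclideanSpace ℝ (Fin (m + 1))) (β δ : Fin (m + 1)) : ℝ :=
  ∑ α, curvatureCoeff (g.christoffel ψ) x α β α δ

/-- The curvature scalar in the chart `ψ`. -/
def scalarComp (ψ : OpenPartialHomeomorph M (EuclideanSpace ℝ (Fin (m + 1))))
    (x : EuclideanSpace ℝ (Fin (m + 1))) : ℝ :=
  ∑ β, ∑ δ, g.invComp ψ x β δ * g.ricciComp ψ x β δ

/-- The components `G^μ_ν = R^μ_ν - ½ R δ^μ_ν` in the chart `ψ`. -/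
def einsteinComp (ψ : OpenPartialHomeomorph M (EuclideanSpace ℝ (Fin (m + 1))))
    (x : EuclideanSpace ℝ (Fin (m + 1))) (μ ν : Fin (m + 1)) : ℝ :=
  (∑ σ, g.invComp ψ x μ σ * g.ricciComp ψ x σ ν)
    - (1 / 2) * g.scalarComp ψ x * (if μ = ν then 1 else 0)

/-- The Einstein tensor at `q`, evaluated on a covector and a vector: `G^μ_ν α_μ v^ν`. -/
def einstein (q : M) (α : TangentSpace (𝓡 (m + 1)) q →L[ℝ] ℝ) (v : TangentSpace (𝓡 (m + 1)) q) :
    ℝ :=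
  let ψ := chartAt (EuclideanSpace ℝ (Fin (m + 1))) q
  ∑ μ, ∑ ν, g.einsteinComp ψ (ψ q) μ ν * α (coordVec ψ q μ) * vecComp ψ q v ν

/-- The Lie derivative `£_L g` at `q`, evaluated on two vectors; in coordinates
`(£_L g)_{αβ} = L^μ ∂_μ g_{αβ} + g_{μβ} ∂_α L^μ + g_{αμ} ∂_β L^μ`. -/
def lieDeriv (L : ∀ q : M, TangentSpace (𝓡 (m + 1)) q) (q : M)
    (v w : TangentSpace (𝓡 (m + 1)) q) : ℝ :=
  let ψ := chartAt (EuclideanSpace ℝ (Fin (m + 1))) q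
  ∑ α, ∑ β, vecComp ψ q v α * vecComp ψ q w β *
    ∑ μ, (fieldComp L ψ (ψ q) μ * pd (fun y => bilinComp g.val ψ y α β) μ (ψ q)
      + bilinComp g.val ψ (ψ q) μ β * pd (fun y => fieldComp L ψ y μ) α (ψ q)
      + bilinComp g.val ψ (ψ q) α μ * pd (fun y => fieldComp L ψ y μ) β (ψ q))

end SpacetimeMetric

/-! ### Hypersurface metric data -/

/-- Hypersurface metric data `{S, γ_{ab}, ℓ_a, ℓ⁽²⁾}`.  The bilinear form in `lorentzian` is the one
whose matrix in a basis of `T_p S ⊕ ℝ` adapted to the sum is `[[γ_{ab}, ℓ_a], [ℓ_b, ℓ⁽²⁾]]`. -/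
structure MetricHypersurfaceData (m : ℕ) (S : Type*) [TopologicalSpace S]
    [ChartedSpace (EuclideanSpace ℝ (Fin m)) S] where
  gam : ∀ p : S, TangentSpace (𝓡 m) p →L[ℝ] TangentSpace (𝓡 m) p →L[ℝ] ℝ
  ell : ∀ p : S, TangentSpace (𝓡 m) p →L[ℝ] ℝ
  ell2 : S → ℝ
  gam_symm : ∀ p v w, gam p v w = gam p w v
  lorentzian : ∀ p, IsLorentzian m (fun v w : TangentSpace (𝓡 m) p × ℝ =>
    gam p v.1 w.1 + v.2 * ell p w.1 + w.2 * ell p v.1 + v.2 * w.2 * ell2 p)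
  gam_contDiff : IsBilinCr 2 gam
  ell_contDiff : IsFormCr 2 ell
  ell2_contMDiff : ContMDiff (𝓡 m) 𝓘(ℝ, ℝ) 2 ell2

namespace MetricHypersurfaceData

variable {m : ℕ} {S : Type*} [TopologicalSpace S] [ChartedSpace (EuclideanSpace ℝ (Fin m)) S]
  (D : MetricHypersurfaceData m S)

/-- The matrix `[[γ_{ab}, ℓ_a], [ℓ_b, ℓ⁽²⁾]]` at `p` in the basis `e` of `T_p S`. -/
def mat (p : S) (e : Fin m → TangentSpace (𝓡 m) p) : Matrix (Fin m ⊕ Unit) (Fin m ⊕ Unit) ℝ :=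
  Matrix.fromBlocks (Matrix.of fun a b => D.gam p (e a) (e b)) (Matrix.of fun a _ => D.ell p (e a))
    (Matrix.of fun _ b => D.ell p (e b)) (Matrix.of fun _ _ => D.ell2 p)

/-- The components `P^{ab}` at `p` in the basis `e`; by definition `[[P^{ab}, n^a], [n^b, n⁽²⁾]]`
is the inverse of `mat`. -/
def P (p : S) (e : Fin m → TangentSpace (𝓡 m) p) (a b : Fin m) : ℝ :=
  (D.mat p e)⁻¹ (Sum.inl a) (Sum.inl b)

/-- The components `n^a` at `p` in the basis `e`. -/
def n (p : S) (e : Fin m → TangentSpace (𝓡 m) p) (a : Fin m) : ℝ :=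
  (D.mat p e)⁻¹ (Sum.inl a) (Sum.inr ())

/-- The scalar `n⁽²⁾` at `p`, computed in the basis `e`. -/
def n2 (p : S) (e : Fin m → TangentSpace (𝓡 m) p) : ℝ :=
  (D.mat p e)⁻¹ (Sum.inr ()) (Sum.inr ())

variable (φ : OpenPartialHomeomorph S (EuclideanSpace ℝ (Fin m)))

/-- `P^{ab}` in the coordinate basis of `φ`. -/
def PComp (x : EuclideanSpace ℝ (Fin m)) (a b : Fin m) : ℝ :=
  D.P (φ.symm x) (coordVec φ (φ.symm x)) a b

/-- `n^a` in the coordinate basis of `φ`. -/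
def nComp (x : EuclideanSpace ℝ (Fin m)) (a : Fin m) : ℝ :=
  D.n (φ.symm x) (coordVec φ (φ.symm x)) a

/-- `n⁽²⁾` as a function of the coordinates of `φ`. -/
def n2Comp (x : EuclideanSpace ℝ (Fin m)) : ℝ :=
  D.n2 (φ.symm x) (coordVec φ (φ.symm x))

/-- The coefficients `Γ°^c_{ab}` of the metric hypersurface connection in the chart `φ`. -/
def conn (x : EuclideanSpace ℝ (Fin m)) (c a b : Fin m) : ℝ :=
  (1 / 2) * ∑ d, D.PComp φ x c d *
      (pd (fun y => bilinComp D.gam φ y b d) a x + pd (fun y => bilinComp D.gam φ y a d) b x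
        - pd (fun y => bilinComp D.gam φ y a b) d x)
    + (1 / 2) * D.nComp φ x c *
      (pd (fun y => formComp D.ell φ y b) a x + pd (fun y => formComp D.ell φ y a) b x)

/-- The components of `F = ½ dℓ`. -/
def FComp (x : EuclideanSpace ℝ (Fin m)) (a b : Fin m) : ℝ :=
  (1 / 2) * (pd (fun y => formComp D.ell φ y b) a x - pd (fun y => formComp D.ell φ y a) b x)

/-- The components of `£_n̂ γ`. -/
def lieGamComp (x : EuclideanSpace ℝ (Fin m)) (a b : Fin m) : ℝ :=
  ∑ c, (D.nComp φ x c * pd (fun y => bilinComp D.gam φ y a b) c x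
    + bilinComp D.gam φ x c b * pd (fun y => D.nComp φ y c) a x
    + bilinComp D.gam φ x a c * pd (fun y => D.nComp φ y c) b x)

/-- The components of `U_{ab} = ½ (£_n̂ γ_{ab} + ℓ_a ∂_b n⁽²⁾ + ℓ_b ∂_a n⁽²⁾)`. -/
def UComp (x : EuclideanSpace ℝ (Fin m)) (a b : Fin m) : ℝ :=
  (1 / 2) * (D.lieGamComp φ x a b + formComp D.ell φ x a * pd (D.n2Comp φ) b x
    + formComp D.ell φ x b * pd (D.n2Comp φ) a x)

/-! Covariant derivatives with respect to the metric hypersurface connection of tensor fields given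
by their components in the chart `φ`; the index of differentiation comes first. -/

/-- `∇°_a V^c`. -/
def covVec (V : EuclideanSpace ℝ (Fin m) → Fin m → ℝ) (x : EuclideanSpace ℝ (Fin m))
    (a c : Fin m) : ℝ :=
  pd (fun y => V y c) a x + ∑ f, D.conn φ x c a f * V x f

/-- `∇°_a T_{bc}`. -/
def covBilin (T : EuclideanSpace ℝ (Fin m) → Fin m → Fin m → ℝ) (x : EuclideanSpace ℝ (Fin m))
    (a b c : Fin m) : ℝ :=
  pd (fun y => T y b c) a x - (∑ f, D.conn φ x f a b * T x f c) - ∑ f, D.conn φ x f a c * T x b f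

/-- `∇°_a T^b_c` for a field `T x b c = T^b_c`. -/
def covEnd (T : EuclideanSpace ℝ (Fin m) → Fin m → Fin m → ℝ) (x : EuclideanSpace ℝ (Fin m))
    (a b c : Fin m) : ℝ :=
  pd (fun y => T y b c) a x + (∑ f, D.conn φ x b a f * T x f c) - ∑ f, D.conn φ x f a c * T x b f

/-! The tensors at a point `p` of the domain of `φ`, as functions of vectors and covectors at `p`. -/

variable (p : S)

/-- The two-form `F` at `p`. -/
def F (v w : TangentSpace (𝓡 m) p) : ℝ :=
  ∑ a, ∑ b, D.FComp φ (φ p) a b * vecComp φ p v a * vecComp φ p w b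

/-- The symmetric tensor `U` at `p`. -/
def U (v w : TangentSpace (𝓡 m) p) : ℝ :=
  ∑ a, ∑ b, D.UComp φ (φ p) a b * vecComp φ p v a * vecComp φ p w b

/-- The tensor `∇°_a U_{bc}` at `p`, evaluated on `u^a v^b w^c`. -/
def covU (u v w : TangentSpace (𝓡 m) p) : ℝ :=
  ∑ a, ∑ b, ∑ c, D.covBilin φ (D.UComp φ) (φ p) a b c
    * vecComp φ p u a * vecComp φ p v b * vecComp φ p w c

/-- The curvature tensor `R°^a_{bcd}` of the metric hypersurface connection at `p`, evaluated on
`α_a u^b v^c w^d`. -/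
def curvature (α : TangentSpace (𝓡 m) p →ₗ[ℝ] ℝ) (u v w : TangentSpace (𝓡 m) p) : ℝ :=
  ∑ a, ∑ b, ∑ c, ∑ d, curvatureCoeff (D.conn φ) (φ p) a b c d
    * α (coordVec φ p a) * vecComp φ p u b * vecComp φ p v c * vecComp φ p w d

end MetricHypersurfaceData

/-! ### Hypersurface data -/

/-- Hypersurface data `{S, γ_{ab}, ℓ_a, ℓ⁽²⁾, Y_{ab}}`. -/
structure HypersurfaceData (m : ℕ) (S : Type*) [TopologicalSpace S]
    [ChartedSpace (EuclideanSpace ℝ (Fin m)) S] extends MetricHypersurfaceData m S where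
  Y : ∀ p : S, TangentSpace (𝓡 m) p →L[ℝ] TangentSpace (𝓡 m) p →L[ℝ] ℝ
  Y_symm : ∀ p v w, Y p v w = Y p w v
  Y_contDiff : IsBilinCr 1 Y

namespace HypersurfaceData

variable {m : ℕ} {S : Type*} [TopologicalSpace S] [ChartedSpace (EuclideanSpace ℝ (Fin m)) S]
  (D : HypersurfaceData m S) (φ : OpenPartialHomeomorph S (EuclideanSpace ℝ (Fin m)))

/-- The components of the vector field `(P^{bd} n^c - P^{bc} n^d) Y_{bc}` (free index `d`). -/
def divFieldComp (x : EuclideanSpace ℝ (Fin m)) (d : Fin m) : ℝ :=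
  ∑ b, ∑ c, (D.PComp φ x b d * D.nComp φ x c - D.PComp φ x b c * D.nComp φ x d)
    * bilinComp D.Y φ x b c

/-- The components of `(n⁽²⁾ P^{bd} - n^b n^d) (δ^f_d Y_{bc} - δ^f_c Y_{bd})`
(free indices `f` up, `c` down). -/
def divTensorComp (x : EuclideanSpace ℝ (Fin m)) (f c : Fin m) : ℝ :=
  ∑ b, ∑ d, (D.n2Comp φ x * D.PComp φ x b d - D.nComp φ x b * D.nComp φ x d)
    * ((if f = d then bilinComp D.Y φ x b c else 0) - (if f = c then bilinComp D.Y φ x b d else 0))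

variable (p : S)

/-- The tensor `∇°_a [(P^{bd} n^c - P^{bc} n^d) Y_{bc}]` at `p`, evaluated on `u^a α_d`. -/
def covDivField (u : TangentSpace (𝓡 m) p) (α : TangentSpace (𝓡 m) p →ₗ[ℝ] ℝ) : ℝ :=
  ∑ a, ∑ d, D.covVec φ (D.divFieldComp φ) (φ p) a d * vecComp φ p u a * α (coordVec φ p d)

/-- The tensor `∇°_a [(n⁽²⁾ P^{bd} - n^b n^d) (δ^f_d Y_{bc} - δ^f_c Y_{bd})]` at `p`, evaluated on
`u^a α_f v^c`. -/
def covDivTensor (u : TangentSpace (𝓡 m) p) (α : TangentSpace (𝓡 m) p →ₗ[ℝ] ℝ)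
    (v : TangentSpace (𝓡 m) p) : ℝ :=
  ∑ a, ∑ f, ∑ c, D.covEnd φ (D.divTensorComp φ) (φ p) a f c
    * vecComp φ p u a * α (coordVec φ p f) * vecComp φ p v c

end HypersurfaceData

/-! ### Embedded hypersurface data -/

section Embedding

variable {m : ℕ} {S M : Type*}
  [TopologicalSpace S] [ChartedSpace (EuclideanSpace ℝ (Fin m)) S] [IsManifold (𝓡 m) ∞ S]
  [TopologicalSpace M] [ChartedSpace (EuclideanSpace ℝ (Fin (m + 1))) M]
  [IsManifold (𝓡 (m + 1)) ∞ M]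

/-- A rigging: a smooth vector field along `Φ` that is nowhere tangent to the hypersurface. -/
structure IsRigging (Φ : S → M) (l : ∀ p : S, TangentSpace (𝓡 (m + 1)) (Φ p)) : Prop where
  smooth : ContMDiff (𝓡 m) (𝓡 (m + 1)).tangent ∞
    (fun p => (⟨Φ p, l p⟩ : TangentBundle (𝓡 (m + 1)) M))
  transverse : ∀ p, l p ∉ range (mfderiv (𝓡 m) (𝓡 (m + 1)) Φ p)

/-- `L` is a smooth extension of the rigging to a neighbourhood of `Φ p` in the ambient space. -/
structure IsRiggingExtension (Φ : S → M) (l : ∀ p : S, TangentSpace (𝓡 (m + 1)) (Φ p)) (p : S)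
    (L : ∀ q : M, TangentSpace (𝓡 (m + 1)) q) : Prop where
  smooth : ContMDiffAt (𝓡 (m + 1)) (𝓡 (m + 1)).tangent ∞
    (fun q => (⟨q, L q⟩ : TangentBundle (𝓡 (m + 1)) M)) (Φ p)
  extends_rigging : ∀ᶠ p' in 𝓝 p, L (Φ p') = l p'

/-- The hypersurface data `D` is embedded in the spacetime `(M, g)` with embedding `Φ` and rigging
`l`: `Φ^*(g) = γ`, `Φ^*(g(l,·)) = ℓ`, `g(l,l) = ℓ⁽²⁾`, `½ Φ^*(£_l g) = Y`.  The last expression does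
not depend on the extension of `l` off the hypersurface that is used to compute it. -/
structure HypersurfaceData.IsEmbedded (D : HypersurfaceData m S) (g : SpacetimeMetric m M)
    (Φ : S → M) (l : ∀ p : S, TangentSpace (𝓡 (m + 1)) (Φ p)) : Prop where
  embedding : IsSmoothEmbedding (𝓡 m) (𝓡 (m + 1)) ∞ Φ
  rigging : IsRigging Φ l
  gam_eq : ∀ p v w, g.val (Φ p) (mfderiv (𝓡 m) (𝓡 (m + 1)) Φ p v)
    (mfderiv (𝓡 m) (𝓡 (m + 1)) Φ p w) = D.gam p v w
  ell_eq : ∀ p v, g.val (Φ p) (l p) (mfderiv (𝓡 m) (𝓡 (m + 1)) Φ p v) = D.ell p v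
  ell2_eq : ∀ p, g.val (Φ p) (l p) (l p) = D.ell2 p
  Y_eq : ∀ p, ∃ L : ∀ q : M, TangentSpace (𝓡 (m + 1)) q, IsRiggingExtension Φ l p L ∧
    ∀ v w, (1 / 2) * g.lieDeriv L (Φ p) (mfderiv (𝓡 m) (𝓡 (m + 1)) Φ p v)
      (mfderiv (𝓡 m) (𝓡 (m + 1)) Φ p w) = D.Y p v w

/-- `ν` is the normal one-form at `p` normalized by the rigging. -/
structure IsNormalForm (Φ : S → M) (l : ∀ p : S, TangentSpace (𝓡 (m + 1)) (Φ p)) (p : S)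
    (ν : TangentSpace (𝓡 (m + 1)) (Φ p) →L[ℝ] ℝ) : Prop where
  tangent : ∀ v, ν (mfderiv (𝓡 m) (𝓡 (m + 1)) Φ p v) = 0
  rigging : ν (l p) = 1

end Embedding

end

/-! Let `E` be the frame `(∂_a f, l)` along the hypersurface, where `f` is the embedding in charts.
The embedding conditions say that its Gram matrix `h = Eᵀ G E` is the matrix `𝔸` of the data, so
`P`, `n`, `n⁽²⁾` are the blocks of `H = h⁻¹`. Put `W_a(A,B) = ⟨e_A, ∇_a e_B⟩`. Three facts determine
`W_a`, by a Koszul argument (`eq_lowConn`): metric compatibility gives `W_a + W_aᵀ = ∂_a h`, absence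
of torsion gives `∇_a e_b = ∇_b e_a`, and the Lie derivative condition prescribes the symmetric part
`Y_ab` of `⟨e_b, ∇_a l⟩`, whose antisymmetric part is `F_ab`. Raising the index with `H` gives `∇_a
e_b = (Γ°^c_ab - n^c Y_ab) e_c - (U_ab + n⁽²⁾ Y_ab) l` together with a similar expression for `∇_a
l`. Thus `Γ°` and `U` are what remains when the explicit `Y` is split off.

The curvature of these connection matrices is the ambient `R(e_c, e_d)` written in the frame
(`matCurv_mul_frame`, `matCurv_pullConn_mul_rigFrame`). Its blocks are the Gauss and Codazzi
equations, and contracting the former with `ℓ_a` and the latter with `ℓ⁽²⁾` gives the lowered row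
`⟨l, R(e_c, e_d) e_b⟩` (`coordMat_mul_frameCurvature`).

This is enough, because an Einstein component with one slot contracted with the normal involves only
curvatures `R_ABcd` with `c`, `d` tangential. In `Ric(n, e_c)` the terms with a transverse third
index pair a symmetric with an antisymmetric array (`sum_contract_inl`). In `G(n, l)` the terms with
a transverse third or fourth index are exactly removed by half the scalar curvature
(`sum_contract_inr`). Only the antisymmetries in the first and in the last pair of indices are used,
no Bianchi identity.

What is left is bookkeeping. Differentiating `H h = 1` gives `∇°P`, `∇°n` and `dn⁽²⁾`
(`covBiv_PComp`, `covVec_nComp`, `pd_n2Comp`), and the Leibniz rules expand the two divergences in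
the statement. Both sides then become linear combinations of the same few contractions, and `ring`
compares them.

Two invariance arguments complete the proof. The Lie derivative is computed in the preferred chart
of each image point, and this chart varies with the point; `pullLie_change_coord` moves everything
into one chart so that `Y` may be differentiated. Finally, the formulas are proved in a coordinate
basis and transferred to an arbitrary basis at the point by tensoriality (`IsPull₁`, `IsPush₁` and
their analogues). -/

noncomputable section

/-! ### Partial derivatives -/

section PartialDerivatives

variable {k N : ℕ} {f g : EuclideanSpace ℝ (Fin k) → ℝ} {x : EuclideanSpace ℝ (Fin k)}

theorem pd_const (c : ℝ) (a : Fin k) : pd (fun _ => c) a x = 0 := by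
  simp [pd]

theorem pd_add (hf : DifferentiableAt ℝ f x) (hg : DifferentiableAt ℝ g x) (a : Fin k) :
    pd (fun y => f y + g y) a x = pd f a x + pd g a x := by
  simp [pd, fderiv_fun_add hf hg]

theorem pd_sub (hf : DifferentiableAt ℝ f x) (hg : DifferentiableAt ℝ g x) (a : Fin k) :
    pd (fun y => f y - g y) a x = pd f a x - pd g a x := by
  simp [pd, fderiv_fun_sub hf hg]

theorem pd_neg (a : Fin k) : pd (fun y => -f y) a x = -pd f a x := by
  simp [pd, fderiv_fun_neg]

theorem pd_mul (hf : DifferentiableAt ℝ f x) (hg : DifferentiableAt ℝ g x) (a : Fin k) :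
    pd (fun y => f y * g y) a x = pd f a x * g x + f x * pd g a x := by
  simp [pd, fderiv_fun_mul hf hg]
  ring

theorem pd_sum {ι : Type*} {s : Finset ι} {F : ι → EuclideanSpace ℝ (Fin k) → ℝ}
    (hF : ∀ i ∈ s, DifferentiableAt ℝ (F i) x) (a : Fin k) :
    pd (fun y => ∑ i ∈ s, F i y) a x = ∑ i ∈ s, pd (F i) a x := by
  simp [pd, fderiv_fun_sum hF]

theorem pd_congr (h : f =ᶠ[𝓝 x] g) (a : Fin k) : pd f a x = pd g a x := by
  rw [pd, pd, h.fderiv_eq]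

theorem EuclideanSpace.clm_apply_eq_sum {F : Type*} [NormedAddCommGroup F] [NormedSpace ℝ F]
    (A : EuclideanSpace ℝ (Fin N) →L[ℝ] F) (v : EuclideanSpace ℝ (Fin N)) :
    A v = ∑ i, v i • A (EuclideanSpace.single i 1) := by
  conv_lhs => rw [← (EuclideanSpace.basisFun (Fin N) ℝ).sum_repr v]
  simp [map_sum]

theorem fderiv_apply_eq_sum_pd (f : EuclideanSpace ℝ (Fin k) → ℝ) (x v : EuclideanSpace ℝ (Fin k)) :
    fderiv ℝ f x v = ∑ a, v a * pd f a x := by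
  rw [EuclideanSpace.clm_apply_eq_sum]
  simp [pd]

theorem fderiv_coord {F : EuclideanSpace ℝ (Fin k) → EuclideanSpace ℝ (Fin N)}
    (hF : DifferentiableAt ℝ F x) (v : EuclideanSpace ℝ (Fin k)) (i : Fin N) :
    fderiv ℝ F x v i = fderiv ℝ (fun y => F y i) x v := by
  have h := ((EuclideanSpace.proj i : EuclideanSpace ℝ (Fin N) →L[ℝ] ℝ).hasFDerivAt.comp x
    hF.hasFDerivAt).fderiv
  change _ = fderiv ℝ ((EuclideanSpace.proj i : EuclideanSpace ℝ (Fin N) →L[ℝ] ℝ) ∘ F) x v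
  rw [h]
  rfl

theorem pd_comp {F : EuclideanSpace ℝ (Fin k) → EuclideanSpace ℝ (Fin N)}
    {G : EuclideanSpace ℝ (Fin N) → ℝ} (hF : DifferentiableAt ℝ F x)
    (hG : DifferentiableAt ℝ G (F x)) (a : Fin k) :
    pd (fun y => G (F y)) a x = ∑ i, pd (fun y => F y i) a x * pd G i (F x) := by
  have h := (hG.hasFDerivAt.comp x hF.hasFDerivAt).fderiv
  change fderiv ℝ (G ∘ F) x _ = _
  rw [h, ContinuousLinearMap.comp_apply, fderiv_apply_eq_sum_pd]
  simp_rw [fderiv_coord hF, pd]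

theorem ContDiffAt.pd {r s : WithTop ℕ∞} (hf : ContDiffAt ℝ r f x) (h : s + 1 ≤ r) (a : Fin k) :
    ContDiffAt ℝ s (pd f a) x :=
  (hf.fderiv_right h).clm_apply contDiffAt_const

theorem pd_comm (hf : ContDiffAt ℝ 2 f x) (a b : Fin k) :
    pd (pd f a) b x = pd (pd f b) a x := by
  have hd : DifferentiableAt ℝ (fderiv ℝ f) x :=
    (hf.fderiv_right (m := 1) (by norm_num)).differentiableAt (by norm_num)
  have hs : IsSymmSndFDerivAt ℝ f x := hf.isSymmSndFDerivAt (by simp)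
  have key (c d : Fin k) : pd (pd f c) d x =
      fderiv ℝ (fderiv ℝ f) x (EuclideanSpace.single d 1) (EuclideanSpace.single c 1) := by
    change fderiv ℝ (fun y => fderiv ℝ f y (EuclideanSpace.single c 1)) x _ = _
    rw [fderiv_clm_apply hd (differentiableAt_const _)]
    simp
  rw [key, key, hs.eq]

end PartialDerivatives

/-! ### Matrix-valued functions -/

section MatrixCalculus

variable {k : ℕ} {ι κ τ : Type*}

/-- The entrywise partial derivative of a matrix-valued function. -/
def matPd (A : EuclideanSpace ℝ (Fin k) → Matrix ι κ ℝ) (a : Fin k)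
    (x : EuclideanSpace ℝ (Fin k)) : Matrix ι κ ℝ :=
  Matrix.of fun i j => pd (fun y => A y i j) a x

/-- The entries of a matrix-valued function are of class `C^r` at `x`. -/
def MatContDiffAt (r : WithTop ℕ∞) (A : EuclideanSpace ℝ (Fin k) → Matrix ι κ ℝ)
    (x : EuclideanSpace ℝ (Fin k)) : Prop :=
  ∀ i j, ContDiffAt ℝ r (fun y => A y i j) x

variable {x : EuclideanSpace ℝ (Fin k)} {r s : WithTop ℕ∞}

theorem MatContDiffAt.of_le {A : EuclideanSpace ℝ (Fin k) → Matrix ι κ ℝ}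
    (hA : MatContDiffAt r A x) (h : s ≤ r) : MatContDiffAt s A x :=
  fun i j => (hA i j).of_le h

theorem MatContDiffAt.differentiableAt {A : EuclideanSpace ℝ (Fin k) → Matrix ι κ ℝ}
    (hA : MatContDiffAt 1 A x) (i : ι) (j : κ) : DifferentiableAt ℝ (fun y => A y i j) x :=
  (hA i j).differentiableAt (by norm_num)

theorem MatContDiffAt.transpose {A : EuclideanSpace ℝ (Fin k) → Matrix ι κ ℝ}
    (hA : MatContDiffAt r A x) : MatContDiffAt r (fun y => (A y)ᵀ) x :=
  fun i j => hA j i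

theorem MatContDiffAt.mul [Fintype κ] {A : EuclideanSpace ℝ (Fin k) → Matrix ι κ ℝ}
    {B : EuclideanSpace ℝ (Fin k) → Matrix κ τ ℝ}
    (hA : MatContDiffAt r A x) (hB : MatContDiffAt r B x) :
    MatContDiffAt r (fun y => A y * B y) x := fun i j => by
  simp only [Matrix.mul_apply]
  exact ContDiffAt.sum fun c _ => (hA i c).mul (hB c j)

theorem MatContDiffAt.matPd {A : EuclideanSpace ℝ (Fin k) → Matrix ι κ ℝ}
    (hA : MatContDiffAt r A x) (h : s + 1 ≤ r) (a : Fin k) : MatContDiffAt s (matPd A a) x :=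
  fun i j => (hA i j).pd h a

theorem MatContDiffAt.det [Fintype ι] [DecidableEq ι]
    {A : EuclideanSpace ℝ (Fin k) → Matrix ι ι ℝ} (hA : MatContDiffAt r A x) :
    ContDiffAt ℝ r (fun y => (A y).det) x := by
  simp only [Matrix.det_apply']
  exact ContDiffAt.sum fun σ _ => contDiffAt_const.mul (contDiffAt_prod fun i _ => hA _ _)

/-- Cramer's rule: each entry is a determinant of entries of `A` and constants, divided by `det A`.
-/
theorem MatContDiffAt.inv [Fintype ι] [DecidableEq ι]
    {A : EuclideanSpace ℝ (Fin k) → Matrix ι ι ℝ} (hA : MatContDiffAt r A x)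
    (h : (A x).det ≠ 0) : MatContDiffAt r (fun y => (A y)⁻¹) x := fun i j => by
  simp only [Matrix.inv_def, Ring.inverse_eq_inv', Matrix.smul_apply, smul_eq_mul,
    Matrix.adjugate_apply]
  refine (hA.det.inv h).mul (MatContDiffAt.det fun a b => ?_)
  by_cases hb : a = j
  · subst hb
    simpa using contDiffAt_const
  · simpa [Matrix.updateRow_ne hb] using hA a b

theorem matPd_congr {A B : EuclideanSpace ℝ (Fin k) → Matrix ι κ ℝ} (h : A =ᶠ[𝓝 x] B)
    (a : Fin k) : matPd A a x = matPd B a x := by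
  ext i j
  exact pd_congr (h.mono fun y hy => by rw [hy]) a

theorem matPd_transpose (A : EuclideanSpace ℝ (Fin k) → Matrix ι κ ℝ) (a : Fin k) :
    matPd (fun y => (A y)ᵀ) a x = (matPd A a x)ᵀ := rfl

theorem matPd_add {A B : EuclideanSpace ℝ (Fin k) → Matrix ι κ ℝ}
    (hA : MatContDiffAt 1 A x) (hB : MatContDiffAt 1 B x) (a : Fin k) :
    matPd (fun y => A y + B y) a x = matPd A a x + matPd B a x := by
  ext i j
  exact pd_add (hA.differentiableAt i j) (hB.differentiableAt i j) a

theorem matPd_mul [Fintype κ] {A : EuclideanSpace ℝ (Fin k) → Matrix ι κ ℝ}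
    {B : EuclideanSpace ℝ (Fin k) → Matrix κ τ ℝ}
    (hA : MatContDiffAt 1 A x) (hB : MatContDiffAt 1 B x) (a : Fin k) :
    matPd (fun y => A y * B y) a x = matPd A a x * B x + A x * matPd B a x := by
  ext i j
  simp only [matPd, Matrix.of_apply, Matrix.mul_apply, Matrix.add_apply]
  rw [pd_sum fun c _ => (hA.differentiableAt i c).fun_mul (hB.differentiableAt c j),
    ← Finset.sum_add_distrib]
  exact Finset.sum_congr rfl fun c _ => pd_mul (hA.differentiableAt i c) (hB.differentiableAt c j) a

theorem matPd_comm {A : EuclideanSpace ℝ (Fin k) → Matrix ι κ ℝ} (hA : MatContDiffAt 2 A x)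
    (a b : Fin k) : matPd (matPd A a) b x = matPd (matPd A b) a x := by
  ext i j
  exact pd_comm (hA i j) a b

/-- The curvature `∂_c Θ_d - ∂_d Θ_c + [Θ_c, Θ_d]` of the connection matrices `Θ_a`. -/
def matCurv [Fintype ι] (Θ : Fin k → EuclideanSpace ℝ (Fin k) → Matrix ι ι ℝ)
    (c d : Fin k) (x : EuclideanSpace ℝ (Fin k)) : Matrix ι ι ℝ :=
  matPd (Θ d) c x - matPd (Θ c) d x + (Θ c x * Θ d x - Θ d x * Θ c x)

/-- If `∇_a E = E Θ'_a` for a frame `E` then the curvatures of `Θ` and `Θ'` are related by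
`Ω E = E Ω'`. -/
theorem matCurv_mul_frame [Fintype ι] [Fintype κ]
    {Θ : Fin k → EuclideanSpace ℝ (Fin k) → Matrix ι ι ℝ}
    {Θ' : Fin k → EuclideanSpace ℝ (Fin k) → Matrix κ κ ℝ}
    {E : EuclideanSpace ℝ (Fin k) → Matrix ι κ ℝ}
    (hE : MatContDiffAt 2 E x) (hΘ : ∀ a, MatContDiffAt 1 (Θ a) x)
    (hΘ' : ∀ a, MatContDiffAt 1 (Θ' a) x)
    (h : ∀ a, ∀ᶠ y in 𝓝 x, matPd E a y + Θ a y * E y = E y * Θ' a y) (c d : Fin k) :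
    matCurv Θ c d x * E x = E x * matCurv Θ' c d x := by
  have hE1 := hE.of_le (s := 1) (by norm_num)
  -- The frame equation holds near `x`, so it may be differentiated once more.
  have h2 (a b : Fin k) : matPd (matPd E a) b x + (matPd (Θ a) b x * E x + Θ a x * matPd E b x) =
      matPd E b x * Θ' a x + E x * matPd (Θ' a) b x := by
    rw [← matPd_mul (hΘ a) hE1, ← matPd_mul hE1 (hΘ' a),
      ← matPd_add (hE.matPd (by norm_num) a) ((hΘ a).mul hE1)]
    exact matPd_congr (h a) b
  have h1 (a : Fin k) : matPd E a x = E x * Θ' a x - Θ a x * E x :=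
    eq_sub_of_add_eq (h a).self_of_nhds
  have hcd := h2 d c
  have hdc := h2 c d
  -- Once the mixed second derivatives of `E` agree, subtracting the two equations eliminates them.
  rw [matPd_comm hE d c] at hcd
  have e1 : matPd (Θ d) c x * E x - matPd (Θ c) d x * E x =
      matPd E c x * Θ' d x + E x * matPd (Θ' d) c x - matPd E d x * Θ' c x
        - E x * matPd (Θ' c) d x - Θ d x * matPd E c x + Θ c x * matPd E d x := by
    have := congrArg₂ (· - ·) hcd hdc
    rw [add_sub_add_left_eq_sub] at this
    have h3 : matPd (Θ d) c x * E x - matPd (Θ c) d x * E x =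
        (matPd (Θ d) c x * E x + Θ d x * matPd E c x - (matPd (Θ c) d x * E x + Θ c x * matPd E d x))
        - Θ d x * matPd E c x + Θ c x * matPd E d x := by abel
    rw [h3, this]
    abel
  simp only [matCurv, Matrix.add_mul, Matrix.sub_mul, Matrix.mul_add, Matrix.mul_sub]
  -- After inserting `∂E = E Θ' - Θ E`, the mixed products `Θ E Θ'` cancel and only the two
  -- commutators survive.
  rw [e1, h1 c, h1 d]
  simp only [Matrix.sub_mul, Matrix.mul_sub, Matrix.mul_assoc]
  abel

/-- The curvature of a metric connection is antisymmetric. -/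
theorem metric_mul_matCurv_antisymm [Fintype ι]
    {Θ : Fin k → EuclideanSpace ℝ (Fin k) → Matrix ι ι ℝ}
    {G : EuclideanSpace ℝ (Fin k) → Matrix ι ι ℝ} (hsymm : (G x)ᵀ = G x)
    (hG : MatContDiffAt 2 G x) (hΘ : ∀ a, MatContDiffAt 1 (Θ a) x)
    (h : ∀ a, ∀ᶠ y in 𝓝 x, matPd G a y = G y * Θ a y + (G y * Θ a y)ᵀ) (c d : Fin k) :
    (G x * matCurv Θ c d x)ᵀ = -(G x * matCurv Θ c d x) := by
  have hG1 := hG.of_le (s := 1) (by norm_num)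
  have h2 (a b : Fin k) : matPd (matPd G a) b x =
      matPd G b x * Θ a x + G x * matPd (Θ a) b x
        + (matPd G b x * Θ a x + G x * matPd (Θ a) b x)ᵀ := by
    rw [← matPd_mul hG1 (hΘ a), ← matPd_transpose,
      ← matPd_add (hG1.mul (hΘ a)) (hG1.mul (hΘ a)).transpose]
    exact matPd_congr (h a) b
  have h1 (a : Fin k) : matPd G a x = G x * Θ a x + (G x * Θ a x)ᵀ := (h a).self_of_nhds
  have hcd := h2 d c
  -- Equality of the mixed second derivatives of `G` is the integrability condition that yields the
  -- antisymmetry.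
  rw [matPd_comm hG d c, h2 c d, h1 c, h1 d] at hcd
  simp only [Matrix.transpose_add, Matrix.transpose_mul, Matrix.transpose_transpose, hsymm,
    Matrix.add_mul] at hcd
  simp only [matCurv, Matrix.transpose_add, Matrix.transpose_sub, Matrix.transpose_mul, hsymm,
    Matrix.mul_add, Matrix.mul_sub]
  simp only [Matrix.mul_assoc] at hcd ⊢
  rw [← sub_eq_zero] at hcd ⊢
  rw [← neg_eq_zero, ← hcd]
  abel

end MatrixCalculus

/-! ### Connections in coordinates -/

section Connections

variable {k N : ℕ}

/-- The matrices `(Γ_a)^c_b = Γ^c_{ab}` of a connection. -/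
def connMat (C : EuclideanSpace ℝ (Fin k) → Fin k → Fin k → Fin k → ℝ) (a : Fin k)
    (x : EuclideanSpace ℝ (Fin k)) : Matrix (Fin k) (Fin k) ℝ :=
  Matrix.of fun c b => C x c a b

theorem curvatureCoeff_eq_matCurv (C : EuclideanSpace ℝ (Fin k) → Fin k → Fin k → Fin k → ℝ)
    (x : EuclideanSpace ℝ (Fin k)) (a b c d : Fin k) :
    curvatureCoeff C x a b c d = matCurv (connMat C) c d x a b := by
  simp [curvatureCoeff, matCurv, matPd, connMat, Matrix.mul_apply, Finset.sum_sub_distrib]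

/-- The connection matrices of the pull-back along `f` of a connection. -/
def pullConn (C : EuclideanSpace ℝ (Fin N) → Fin N → Fin N → Fin N → ℝ)
    (f : EuclideanSpace ℝ (Fin k) → EuclideanSpace ℝ (Fin N)) (a : Fin k)
    (x : EuclideanSpace ℝ (Fin k)) : Matrix (Fin N) (Fin N) ℝ :=
  ∑ α, pd (fun y => f y α) a x • connMat C α (f x)

variable {C : EuclideanSpace ℝ (Fin N) → Fin N → Fin N → Fin N → ℝ}
  {f : EuclideanSpace ℝ (Fin k) → EuclideanSpace ℝ (Fin N)} {x : EuclideanSpace ℝ (Fin k)}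

theorem ContDiffAt.coord {r : WithTop ℕ∞} (hf : ContDiffAt ℝ r f x) (α : Fin N) :
    ContDiffAt ℝ r (fun y => f y α) x :=
  (EuclideanSpace.proj α : EuclideanSpace ℝ (Fin N) →L[ℝ] ℝ).contDiff.contDiffAt.comp x hf

theorem matContDiffAt_pullConn (hf : ContDiffAt ℝ 2 f x)
    (hC : ∀ α, MatContDiffAt 1 (connMat C α) (f x)) (a : Fin k) :
    MatContDiffAt 1 (pullConn C f a) x := fun μ ν => by
  simp only [pullConn, Matrix.sum_apply, Matrix.smul_apply, smul_eq_mul]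
  refine ContDiffAt.sum fun α _ => ((hf.coord α).pd (by norm_num) a).mul ?_
  exact (hC α μ ν).comp x (hf.of_le (by norm_num))

/-- Product rule plus chain rule. The sum with second derivatives of `f` is symmetric in `c`, `d`,
so it will disappear from the curvature. -/
theorem matPd_pullConn (hf : ContDiffAt ℝ 2 f x)
    (hC : ∀ α, MatContDiffAt 1 (connMat C α) (f x)) (c d : Fin k) :
    matPd (pullConn C f d) c x = (∑ α, pd (pd (fun y => f y α) d) c x • connMat C α (f x))
      + ∑ α, ∑ β, (pd (fun y => f y α) c x * pd (fun y => f y β) d x)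
        • matPd (connMat C β) α (f x) := by
  have hfd : DifferentiableAt ℝ f x := hf.differentiableAt (by norm_num)
  ext μ ν
  have h1 (α : Fin N) : DifferentiableAt ℝ (pd (fun y => f y α) d) x :=
    ((hf.coord α).pd (s := 1) (by norm_num) d).differentiableAt (by norm_num)
  have h2 (α : Fin N) := (hC α).differentiableAt μ ν
  have h3 (α : Fin N) : DifferentiableAt ℝ (fun y => connMat C α (f y) μ ν) x :=
    (h2 α).comp x hfd
  simp only [matPd, pullConn, Matrix.sum_apply, Matrix.smul_apply, smul_eq_mul, Matrix.of_apply,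
    Matrix.add_apply]
  rw [pd_sum fun α _ => (h1 α).fun_mul (h3 α), Finset.sum_comm, ← Finset.sum_add_distrib]
  refine Finset.sum_congr rfl fun α _ => ?_
  rw [pd_mul (h1 α) (h3 α), pd_comp (G := fun y => connMat C α y μ ν) hfd (h2 α), Finset.mul_sum]
  congr 1
  exact Finset.sum_congr rfl fun β _ => by ring

/-- The curvature of the pull-back of a connection is the pull-back of its curvature. -/
theorem matCurv_pullConn (hf : ContDiffAt ℝ 2 f x)
    (hC : ∀ α, MatContDiffAt 1 (connMat C α) (f x)) (c d : Fin k) :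
    matCurv (pullConn C f) c d x = ∑ α, ∑ β,
      (pd (fun y => f y α) c x * pd (fun y => f y β) d x) • matCurv (connMat C) α β (f x) := by
  have hmul (c d : Fin k) : pullConn C f c x * pullConn C f d x = ∑ α, ∑ β,
      (pd (fun y => f y α) c x * pd (fun y => f y β) d x) •
        (connMat C α (f x) * connMat C β (f x)) := by
    simp only [pullConn, Finset.sum_mul_sum, Matrix.smul_mul, Matrix.mul_smul, smul_smul]
    exact Finset.sum_congr rfl fun α _ => Finset.sum_congr rfl fun β _ => by
      rw [mul_comm (pd _ d x)]
  have hc (α : Fin N) : pd (pd (fun y => f y α) d) c x = pd (pd (fun y => f y α) c) d x :=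
    pd_comm (hf.coord α) d c
  rw [matCurv, matPd_pullConn hf hC, matPd_pullConn hf hC, hmul, hmul]
  simp only [hc, add_sub_add_left_eq_sub, matCurv, smul_add, smul_sub, Finset.sum_add_distrib,
    Finset.sum_sub_distrib]
  congr 2
  · rw [Finset.sum_comm]
    exact Finset.sum_congr rfl fun β _ => Finset.sum_congr rfl fun α _ => by rw [mul_comm]
  · rw [Finset.sum_comm]
    exact Finset.sum_congr rfl fun β _ => Finset.sum_congr rfl fun α _ => by rw [mul_comm]

end Connections

/-! ### The Levi-Civita connection in coordinates -/

section LeviCivita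

variable {N : ℕ}

/-- The Christoffel symbols `Γ^μ_{αβ}` of a matrix-valued function `G`. -/
def leviCivita (G : EuclideanSpace ℝ (Fin N) → Matrix (Fin N) (Fin N) ℝ)
    (y : EuclideanSpace ℝ (Fin N)) (μ α β : Fin N) : ℝ :=
  ∑ ν, (1 / 2) * (G y)⁻¹ μ ν *
    (pd (fun z => G z β ν) α y + pd (fun z => G z α ν) β y - pd (fun z => G z α β) ν y)

variable {G : EuclideanSpace ℝ (Fin N) → Matrix (Fin N) (Fin N) ℝ}
  {y : EuclideanSpace ℝ (Fin N)}

theorem leviCivita_symm (hG : ∀ z α β, G z α β = G z β α) (μ α β : Fin N) :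
    leviCivita G y μ α β = leviCivita G y μ β α := by
  refine Finset.sum_congr rfl fun ν _ => ?_
  simp only [fun z => hG z β α]
  ring

theorem sum_metric_mul_leviCivita (hdet : (G y).det ≠ 0) (μ α β : Fin N) :
    ∑ σ, G y μ σ * leviCivita G y σ α β =
      (1 / 2) * (pd (fun z => G z β μ) α y + pd (fun z => G z α μ) β y
        - pd (fun z => G z α β) μ y) := by
  have hinv : G y * (G y)⁻¹ = 1 := Matrix.mul_nonsing_inv _ (Ne.isUnit hdet)
  simp only [leviCivita, Finset.mul_sum]
  rw [Finset.sum_comm]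
  have (ν : Fin N) : ∑ σ, G y μ σ * (1 / 2 * (G y)⁻¹ σ ν *
      (pd (fun z => G z β ν) α y + pd (fun z => G z α ν) β y - pd (fun z => G z α β) ν y)) =
      (1 : Matrix (Fin N) (Fin N) ℝ) μ ν * ((1 / 2) *
      (pd (fun z => G z β ν) α y + pd (fun z => G z α ν) β y - pd (fun z => G z α β) ν y)) := by
    rw [← hinv, Matrix.mul_apply, Finset.sum_mul]
    exact Finset.sum_congr rfl fun σ _ => by ring
  rw [Finset.sum_congr rfl fun ν _ => this ν]
  simp [Matrix.one_apply]

/-- Metric compatibility: in the sum of the two lowered Christoffel symbols four of the six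
derivatives cancel and the other two coincide. -/
theorem matPd_metric_eq (hG : ∀ z α β, G z α β = G z β α) (hdet : (G y).det ≠ 0) (α : Fin N) :
    matPd G α y = G y * connMat (leviCivita G) α y + (G y * connMat (leviCivita G) α y)ᵀ := by
  ext μ ν
  simp only [matPd, connMat, Matrix.add_apply, Matrix.transpose_apply, Matrix.mul_apply,
    Matrix.of_apply, sum_metric_mul_leviCivita hdet]
  simp only [fun z => hG z ν μ]
  ring

theorem matContDiffAt_leviCivita (hG : MatContDiffAt 2 G y) (hdet : (G y).det ≠ 0) (α : Fin N) :
    MatContDiffAt 1 (connMat (leviCivita G) α) y := fun μ β => by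
  simp only [connMat, leviCivita, Matrix.of_apply]
  have hG' (a b c : Fin N) : ContDiffAt ℝ 1 (fun z => pd (fun w => G w a b) c z) y :=
    (hG a b).pd (by norm_num) c
  exact ContDiffAt.sum fun ν _ => (contDiffAt_const.mul
    ((hG.of_le (by norm_num)).inv hdet μ ν)).mul (((hG' _ _ _).add (hG' _ _ _)).sub (hG' _ _ _))

theorem curvature_leviCivita_antisymm (hsymm : ∀ z α β, G z α β = G z β α)
    (hG : MatContDiffAt 2 G y) (hdet : (G y).det ≠ 0) (c d : Fin N) :
    (G y * matCurv (connMat (leviCivita G)) c d y)ᵀ =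
      -(G y * matCurv (connMat (leviCivita G)) c d y) := by
  refine metric_mul_matCurv_antisymm (Matrix.ext fun i j => hsymm y j i) hG
    (matContDiffAt_leviCivita hG hdet) (fun a => ?_) c d
  have hc : ContinuousAt (fun z => (G z).det) y := hG.det.continuousAt
  -- Metric compatibility is needed on a neighbourhood, where the determinant stays nonzero.
  filter_upwards [hc.eventually_ne hdet] with z hz
  exact matPd_metric_eq hsymm hz a

end LeviCivita

/-! ### Hypersurfaces with a rigging, in coordinates -/

section RiggedHypersurface

variable {m N : ℕ}

/-- The frame `(∂_a f, l)` along the map `f`. -/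
def rigFrame (f : EuclideanSpace ℝ (Fin m) → EuclideanSpace ℝ (Fin N))
    (l : EuclideanSpace ℝ (Fin m) → Fin N → ℝ) (x : EuclideanSpace ℝ (Fin m)) :
    Matrix (Fin N) (Fin m ⊕ Unit) ℝ :=
  Matrix.of fun μ => Sum.elim (fun a => pd (fun y => f y μ) a x) (fun _ => l x μ)

/-- The components `⟨e_A, ∇_a e_B⟩` of the derivatives of the frame `(∂_a f, l)`. -/
def lowFrameDeriv (G : EuclideanSpace ℝ (Fin N) → Matrix (Fin N) (Fin N) ℝ)
    (f : EuclideanSpace ℝ (Fin m) → EuclideanSpace ℝ (Fin N))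
    (l : EuclideanSpace ℝ (Fin m) → Fin N → ℝ) (a : Fin m) (x : EuclideanSpace ℝ (Fin m)) :
    Matrix (Fin m ⊕ Unit) (Fin m ⊕ Unit) ℝ :=
  (rigFrame f l x)ᵀ * G (f x) *
    (matPd (rigFrame f l) a x + pullConn (leviCivita G) f a x * rigFrame f l x)

/-- The pull-back along `f` of the Lie derivative of `G` along `l`. -/
def pullLie (G : EuclideanSpace ℝ (Fin N) → Matrix (Fin N) (Fin N) ℝ)
    (f : EuclideanSpace ℝ (Fin m) → EuclideanSpace ℝ (Fin N))
    (l : EuclideanSpace ℝ (Fin m) → Fin N → ℝ) (x : EuclideanSpace ℝ (Fin m)) (a b : Fin m) : ℝ :=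
  ((rigFrame f l x)ᵀ * (∑ μ, l x μ • matPd G μ (f x)) * rigFrame f l x) (Sum.inl a) (Sum.inl b)
    + ((rigFrame f l x)ᵀ * G (f x) * matPd (rigFrame f l) a x) (Sum.inl b) (Sum.inr ())
    + ((rigFrame f l x)ᵀ * G (f x) * matPd (rigFrame f l) b x) (Sum.inl a) (Sum.inr ())

/-- The connection matrices with lowered index determined by the metric `h` of the frame
`(e_a, l)` and by the tensor `Y`. -/
def lowConn (h : EuclideanSpace ℝ (Fin m) → Matrix (Fin m ⊕ Unit) (Fin m ⊕ Unit) ℝ)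
    (Y : EuclideanSpace ℝ (Fin m) → Fin m → Fin m → ℝ) (a : Fin m)
    (x : EuclideanSpace ℝ (Fin m)) : Matrix (Fin m ⊕ Unit) (Fin m ⊕ Unit) ℝ :=
  Matrix.fromBlocks
    (Matrix.of fun b c => (1 / 2) * (pd (fun y => h y (Sum.inl c) (Sum.inl b)) a x
      + pd (fun y => h y (Sum.inl a) (Sum.inl b)) c x
      - pd (fun y => h y (Sum.inl a) (Sum.inl c)) b x))
    (Matrix.of fun b _ => (1 / 2) * (pd (fun y => h y (Sum.inl b) (Sum.inr ())) a x
      - pd (fun y => h y (Sum.inl a) (Sum.inr ())) b x) + Y x a b)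
    (Matrix.of fun _ c => (1 / 2) * (pd (fun y => h y (Sum.inl c) (Sum.inr ())) a x
      + pd (fun y => h y (Sum.inl a) (Sum.inr ())) c x) - Y x a c)
    (Matrix.of fun _ _ => (1 / 2) * pd (fun y => h y (Sum.inr ()) (Sum.inr ())) a x)

variable {G : EuclideanSpace ℝ (Fin N) → Matrix (Fin N) (Fin N) ℝ}
  {f : EuclideanSpace ℝ (Fin m) → EuclideanSpace ℝ (Fin N)}
  {l : EuclideanSpace ℝ (Fin m) → Fin N → ℝ} {x : EuclideanSpace ℝ (Fin m)}

theorem matContDiffAt_rigFrame {r s : WithTop ℕ∞} (hf : ContDiffAt ℝ r f x) (hr : s + 1 ≤ r)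
    (hl : ∀ μ, ContDiffAt ℝ s (fun y => l y μ) x) : MatContDiffAt s (rigFrame f l) x := by
  rintro μ (a | a)
  · exact (hf.coord μ).pd hr a
  · exact hl μ

theorem matPd_comp {ι κ : Type*} {A : EuclideanSpace ℝ (Fin N) → Matrix ι κ ℝ}
    (hf : DifferentiableAt ℝ f x) (hA : MatContDiffAt 1 A (f x)) (a : Fin m) :
    matPd (fun y => A (f y)) a x = ∑ μ, pd (fun y => f y μ) a x • matPd A μ (f x) := by
  ext i j
  simp only [matPd, Matrix.of_apply, Matrix.sum_apply, Matrix.smul_apply, smul_eq_mul]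
  exact pd_comp (G := fun z => A z i j) hf (hA.differentiableAt i j) a

/-- The Christoffel half of `∇_a ∂_b f = ∇_b ∂_a f`. -/
theorem pullConn_mul_rigFrame_inl (hG : ∀ z α β, G z α β = G z β α) (a b : Fin m) (σ : Fin N) :
    (pullConn (leviCivita G) f a x * rigFrame f l x) σ (Sum.inl b) =
      (pullConn (leviCivita G) f b x * rigFrame f l x) σ (Sum.inl a) := by
  simp only [pullConn, connMat, rigFrame, Matrix.mul_apply, Matrix.sum_apply, Matrix.smul_apply,
    Matrix.of_apply, smul_eq_mul, Finset.sum_mul, Sum.elim_inl]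
  rw [Finset.sum_comm]
  refine Finset.sum_congr rfl fun α _ => Finset.sum_congr rfl fun β _ => ?_
  rw [leviCivita_symm hG]
  ring

/-- Symmetry of `Γ` lets `l` take the place of the differentiation direction; this creates the
`l`-derivative of the metric that occurs in the Lie derivative. -/
theorem pullConn_mul_rigFrame_inr (hG : ∀ z α β, G z α β = G z β α) (b : Fin m) (σ : Fin N) :
    (pullConn (leviCivita G) f b x * rigFrame f l x) σ (Sum.inr ()) =
      ((∑ μ, l x μ • connMat (leviCivita G) μ (f x)) * rigFrame f l x) σ (Sum.inl b) := by
  simp only [pullConn, connMat, rigFrame, Matrix.mul_apply, Matrix.sum_apply, Matrix.smul_apply,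
    Matrix.of_apply, smul_eq_mul, Finset.sum_mul, Sum.elim_inl, Sum.elim_inr]
  rw [Finset.sum_comm]
  refine Finset.sum_congr rfl fun α _ => Finset.sum_congr rfl fun β _ => ?_
  rw [leviCivita_symm hG]
  ring

/-- Leibniz rule for `⟨e_A, e_B⟩` under a metric connection. -/
theorem lowFrameDeriv_add_transpose (hG : ∀ z α β, G z α β = G z β α)
    (hGc : MatContDiffAt 1 G (f x)) (hdet : (G (f x)).det ≠ 0) (hf : ContDiffAt ℝ 2 f x)
    (hl : ∀ μ, ContDiffAt ℝ 1 (fun y => l y μ) x) (a : Fin m) :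
    lowFrameDeriv G f l a x + (lowFrameDeriv G f l a x)ᵀ =
      matPd (fun y => (rigFrame f l y)ᵀ * G (f y) * rigFrame f l y) a x := by
  have hE : MatContDiffAt 1 (rigFrame f l) x := matContDiffAt_rigFrame hf (by norm_num) hl
  have hGf : MatContDiffAt 1 (fun y => G (f y)) x :=
    fun i j => (hGc i j).comp x (hf.of_le (by norm_num))
  have hGt : (G (f x))ᵀ = G (f x) := Matrix.ext fun i j => hG _ _ _
  have hdG : matPd (fun y => G (f y)) a x = G (f x) * pullConn (leviCivita G) f a x
      + (G (f x) * pullConn (leviCivita G) f a x)ᵀ := by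
    rw [matPd_comp (hf.differentiableAt (by norm_num)) hGc]
    simp only [matPd_metric_eq hG hdet, pullConn, Finset.mul_sum, Matrix.mul_smul, smul_add,
      Finset.sum_add_distrib, Matrix.transpose_sum, Matrix.transpose_smul]
  rw [matPd_mul (hE.transpose.mul hGf) hE, matPd_mul hE.transpose hGf, matPd_transpose, hdG]
  simp only [lowFrameDeriv, Matrix.transpose_mul, Matrix.transpose_add, Matrix.transpose_transpose,
    Matrix.add_mul, Matrix.mul_add, hGt, Matrix.mul_assoc]
  abel

/-- Absence of torsion: second partial derivatives of `f` commute and the Christoffel symbols are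
symmetric. -/
theorem lowFrameDeriv_inl_symm (hG : ∀ z α β, G z α β = G z β α) (hf : ContDiffAt ℝ 2 f x)
    (a b : Fin m) (A : Fin m ⊕ Unit) :
    lowFrameDeriv G f l a x A (Sum.inl b) = lowFrameDeriv G f l b x A (Sum.inl a) := by
  rw [lowFrameDeriv, lowFrameDeriv, Matrix.mul_apply, Matrix.mul_apply]
  refine Finset.sum_congr rfl fun σ _ => ?_
  congr 1
  rw [Matrix.add_apply, Matrix.add_apply, pullConn_mul_rigFrame_inl hG]
  congr 1
  exact pd_comm (hf.coord σ) b a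

/-- The identity `(£_l g)_ab = ⟨e_b, ∇_a l⟩ + ⟨e_a, ∇_b l⟩`. Only tangential derivatives of `l`
enter, so no extension off the hypersurface is needed here. -/
theorem lowFrameDeriv_inr_add (hG : ∀ z α β, G z α β = G z β α) (hdet : (G (f x)).det ≠ 0)
    (a b : Fin m) :
    lowFrameDeriv G f l a x (Sum.inl b) (Sum.inr ()) + lowFrameDeriv G f l b x (Sum.inl a) (Sum.inr ())
      = pullLie G f l x a b := by
  set E := rigFrame f l x with hE
  set B := ∑ μ, l x μ • connMat (leviCivita G) μ (f x) with hB
  have hGt : (G (f x))ᵀ = G (f x) := Matrix.ext fun i j => hG _ _ _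
  have hdG : ∑ μ, l x μ • matPd G μ (f x) = G (f x) * B + (G (f x) * B)ᵀ := by
    simp only [hB, matPd_metric_eq hG hdet, Finset.mul_sum, Matrix.mul_smul, smul_add,
      Finset.sum_add_distrib, Matrix.transpose_sum, Matrix.transpose_smul]
  have key (c d : Fin m) : lowFrameDeriv G f l c x (Sum.inl d) (Sum.inr ()) =
      (Eᵀ * G (f x) * matPd (rigFrame f l) c x) (Sum.inl d) (Sum.inr ())
        + (Eᵀ * G (f x) * (B * E)) (Sum.inl d) (Sum.inl c) := by
    rw [lowFrameDeriv, Matrix.mul_add, Matrix.add_apply]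
    congr 1
    rw [Matrix.mul_apply, Matrix.mul_apply]
    exact Finset.sum_congr rfl fun σ _ => by rw [pullConn_mul_rigFrame_inr hG]
  have ht : (Eᵀ * G (f x) * (B * E)) (Sum.inl b) (Sum.inl a) =
      (Eᵀ * (G (f x) * B)ᵀ * E) (Sum.inl a) (Sum.inl b) := by
    rw [← Matrix.transpose_apply (Eᵀ * G (f x) * (B * E))]
    simp only [Matrix.transpose_mul, Matrix.transpose_transpose, hGt, Matrix.mul_assoc]
  rw [key, key, pullLie, ← hE, hdG, Matrix.mul_add, Matrix.add_mul, Matrix.add_apply, ht]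
  simp only [Matrix.mul_assoc]
  ring

/-- A Koszul argument. For tangential indices it is the classical one. For `⟨e_b, ∇_a l⟩` the
antisymmetric part comes from the derivatives of `ℓ_a`, and the symmetric part must be supplied as
`Y`. -/
theorem eq_lowConn {h : EuclideanSpace ℝ (Fin m) → Matrix (Fin m ⊕ Unit) (Fin m ⊕ Unit) ℝ}
    {Y : EuclideanSpace ℝ (Fin m) → Fin m → Fin m → ℝ}
    {W : Fin m → Matrix (Fin m ⊕ Unit) (Fin m ⊕ Unit) ℝ}
    (h1 : ∀ a, W a + (W a)ᵀ = matPd h a x)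
    (h2 : ∀ a b A, W a A (Sum.inl b) = W b A (Sum.inl a))
    (h3 : ∀ a b, W a (Sum.inl b) (Sum.inr ()) + W b (Sum.inl a) (Sum.inr ()) = 2 * Y x a b)
    (a : Fin m) : W a = lowConn h Y a x := by
  have h1' (a A B) : W a A B + W a B A = pd (fun y => h y A B) a x :=
    congrFun (congrFun (h1 a) A) B
  ext A B
  rcases A with b | u <;> rcases B with c | v
  · simp only [lowConn, Matrix.fromBlocks_apply₁₁, Matrix.of_apply, ← h1']
    -- With the lower pairs brought into a common order, all products of the frame derivatives
    -- except the wanted one cancel.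
    rw [h2 c a, h2 b c, h2 b a (Sum.inl c)]
    ring
  · simp only [lowConn, Matrix.fromBlocks_apply₁₂, Matrix.of_apply, ← h1']
    have := h3 a b
    rw [h2 b a (Sum.inr ())]
    cases v
    linarith
  · simp only [lowConn, Matrix.fromBlocks_apply₂₁, Matrix.of_apply, ← h1']
    have := h3 a c
    rw [h2 c a (Sum.inr ())]
    cases u
    linarith
  · simp only [lowConn, Matrix.fromBlocks_apply₂₂, Matrix.of_apply, ← h1']
    ring

/-- The connection matrices of the ambient connection in the frame `(e_a, l)`. -/
def frameConn (h : EuclideanSpace ℝ (Fin m) → Matrix (Fin m ⊕ Unit) (Fin m ⊕ Unit) ℝ)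
    (Y : EuclideanSpace ℝ (Fin m) → Fin m → Fin m → ℝ) (a : Fin m)
    (x : EuclideanSpace ℝ (Fin m)) : Matrix (Fin m ⊕ Unit) (Fin m ⊕ Unit) ℝ :=
  (h x)⁻¹ * lowConn h Y a x

theorem matContDiffAt_lowConn
    {h : EuclideanSpace ℝ (Fin m) → Matrix (Fin m ⊕ Unit) (Fin m ⊕ Unit) ℝ}
    {Y : EuclideanSpace ℝ (Fin m) → Fin m → Fin m → ℝ} (hh : MatContDiffAt 2 h x)
    (hY : ∀ a b, ContDiffAt ℝ 1 (fun y => Y y a b) x) (a : Fin m) :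
    MatContDiffAt 1 (lowConn h Y a) x := by
  have h' (A B c) : ContDiffAt ℝ 1 (fun y => pd (fun z => h z A B) c y) x :=
    (hh A B).pd (by norm_num) c
  rintro (b | b) (c | c)
  · exact contDiffAt_const.mul (((h' _ _ _).add (h' _ _ _)).sub (h' _ _ _))
  · exact (contDiffAt_const.mul ((h' _ _ _).sub (h' _ _ _))).add (hY _ _)
  · exact (contDiffAt_const.mul ((h' _ _ _).add (h' _ _ _))).sub (hY _ _)
  · exact contDiffAt_const.mul (h' _ _ _)

/-- `h⁻¹ Eᵀ g` is a left inverse of `E` by construction. Rows and columns are equal in number, so it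
is also a right inverse. -/
theorem rigFrame_mul_inv {h : EuclideanSpace ℝ (Fin m) → Matrix (Fin m ⊕ Unit) (Fin m ⊕ Unit) ℝ}
    {E : Matrix (Fin (m + 1)) (Fin m ⊕ Unit) ℝ} {g : Matrix (Fin (m + 1)) (Fin (m + 1)) ℝ}
    (hh : h x = Eᵀ * g * E) (hdet : (h x).det ≠ 0) : E * ((h x)⁻¹ * (Eᵀ * g)) = 1 := by
  rw [Matrix.mul_eq_one_comm_of_card_eq _ _ _ (by simp), Matrix.mul_assoc, ← hh]
  exact Matrix.nonsing_inv_mul _ (Ne.isUnit hdet)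

/-- The ambient curvature on tangential arguments, in the frame `(∂_a f, l)`, is the curvature of
`frameConn`. -/
theorem matCurv_pullConn_mul_rigFrame
    {G : EuclideanSpace ℝ (Fin (m + 1)) → Matrix (Fin (m + 1)) (Fin (m + 1)) ℝ}
    {f : EuclideanSpace ℝ (Fin m) → EuclideanSpace ℝ (Fin (m + 1))}
    {l : EuclideanSpace ℝ (Fin m) → Fin (m + 1) → ℝ}
    {h : EuclideanSpace ℝ (Fin m) → Matrix (Fin m ⊕ Unit) (Fin m ⊕ Unit) ℝ}
    {Y : EuclideanSpace ℝ (Fin m) → Fin m → Fin m → ℝ}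
    (hG : ∀ z α β, G z α β = G z β α)
    (hGc : MatContDiffAt 2 G (f x)) (hdet : (G (f x)).det ≠ 0) (hf : ContDiffAt ℝ 3 f x)
    (hl : ∀ μ, ContDiffAt ℝ 2 (fun y => l y μ) x)
    (hh : ∀ᶠ y in 𝓝 x, h y = (rigFrame f l y)ᵀ * G (f y) * rigFrame f l y)
    (hhc : MatContDiffAt 2 h x) (hhdet : (h x).det ≠ 0)
    (hYc : ∀ a b, ContDiffAt ℝ 1 (fun y => Y y a b) x)
    (hY : ∀ᶠ y in 𝓝 x, ∀ a b, 2 * Y y a b = pullLie G f l y a b) (c d : Fin m) :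
    matCurv (pullConn (leviCivita G) f) c d x * rigFrame f l x =
      rigFrame f l x * matCurv (frameConn h Y) c d x := by
  have hfc : ContinuousAt f x := hf.continuousAt
  refine matCurv_mul_frame (Θ' := frameConn h Y) (matContDiffAt_rigFrame hf (by norm_num) hl)
    (matContDiffAt_pullConn (hf.of_le (by norm_num)) (matContDiffAt_leviCivita hGc hdet))
    (fun a => ((hhc.of_le (by norm_num)).inv hhdet).mul (matContDiffAt_lowConn hhc hYc a))
    (fun a => ?_) c d
  -- The frame equation must hold near `x` and not merely at `x`, since the curvature differentiates
  -- it; hence the hypotheses are first spread to a neighbourhood.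
  have e1 : ∀ᶠ y in 𝓝 x, (G (f y)).det ≠ 0 :=
    hfc.eventually (hGc.det.continuousAt.eventually_ne hdet)
  have e2 : ∀ᶠ y in 𝓝 x, (h y).det ≠ 0 := hhc.det.continuousAt.eventually_ne hhdet
  have e3 : ∀ᶠ y in 𝓝 x, ContDiffAt ℝ 2 f y :=
    (hf.of_le (by norm_num)).eventually (by simp)
  have e4 : ∀ᶠ y in 𝓝 x, ∀ μ, ContDiffAt ℝ 1 (fun y => l y μ) y :=
    eventually_all.2 fun μ => ((hl μ).of_le (by norm_num)).eventually (by simp)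
  have e5 : ∀ᶠ y in 𝓝 x, MatContDiffAt 1 G (f y) :=
    hfc.eventually (eventually_all.2 fun i => eventually_all.2 fun j =>
      ((hGc i j).of_le (by norm_num)).eventually (by simp))
  filter_upwards [e1, e2, e3, e4, e5, hh.eventually_nhds, hY] with y y1 y2 y3 y4 y5 y6 y7
  have hW : lowFrameDeriv G f l a y = lowConn h Y a y := by
    refine eq_lowConn (W := fun a => lowFrameDeriv G f l a y) (fun a => ?_)
      (lowFrameDeriv_inl_symm hG y3) (fun a b => ?_) a
    · rw [lowFrameDeriv_add_transpose hG y5 y1 y3 y4]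
      exact (matPd_congr y6 a).symm
    · rw [lowFrameDeriv_inr_add hG y1, y7]
  rw [frameConn, ← hW, lowFrameDeriv]
  -- `E h⁻¹ Eᵀ G = 1` recovers `∇_a E` from its inner products with the frame.
  have hinv := rigFrame_mul_inv y6.self_of_nhds y2
  simp only [← Matrix.mul_assoc] at hinv ⊢
  rw [hinv, Matrix.one_mul]

end RiggedHypersurface

/-! ### Contractions of a curvature tensor in a frame `(e_a, l)` -/

section FrameContractions

variable {m : ℕ}

/-! ### Contractions that involve only tangential curvature -/

section Antisymmetric

variable {h H : Matrix (Fin m ⊕ Unit) (Fin m ⊕ Unit) ℝ}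
  {R : Fin m ⊕ Unit → Fin m ⊕ Unit → Fin m ⊕ Unit → Fin m ⊕ Unit → ℝ}
  {X : Fin m → Fin m → Matrix (Fin m ⊕ Unit) (Fin m ⊕ Unit) ℝ}

theorem sum_symm_mul_antisymm {ι : Type*} [Fintype ι] {A : ι → ι → ℝ} (v : ι → ℝ)
    (hA : ∀ i j, A i j = -A j i) : ∑ i, v i * ∑ j, v j * A i j = 0 := by
  have : ∑ i, v i * ∑ j, v j * A i j = -∑ i, v i * ∑ j, v j * A i j := by
    conv_lhs => rw [Finset.sum_congr rfl fun i _ => Finset.mul_sum _ _ _, Finset.sum_comm]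
    rw [← Finset.sum_neg_distrib]
    refine Finset.sum_congr rfl fun i _ => ?_
    rw [Finset.mul_sum, ← Finset.sum_neg_distrib]
    refine Finset.sum_congr rfl fun j _ => ?_
    rw [hA j i]
    ring
  linarith

theorem frame_apply_eq (hH : H * h = 1) (hX : ∀ c d A B, R A B (Sum.inl c) (Sum.inl d) =
    (h * X c d) A B) (c d : Fin m) (A B : Fin m ⊕ Unit) :
    ∑ C, H A C * R C B (Sum.inl c) (Sum.inl d) = X c d A B := by
  simp only [hX]
  rw [← Matrix.mul_apply, ← Matrix.mul_assoc, hH, Matrix.one_mul]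

/-- The row `H (inr) ·` holds the frame components of the normal vector. For `C` transverse this row
appears twice, contracted with the antisymmetric pair `A`, `B`, and the term vanishes. What remains
has last pair tangential, where `R` is known through `X`. -/
theorem sum_contract_inl (hH : H * h = 1) (hsymm : ∀ A B, H A B = H B A)
    (hR : ∀ A B C D, R A B C D = -R B A C D)
    (hX : ∀ c d A B, R A B (Sum.inl c) (Sum.inl d) = (h * X c d) A B) (c : Fin m) :
    ∑ B, H (Sum.inr ()) B * ∑ A, ∑ C, H A C * R A B C (Sum.inl c) =
      -(∑ b, ∑ d, H (Sum.inl b) (Sum.inl d) * X d c (Sum.inr ()) (Sum.inl b))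
      + ∑ b, ∑ d, H (Sum.inl b) (Sum.inr ()) * H (Sum.inl d) (Sum.inr ())
        * (h * X d c) (Sum.inr ()) (Sum.inl b) := by
  have h0 := sum_symm_mul_antisymm (A := fun A B => R A B (Sum.inr ()) (Sum.inl c))
    (fun A => H (Sum.inr ()) A) (fun A B => hR A B _ _)
  have hz (d) : R (Sum.inr ()) (Sum.inr ()) (Sum.inl d) (Sum.inl c) = 0 := by
    linarith [hR (Sum.inr ()) (Sum.inr ()) (Sum.inl d) (Sum.inl c)]
  -- The transverse diagonal entry of `X` is rewritten through the lowered row, using `R_{llcd} =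
  -- 0`.
  have hll (d : Fin m) : X d c (Sum.inr ()) (Sum.inr ()) =
      -∑ b, H (Sum.inl b) (Sum.inr ()) * (h * X d c) (Sum.inr ()) (Sum.inl b) := by
    rw [← frame_apply_eq hH hX, Fintype.sum_sum_type]
    simp only [Finset.univ_unique, Finset.sum_singleton]
    rw [show (default : Unit) = () from rfl, hz, mul_zero, add_zero, ← Finset.sum_neg_distrib]
    exact Finset.sum_congr rfl fun b _ => by rw [hR, hX, hsymm]; ring
  have step (A : Fin m ⊕ Unit) (d : Fin m) :
      ∑ B, H (Sum.inr ()) B * R A B (Sum.inl d) (Sum.inl c) = -X d c (Sum.inr ()) A := by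
    rw [← frame_apply_eq hH hX, ← Finset.sum_neg_distrib]
    exact Finset.sum_congr rfl fun B _ => by rw [hR]; ring
  have e1 : ∑ B, H (Sum.inr ()) B * ∑ A, ∑ C, H A C * R A B C (Sum.inl c) =
      ∑ A, ∑ C, H A C * ∑ B, H (Sum.inr ()) B * R A B C (Sum.inl c) := by
    simp only [Finset.mul_sum]
    rw [Finset.sum_comm]
    refine Finset.sum_congr rfl fun A _ => ?_
    rw [Finset.sum_comm]
    exact Finset.sum_congr rfl fun B _ => Finset.sum_congr rfl fun C _ => by ring
  have e2 (A) : ∑ C, H A C * ∑ B, H (Sum.inr ()) B * R A B C (Sum.inl c) =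
      (∑ d, H A (Sum.inl d) * -X d c (Sum.inr ()) A)
        + H (Sum.inr ()) A * ∑ B, H (Sum.inr ()) B * R A B (Sum.inr ()) (Sum.inl c) := by
    rw [Fintype.sum_sum_type]
    simp only [step, Finset.univ_unique, Finset.sum_singleton]
    rw [show (default : Unit) = () from rfl, hsymm A (Sum.inr ())]
  rw [e1, Finset.sum_congr rfl fun A _ => e2 A, Finset.sum_add_distrib, h0, add_zero,
    Fintype.sum_sum_type]
  simp only [Finset.univ_unique, Finset.sum_singleton]
  rw [show (default : Unit) = () from rfl]
  simp only [hll, mul_neg, Finset.sum_neg_distrib, neg_neg, Finset.mul_sum]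
  congr 1
  rw [Finset.sum_comm]
  exact Finset.sum_congr rfl fun b _ => Finset.sum_congr rfl fun d _ => by
    rw [hsymm (Sum.inr ())]; ring

/-- In the scalar curvature the terms with `C` transverse and those with `D` transverse each equal
the Ricci term `L`, and both transverse gives zero. Hence `L` minus half the scalar leaves minus
half of the doubly tangential part. -/
theorem sum_contract_inr (hH : H * h = 1) (hsymm : ∀ A B, H A B = H B A)
    (hR : ∀ A B C D, R A B C D = -R B A C D) (hR' : ∀ A B C D, R A B C D = -R A B D C)
    (hX : ∀ c d A B, R A B (Sum.inl c) (Sum.inl d) = (h * X c d) A B) :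
    (∑ B, H (Sum.inr ()) B * ∑ A, ∑ C, H A C * R A B C (Sum.inr ()))
      - (1 / 2) * ∑ B, ∑ D, H B D * ∑ A, ∑ C, H A C * R A B C D =
      -(1 / 2) * ((∑ b, ∑ c, ∑ d, H (Sum.inl b) (Sum.inl d) * X c d (Sum.inl c) (Sum.inl b))
      + ∑ b, ∑ c, ∑ d, H (Sum.inl b) (Sum.inl d) * H (Sum.inl c) (Sum.inr ())
        * (h * X c d) (Sum.inr ()) (Sum.inl b)) := by
  have hz (c d) : R (Sum.inr ()) (Sum.inr ()) (Sum.inl c) (Sum.inl d) = 0 := by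
    linarith [hR (Sum.inr ()) (Sum.inr ()) (Sum.inl c) (Sum.inl d)]
  have hz' (A B) : R A B (Sum.inr ()) (Sum.inr ()) = 0 := by
    linarith [hR' A B (Sum.inr ()) (Sum.inr ())]
  have hX' (c d A B) : (h * X c d) A B = -(h * X d c) A B := by rw [← hX, ← hX, hR']
  -- This trades the image of `l` for the lowered row `⟨l, R(e_c, e_d) e_b⟩`.
  have hcl (c d : Fin m) : X c d (Sum.inl c) (Sum.inr ()) =
      -∑ b, H (Sum.inl b) (Sum.inl c) * (h * X c d) (Sum.inr ()) (Sum.inl b) := by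
    rw [← frame_apply_eq hH hX, Fintype.sum_sum_type]
    simp only [Finset.univ_unique, Finset.sum_singleton]
    rw [show (default : Unit) = () from rfl, hz, mul_zero, add_zero, ← Finset.sum_neg_distrib]
    exact Finset.sum_congr rfl fun b _ => by rw [hR, hX, hsymm]; ring
  set L := ∑ B, H (Sum.inr ()) B * ∑ A, ∑ C, H A C * R A B C (Sum.inr ()) with hL
  have hL1 : L = ∑ A, ∑ B, ∑ c, H A (Sum.inl c) * H B (Sum.inr ()) * R A B (Sum.inl c)
      (Sum.inr ()) := by
    rw [hL, Finset.sum_comm]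
    refine Finset.sum_congr rfl fun B _ => ?_
    rw [Finset.mul_sum]
    refine Finset.sum_congr rfl fun A _ => ?_
    rw [Fintype.sum_sum_type, mul_add, Finset.mul_sum]
    simp only [Finset.univ_unique, Finset.sum_singleton]
    rw [show (default : Unit) = () from rfl, hz', mul_zero, mul_zero, add_zero]
    exact Finset.sum_congr rfl fun c _ => by rw [hsymm (Sum.inr ())]; ring
  have hT (B) (d : Fin m) : ∑ A, ∑ C, H A C * R A B C (Sum.inl d) =
      (∑ c, X c d (Sum.inl c) B) + ∑ A, H A (Sum.inr ()) * R A B (Sum.inr ()) (Sum.inl d) := by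
    rw [Finset.sum_comm, Fintype.sum_sum_type]
    simp only [Finset.univ_unique, Finset.sum_singleton]
    rw [show (default : Unit) = () from rfl]
    congr 1
    exact Finset.sum_congr rfl fun c _ => by
      rw [← frame_apply_eq hH hX]
      exact Finset.sum_congr rfl fun A _ => by rw [hsymm]
  have hS : ∑ B, ∑ D, H B D * ∑ A, ∑ C, H A C * R A B C D =
      (∑ B, ∑ d, H B (Sum.inl d) * ∑ c, X c d (Sum.inl c) B) + 2 * L := by
    have e1 (B) : ∑ D, H B D * ∑ A, ∑ C, H A C * R A B C D =
        (∑ d, H B (Sum.inl d) * ∑ c, X c d (Sum.inl c) B)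
        + (∑ A, ∑ d, H B (Sum.inl d) * H A (Sum.inr ()) * R B A (Sum.inl d) (Sum.inr ()))
        + H (Sum.inr ()) B * ∑ A, ∑ C, H A C * R A B C (Sum.inr ()) := by
      rw [Fintype.sum_sum_type]
      simp only [hT, Finset.univ_unique, Finset.sum_singleton]
      rw [show (default : Unit) = () from rfl, hsymm B (Sum.inr ())]
      congr 1
      rw [Finset.sum_comm, ← Finset.sum_add_distrib]
      refine Finset.sum_congr rfl fun d _ => ?_
      rw [mul_add]
      congr 1
      rw [Finset.mul_sum]
      -- Reversing both antisymmetric pairs identifies the `C`-transverse sum with `L`.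
      exact Finset.sum_congr rfl fun A _ => by rw [hR, hR']; ring
    rw [Finset.sum_congr rfl fun B _ => e1 B, Finset.sum_add_distrib, Finset.sum_add_distrib,
      ← hL1, ← hL]
    ring
  have hF : ∑ B, ∑ d, H B (Sum.inl d) * ∑ c, X c d (Sum.inl c) B =
      (∑ b, ∑ c, ∑ d, H (Sum.inl b) (Sum.inl d) * X c d (Sum.inl c) (Sum.inl b))
      + ∑ b, ∑ c, ∑ d, H (Sum.inl b) (Sum.inl d) * H (Sum.inl c) (Sum.inr ())
        * (h * X c d) (Sum.inr ()) (Sum.inl b) := by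
    rw [Fintype.sum_sum_type]
    simp only [Finset.univ_unique, Finset.sum_singleton]
    rw [show (default : Unit) = () from rfl]
    congr 1
    · refine Finset.sum_congr rfl fun b _ => ?_
      rw [Finset.sum_comm]
      exact Finset.sum_congr rfl fun d _ => Finset.mul_sum _ _ _
    · simp only [hcl, ← Finset.sum_neg_distrib, Finset.mul_sum]
      have : ∀ F : Fin m → Fin m → Fin m → ℝ, ∑ d, ∑ c, ∑ b, F b c d =
          ∑ b, ∑ d, ∑ c, F b c d := fun F => by
        rw [Finset.sum_congr rfl fun d _ => Finset.sum_comm, Finset.sum_comm]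
      rw [this fun b c d => _]
      exact Finset.sum_congr rfl fun b _ => Finset.sum_congr rfl fun c _ =>
        Finset.sum_congr rfl fun d _ => by rw [hX' d c, hsymm (Sum.inr ())]; ring
  rw [hS, hF]
  ring

end Antisymmetric

/-! ### The Einstein tensor in frame components -/

section Einstein

variable {E : Matrix (Fin (m + 1)) (Fin m ⊕ Unit) ℝ} {G : Matrix (Fin (m + 1)) (Fin (m + 1)) ℝ}
  {h : Matrix (Fin m ⊕ Unit) (Fin m ⊕ Unit) ℝ}

theorem frame_inverse (hh : h = Eᵀ * G * E) (hdet : h.det ≠ 0) : E * h⁻¹ * Eᵀ * G = 1 := by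
  -- A constant matrix function at an arbitrary point reduces the claim to the pointwise lemma.
  have := rigFrame_mul_inv (x := (0 : EuclideanSpace ℝ (Fin m))) (h := fun _ => h) hh hdet
  simpa only [Matrix.mul_assoc] using this

theorem inverse_eq_frame (hh : h = Eᵀ * G * E) (hdet : h.det ≠ 0) : G⁻¹ = E * h⁻¹ * Eᵀ :=
  Matrix.inv_eq_left_inv (frame_inverse hh hdet)

/-- The frame components `⟨e_A, R(e_C, e_D) e_B⟩` of a curvature tensor with matrices
`(K γ δ)^α_β = R^α_{βγδ}`. -/
def frameCurv (E : Matrix (Fin (m + 1)) (Fin m ⊕ Unit) ℝ)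
    (G : Matrix (Fin (m + 1)) (Fin (m + 1)) ℝ)
    (K : Fin (m + 1) → Fin (m + 1) → Matrix (Fin (m + 1)) (Fin (m + 1)) ℝ)
    (A B C D : Fin m ⊕ Unit) : ℝ :=
  ∑ γ, ∑ δ, E γ C * E δ D * (Eᵀ * (G * K γ δ) * E) A B

/-- Tracing with `h⁻¹` in the frame equals tracing in coordinates, because `E h⁻¹ Eᵀ G = 1`. -/
theorem sum_frameCurv (K : Fin (m + 1) → Fin (m + 1) → Matrix (Fin (m + 1)) (Fin (m + 1)) ℝ)
    (hh : h = Eᵀ * G * E) (hdet : h.det ≠ 0) (hsymm : ∀ A B, h⁻¹ A B = h⁻¹ B A)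
    (B D : Fin m ⊕ Unit) :
    ∑ A, ∑ C, h⁻¹ A C * frameCurv E G K A B C D =
      (Eᵀ * (Matrix.of fun β δ => ∑ α, K α δ α β) * E) B D := by
  have key (γ δ) : ∑ A, ∑ C, h⁻¹ A C * (E γ C * E δ D * (Eᵀ * (G * K γ δ) * E) A B) =
      E δ D * (K γ δ * E) γ B := by
    have : K γ δ * E = E * (h⁻¹ * (Eᵀ * (G * K γ δ) * E)) := by
      have hi := frame_inverse hh hdet
      have h1 : E * (h⁻¹ * (Eᵀ * (G * K γ δ) * E)) = (E * h⁻¹ * Eᵀ * G) * (K γ δ * E) := by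
        simp only [Matrix.mul_assoc]
      rw [h1, hi, Matrix.one_mul]
    rw [this, Matrix.mul_apply, Finset.mul_sum, Finset.sum_comm]
    refine Finset.sum_congr rfl fun C _ => ?_
    rw [Matrix.mul_apply, Finset.mul_sum, Finset.mul_sum]
    exact Finset.sum_congr rfl fun A _ => by rw [hsymm A C]; ring
  have e1 : ∑ A, ∑ C, h⁻¹ A C * frameCurv E G K A B C D =
      ∑ γ, ∑ δ, ∑ A, ∑ C, h⁻¹ A C * (E γ C * E δ D * (Eᵀ * (G * K γ δ) * E) A B) := by
    simp only [frameCurv, Finset.mul_sum]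
    rw [Finset.sum_congr rfl fun A _ => Finset.sum_comm, Finset.sum_comm]
    refine Finset.sum_congr rfl fun γ _ => ?_
    rw [Finset.sum_congr rfl fun A _ => Finset.sum_comm, Finset.sum_comm]
  rw [e1, Finset.sum_congr rfl fun γ _ => Finset.sum_congr rfl fun δ _ => key γ δ]
  simp only [Matrix.mul_apply, Matrix.of_apply, Matrix.transpose_apply, Finset.mul_sum,
    Finset.sum_mul]
  rw [Finset.sum_comm]
  refine Finset.sum_congr rfl fun δ _ => ?_
  rw [Finset.sum_comm]
  exact Finset.sum_congr rfl fun β _ => Finset.sum_congr rfl fun α _ => by ring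

/-- The covector `ρ` is dual to the last frame vector. Since `G⁻¹ = E h⁻¹ Eᵀ`, raising its index
selects the last row of `h⁻¹`. -/
theorem sum_einstein_eq {ρ : Fin (m + 1) → ℝ} {Q : Matrix (Fin (m + 1)) (Fin (m + 1)) ℝ}
    (hh : h = Eᵀ * G * E) (hdet : h.det ≠ 0)
    (hρ : ∀ A, ∑ μ, ρ μ * E μ A = if A = Sum.inr () then 1 else 0) (D : Fin m ⊕ Unit) :
    ∑ μ, ∑ ν, ((∑ σ, G⁻¹ μ σ * Q σ ν)
      - (1 / 2) * (∑ β, ∑ δ, G⁻¹ β δ * Q β δ) * (if μ = ν then 1 else 0)) * ρ μ * E ν D =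
    (∑ B, h⁻¹ (Sum.inr ()) B * (Eᵀ * Q * E) B D)
      - (1 / 2) * (if D = Sum.inr () then 1 else 0) * ∑ B, ∑ D, h⁻¹ B D * (Eᵀ * Q * E) B D := by
  have hv : Matrix.vecMul ρ E = Pi.single (Sum.inr ()) 1 := by
    ext A
    simp only [Matrix.vecMul, dotProduct, hρ, Pi.single_apply]
  -- As a trace, the scalar curvature is carried to the frame by cyclicity.
  have htr {ι : Type} [Fintype ι] (A B : Matrix ι ι ℝ) :
      ∑ i, ∑ j, A i j * B i j = (A * Bᵀ).trace := by
    simp [Matrix.trace, Matrix.mul_apply]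
  have hs : ∑ β, ∑ δ, G⁻¹ β δ * Q β δ = ∑ B, ∑ D, h⁻¹ B D * (Eᵀ * Q * E) B D := by
    rw [htr, htr, inverse_eq_frame hh hdet]
    simp only [Matrix.transpose_mul, Matrix.transpose_transpose]
    rw [Matrix.mul_assoc, Matrix.mul_assoc, Matrix.trace_mul_comm]
    simp only [Matrix.mul_assoc]
  have h1 : ∑ μ, ∑ ν, (∑ σ, G⁻¹ μ σ * Q σ ν) * ρ μ * E ν D =
      ∑ B, h⁻¹ (Sum.inr ()) B * (Eᵀ * Q * E) B D := by
    have e1 : ∑ μ, ∑ ν, (∑ σ, G⁻¹ μ σ * Q σ ν) * ρ μ * E ν D =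
        Matrix.vecMul ρ (G⁻¹ * Q * E) D := by
      simp only [Matrix.vecMul, dotProduct, Matrix.mul_apply, Finset.mul_sum, Finset.sum_mul]
      exact Finset.sum_congr rfl fun μ _ => Finset.sum_congr rfl fun ν _ =>
        Finset.sum_congr rfl fun σ _ => by ring
    have e2 : G⁻¹ * Q * E = E * (h⁻¹ * (Eᵀ * Q * E)) := by
      rw [inverse_eq_frame hh hdet]
      simp only [Matrix.mul_assoc]
    rw [e1, e2, ← Matrix.vecMul_vecMul, hv, Matrix.single_one_vecMul, Matrix.row_apply,
      Matrix.mul_apply]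
  rw [← hs]
  simp only [sub_mul, Finset.sum_sub_distrib, h1]
  congr 1
  generalize ∑ β, ∑ δ, G⁻¹ β δ * Q β δ = s
  rw [← hρ D, Finset.mul_sum, Finset.sum_mul]
  refine Finset.sum_congr rfl fun μ _ => ?_
  simp
  ring

end Einstein

end FrameContractions

/-! ### Components in charts of the smooth structure -/

section ChartComponents

variable {k : ℕ} {X : Type*} [TopologicalSpace X] [ChartedSpace (EuclideanSpace ℝ (Fin k)) X]
  {φ φ' : OpenPartialHomeomorph X (EuclideanSpace ℝ (Fin k))} {q : X}

theorem mdifferentiable_of_mem_maximalAtlas (hφ : φ ∈ IsManifold.maximalAtlas (𝓡 k) ∞ X) :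
    φ.MDifferentiable (𝓡 k) (𝓡 k) :=
  ⟨(contMDiffOn_of_mem_maximalAtlas hφ).mdifferentiableOn (by simp),
    (contMDiffOn_symm_of_mem_maximalAtlas hφ).mdifferentiableOn (by simp)⟩

theorem mfderiv_coordVec (hφ : φ ∈ IsManifold.maximalAtlas (𝓡 k) ∞ X) (hq : q ∈ φ.source)
    (a : Fin k) : mfderiv (𝓡 k) (𝓡 k) φ q (coordVec φ q a) = EuclideanSpace.single a (1 : ℝ) := by
  have he := mdifferentiable_of_mem_maximalAtlas hφ
  have h : mfderiv (𝓡 k) (𝓡 k) φ q = (he.mfderiv hq : _ →L[ℝ] _) := rfl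
  rw [coordVec, h, ContinuousLinearMap.inverse_equiv]
  exact (he.mfderiv hq).apply_symm_apply _

theorem coordVec_symm (hφ : φ ∈ IsManifold.maximalAtlas (𝓡 k) ∞ X)
    {x : EuclideanSpace ℝ (Fin k)} (hx : x ∈ φ.target) (a : Fin k) :
    coordVec φ (φ.symm x) a =
      mfderiv (𝓡 k) (𝓡 k) φ.symm x (EuclideanSpace.single a (1 : ℝ)) := by
  have he := mdifferentiable_of_mem_maximalAtlas hφ
  apply he.mfderiv_injective (φ.map_target hx)
  rw [mfderiv_coordVec hφ (φ.map_target hx)]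
  exact (DFunLike.congr_fun (he.comp_symm_deriv hx) _).symm

/-- The coordinate basis of the tangent space at a point of the domain of a chart. -/
def coordBasis (hφ : φ ∈ IsManifold.maximalAtlas (𝓡 k) ∞ X) (hq : q ∈ φ.source) :
    Basis (Fin k) ℝ (TangentSpace (𝓡 k) q) :=
  (EuclideanSpace.basisFun (Fin k) ℝ).toBasis.map
    ((mdifferentiable_of_mem_maximalAtlas hφ).mfderiv hq).symm.toLinearEquiv

theorem coordBasis_apply (hφ : φ ∈ IsManifold.maximalAtlas (𝓡 k) ∞ X) (hq : q ∈ φ.source)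
    (a : Fin k) : coordBasis hφ hq a = coordVec φ q a := by
  have he := mdifferentiable_of_mem_maximalAtlas hφ
  apply he.mfderiv_injective hq
  have hb : coordBasis hφ hq a =
      (he.mfderiv hq).symm ((EuclideanSpace.basisFun (Fin k) ℝ).toBasis a) := Basis.map_apply _ _ _
  rw [mfderiv_coordVec hφ hq, hb]
  exact ((he.mfderiv hq).apply_symm_apply _).trans (by simp; rfl)

theorem coordBasis_repr (hφ : φ ∈ IsManifold.maximalAtlas (𝓡 k) ∞ X) (hq : q ∈ φ.source)
    (v : TangentSpace (𝓡 k) q) (a : Fin k) :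
    (coordBasis hφ hq).repr v a = vecComp φ q v a := rfl

theorem sum_vecComp_smul_coordVec (hφ : φ ∈ IsManifold.maximalAtlas (𝓡 k) ∞ X)
    (hq : q ∈ φ.source) (v : TangentSpace (𝓡 k) q) :
    ∑ a, vecComp φ q v a • coordVec φ q a = v := by
  have := (coordBasis hφ hq).sum_repr v
  simpa only [coordBasis_apply, coordBasis_repr] using this

theorem vecComp_coordVec (hφ : φ ∈ IsManifold.maximalAtlas (𝓡 k) ∞ X) (hq : q ∈ φ.source)
    (a b : Fin k) : vecComp φ q (coordVec φ q a) b = if b = a then 1 else 0 := by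
  rw [vecComp, mfderiv_coordVec hφ hq]
  simp

theorem form_apply_eq_sum (hφ : φ ∈ IsManifold.maximalAtlas (𝓡 k) ∞ X) (hq : q ∈ φ.source)
    {F : Type*} [AddCommGroup F] [Module ℝ F] (α : TangentSpace (𝓡 k) q →ₗ[ℝ] F)
    (v : TangentSpace (𝓡 k) q) : α v = ∑ a, vecComp φ q v a • α (coordVec φ q a) := by
  conv_lhs => rw [← sum_vecComp_smul_coordVec hφ hq v]
  simp only [map_sum, map_smul]

theorem bilin_apply_eq_sum (hφ : φ ∈ IsManifold.maximalAtlas (𝓡 k) ∞ X) (hq : q ∈ φ.source)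
    (T : ∀ q : X, TangentSpace (𝓡 k) q →L[ℝ] TangentSpace (𝓡 k) q →L[ℝ] ℝ)
    (v w : TangentSpace (𝓡 k) q) :
    T q v w = ∑ a, ∑ b, vecComp φ q v a * (bilinComp T φ (φ q) a b * vecComp φ q w b) := by
  have h1 : T q v w = ∑ a, vecComp φ q v a * T q (coordVec φ q a) w := by
    conv_lhs => rw [← sum_vecComp_smul_coordVec hφ hq v]
    simp
  have h2 (a : Fin k) : T q (coordVec φ q a) w =
      ∑ b, vecComp φ q w b * T q (coordVec φ q a) (coordVec φ q b) := by
    conv_lhs => rw [← sum_vecComp_smul_coordVec hφ hq w]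
    simp
  rw [h1]
  refine Finset.sum_congr rfl fun a _ => ?_
  rw [h2, Finset.mul_sum]
  refine Finset.sum_congr rfl fun b _ => ?_
  rw [bilinComp, φ.left_inv hq]
  ring

variable {n : ℕ} {Z : Type*} [TopologicalSpace Z] [ChartedSpace (EuclideanSpace ℝ (Fin n)) Z]
  {ψ : OpenPartialHomeomorph Z (EuclideanSpace ℝ (Fin n))} {Φ : X → Z}
  {x : EuclideanSpace ℝ (Fin k)}

theorem contDiffAt_chart_comp (hφ : φ ∈ IsManifold.maximalAtlas (𝓡 k) ∞ X)
    (hψ : ψ ∈ IsManifold.maximalAtlas (𝓡 n) ∞ Z) (hΦ : ContMDiff (𝓡 k) (𝓡 n) ∞ Φ)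
    (hx : x ∈ φ.target) (hx' : Φ (φ.symm x) ∈ ψ.source) :
    ContDiffAt ℝ ∞ (fun y => ψ (Φ (φ.symm y))) x := by
  rw [← contMDiffAt_iff_contDiffAt]
  exact (contMDiffAt_of_mem_maximalAtlas hψ hx').comp x
    (hΦ.contMDiffAt.comp x (contMDiffAt_symm_of_mem_maximalAtlas hφ hx))

theorem fderiv_chart_comp (hφ : φ ∈ IsManifold.maximalAtlas (𝓡 k) ∞ X)
    (hψ : ψ ∈ IsManifold.maximalAtlas (𝓡 n) ∞ Z) (hΦ : ContMDiff (𝓡 k) (𝓡 n) ∞ Φ)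
    (hx : x ∈ φ.target) (hx' : Φ (φ.symm x) ∈ ψ.source) (v : EuclideanSpace ℝ (Fin k)) :
    fderiv ℝ (fun y => ψ (Φ (φ.symm y))) x v =
      mfderiv (𝓡 n) (𝓡 n) ψ (Φ (φ.symm x)) (mfderiv (𝓡 k) (𝓡 n) Φ (φ.symm x)
        (mfderiv (𝓡 k) (𝓡 k) φ.symm x v)) := by
  have h1 : MDifferentiableAt (𝓡 k) (𝓡 k) φ.symm x :=
    (mdifferentiable_of_mem_maximalAtlas hφ).mdifferentiableAt_symm hx
  have h2 : MDifferentiableAt (𝓡 k) (𝓡 n) Φ (φ.symm x) :=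
    hΦ.contMDiffAt.mdifferentiableAt (by simp)
  have h3 : MDifferentiableAt (𝓡 n) (𝓡 n) ψ (Φ (φ.symm x)) :=
    (mdifferentiable_of_mem_maximalAtlas hψ).mdifferentiableAt hx'
  have e1 := mfderiv_comp x h3 (h2.comp x h1)
  rw [mfderiv_comp x h2 h1, mfderiv_eq_fderiv] at e1
  exact DFunLike.congr_fun e1 v

theorem pd_chart_comp (hφ : φ ∈ IsManifold.maximalAtlas (𝓡 k) ∞ X)
    (hψ : ψ ∈ IsManifold.maximalAtlas (𝓡 n) ∞ Z) (hΦ : ContMDiff (𝓡 k) (𝓡 n) ∞ Φ)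
    (hx : x ∈ φ.target) (hx' : Φ (φ.symm x) ∈ ψ.source) (a : Fin k) (μ : Fin n) :
    pd (fun y => ψ (Φ (φ.symm y)) μ) a x =
      vecComp ψ (Φ (φ.symm x)) (mfderiv (𝓡 k) (𝓡 n) Φ (φ.symm x)
        (coordVec φ (φ.symm x) a)) μ := by
  have hd : DifferentiableAt ℝ (fun y => ψ (Φ (φ.symm y))) x :=
    (contDiffAt_chart_comp hφ hψ hΦ hx hx').differentiableAt (by simp)
  rw [pd, ← fderiv_coord hd, fderiv_chart_comp hφ hψ hΦ hx hx', coordVec_symm hφ hx]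
  rfl

theorem vecComp_change_chart (hφ : φ ∈ IsManifold.maximalAtlas (𝓡 k) ∞ X)
    (hφ' : φ' ∈ IsManifold.maximalAtlas (𝓡 k) ∞ X) (hq : q ∈ φ.source) (hq' : q ∈ φ'.source)
    (v : TangentSpace (𝓡 k) q) (i : Fin k) :
    vecComp φ' q v i = ∑ α, pd (fun y => φ' (φ.symm y) i) α (φ q) * vecComp φ q v α := by
  obtain ⟨x, hx, rfl⟩ : ∃ x ∈ φ.target, φ.symm x = q := ⟨φ q, φ.map_source hq, φ.left_inv hq⟩
  rw [φ.right_inv hx]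
  -- A change of chart is the coordinate expression of the identity map.
  have h1 := pd_chart_comp hφ hφ' (contMDiff_id (I := 𝓡 k) (M := X)) hx hq' (μ := i)
  have h2 : vecComp φ' (φ.symm x) v i = ∑ α, vecComp φ (φ.symm x) v α *
      vecComp φ' (φ.symm x) (coordVec φ (φ.symm x) α) i :=
    form_apply_eq_sum hφ hq (((EuclideanSpace.proj i : EuclideanSpace ℝ (Fin k) →L[ℝ] ℝ).comp
      (mfderiv (𝓡 k) (𝓡 k) φ' (φ.symm x)) : TangentSpace (𝓡 k) (φ.symm x) →L[ℝ] ℝ) :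
      TangentSpace (𝓡 k) (φ.symm x) →ₗ[ℝ] ℝ) v
  rw [h2]
  refine Finset.sum_congr rfl fun α _ => ?_
  have h3 := h1 α
  simp only [id_eq, mfderiv_id] at h3
  rw [h3, mul_comm]
  rfl

end ChartComponents

/-! ### Invariance of the Lie derivative under coordinate changes -/

section LieInvariance

variable {m N : ℕ}

/-- The Jacobian matrix of a map. -/
def jacobian (t : EuclideanSpace ℝ (Fin N) → EuclideanSpace ℝ (Fin N))
    (y : EuclideanSpace ℝ (Fin N)) : Matrix (Fin N) (Fin N) ℝ :=
  Matrix.of fun i α => pd (fun z => t z i) α y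

variable {G G' : EuclideanSpace ℝ (Fin N) → Matrix (Fin N) (Fin N) ℝ}
  {f f' : EuclideanSpace ℝ (Fin m) → EuclideanSpace ℝ (Fin N)}
  {l l' : EuclideanSpace ℝ (Fin m) → Fin N → ℝ} {x : EuclideanSpace ℝ (Fin m)}
  {t : EuclideanSpace ℝ (Fin N) → EuclideanSpace ℝ (Fin N)}

/-- Besides the tensorial terms, second derivatives of `t` arise twice: from the Jacobian in `G`,
differentiated along `l`, and from the Jacobian in `l'`, differentiated along the hypersurface.
Symmetry of second derivatives makes them agree. -/
theorem pullLie_change_coord (hG' : MatContDiffAt 1 G' (t (f x))) (hsymm : ∀ y i j, G' y i j = G' y j i)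
    (ht : ContDiffAt ℝ 2 t (f x)) (hf : ContDiffAt ℝ 2 f x)
    (hl : ∀ μ, ContDiffAt ℝ 1 (fun y => l y μ) x)
    (hG : ∀ᶠ y in 𝓝 (f x), G y = (jacobian t y)ᵀ * G' (t y) * jacobian t y)
    (hf' : ∀ᶠ y in 𝓝 x, f' y = t (f y))
    (hl' : ∀ᶠ y in 𝓝 x, l' y = (jacobian t (f y)).mulVec (l y)) (a b : Fin m) :
    pullLie G' f' l' x a b = pullLie G f l x a b := by
  have hfd : ContinuousAt f x := hf.continuousAt
  have hTc : MatContDiffAt 1 (jacobian t) (f x) := fun i α => (ht.coord i).pd (by norm_num) α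
  have hE' : ∀ᶠ y in 𝓝 x, rigFrame f' l' y = jacobian t (f y) * rigFrame f l y := by
    have ht1 : ∀ᶠ y in 𝓝 x, ContDiffAt ℝ 2 t (f y) := hfd.eventually (ht.eventually (by simp))
    filter_upwards [hf'.eventually_nhds, hl', ht1, hf.eventually (by simp)] with y y1 y2 y3 y4
    ext i A
    rcases A with c | u
    · simp only [rigFrame, Matrix.of_apply, Sum.elim_inl, Matrix.mul_apply, jacobian]
      rw [pd_congr (g := fun z => t (f z) i) (y1.mono fun z hz => by rw [hz]),
        pd_comp (G := fun z => t z i) (y4.differentiableAt (by norm_num))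
          ((y3.coord i).differentiableAt (by norm_num))]
      exact Finset.sum_congr rfl fun α _ => mul_comm _ _
    · simp only [rigFrame, Matrix.of_apply, Sum.elim_inr, Matrix.mul_apply, y2]
      rfl
  set E := rigFrame f l x with hEdef
  set T := jacobian t (f x) with hT
  set Γ := G' (t (f x)) with hΓ
  have hΓt : Γᵀ = Γ := Matrix.ext fun i j => hsymm _ _ _
  have hE1 : MatContDiffAt 1 (rigFrame f l) x := matContDiffAt_rigFrame hf (by norm_num) hl
  have hf'x := hf'.self_of_nhds
  have hl'x := hl'.self_of_nhds
  have hE'x : rigFrame f' l' x = T * E := hE'.self_of_nhds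
  have hGx : G (f x) = Tᵀ * Γ * T := hG.self_of_nhds
  have hTf : MatContDiffAt 1 (fun y => jacobian t (f y)) x :=
    fun i j => (hTc i j).comp x (hf.of_le (by norm_num))
  set A : Fin m → Matrix (Fin N) (Fin N) ℝ :=
    fun c => ∑ μ, pd (fun y => f y μ) c x • matPd (jacobian t) μ (f x) with hA
  set B : Matrix (Fin N) (Fin N) ℝ := ∑ μ, l x μ • matPd (jacobian t) μ (f x) with hB
  have hdE' (c : Fin m) : matPd (rigFrame f' l') c x = A c * E + T * matPd (rigFrame f l) c x := by
    rw [matPd_congr hE', matPd_mul hTf hE1,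
      matPd_comp (hf.differentiableAt (by norm_num)) hTc]
  -- The second derivative of `t` on the pair `(∂_c f, l)` may be read in either order.
  have hAB (c : Fin m) (i : Fin N) : (A c * E) i (Sum.inr ()) = (B * E) i (Sum.inl c) := by
    simp only [hA, hB, hEdef, rigFrame, Matrix.mul_apply, Matrix.sum_apply, Matrix.smul_apply,
      Matrix.of_apply, smul_eq_mul, Finset.sum_mul, Sum.elim_inl, Sum.elim_inr]
    rw [Finset.sum_comm]
    refine Finset.sum_congr rfl fun α _ => Finset.sum_congr rfl fun β _ => ?_
    have : matPd (jacobian t) α (f x) i β = matPd (jacobian t) β (f x) i α :=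
      pd_comm (ht.coord i) β α
    rw [this]
    ring
  have hG'f : MatContDiffAt 1 (fun y => G' (t y)) (f x) :=
    fun i j => (hG' i j).comp (f x) (ht.of_le (by norm_num))
  have hdG : ∑ μ, l x μ • matPd G μ (f x) = Bᵀ * Γ * T
      + Tᵀ * (∑ i, l' x i • matPd G' i (f' x)) * T + Tᵀ * Γ * B := by
    have h1 (μ : Fin N) : matPd G μ (f x) = (matPd (jacobian t) μ (f x))ᵀ * Γ * T
        + Tᵀ * (∑ i, T i μ • matPd G' i (t (f x))) * T
        + Tᵀ * Γ * matPd (jacobian t) μ (f x) := by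
      rw [matPd_congr hG, matPd_mul (hTc.transpose.mul hG'f) hTc, matPd_mul hTc.transpose hG'f,
        matPd_transpose, matPd_comp (ht.differentiableAt (by norm_num)) hG', Matrix.add_mul]
      rfl
    simp only [h1, smul_add, Finset.sum_add_distrib]
    congr 1
    · congr 1
      · simp only [hB, Matrix.transpose_sum, Finset.sum_mul, Matrix.transpose_smul,
          Matrix.smul_mul]
      · rw [hl'x, hf'x]
        have hs : ∑ i, (T.mulVec (l x)) i • matPd G' i (t (f x)) =
            ∑ μ, l x μ • ∑ i, T i μ • matPd G' i (t (f x)) := by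
          simp only [Finset.smul_sum, smul_smul]
          rw [Finset.sum_comm]
          refine Finset.sum_congr rfl fun i _ => ?_
          have hi : (T.mulVec (l x)) i = ∑ μ, l x μ * T i μ := by
            simp only [Matrix.mulVec, dotProduct, mul_comm]
          rw [← Finset.sum_smul, hi]
        rw [hs, Matrix.mul_sum, Matrix.sum_mul]
        exact Finset.sum_congr rfl fun μ _ => by rw [Matrix.mul_smul, Matrix.smul_mul]
    · simp only [hB, Finset.mul_sum, Matrix.mul_smul]
  have hcross (c d : Fin m) :
      ((rigFrame f' l' x)ᵀ * G' (f' x) * matPd (rigFrame f' l') c x) (Sum.inl d) (Sum.inr ()) =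
      (Eᵀ * Tᵀ * Γ * (B * E)) (Sum.inl d) (Sum.inl c)
        + (Eᵀ * G (f x) * matPd (rigFrame f l) c x) (Sum.inl d) (Sum.inr ()) := by
    rw [hE'x, hf'x, hdE', Matrix.mul_add, Matrix.add_apply, hGx, Matrix.transpose_mul]
    congr 1
    · rw [Matrix.mul_apply, Matrix.mul_apply]
      exact Finset.sum_congr rfl fun i _ => by rw [hAB]
    · simp only [Matrix.mul_assoc, hΓ]
  have ht : (Eᵀ * Tᵀ * Γ * (B * E)) (Sum.inl b) (Sum.inl a) =
      (Eᵀ * (Bᵀ * Γ * T) * E) (Sum.inl a) (Sum.inl b) := by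
    rw [← Matrix.transpose_apply (Eᵀ * Tᵀ * Γ * (B * E))]
    simp only [Matrix.transpose_mul, Matrix.transpose_transpose, hΓt, Matrix.mul_assoc]
  rw [pullLie, pullLie, hcross, hcross, hdG, ← hEdef, hE'x, ht]
  simp only [Matrix.transpose_mul, Matrix.mul_add, Matrix.add_mul, Matrix.add_apply,
    Matrix.mul_assoc]
  ring

end LieInvariance

/-! ### Nondegeneracy of Lorentzian forms -/

section Nondegenerate

variable {m : ℕ} {V : Type*} [AddCommGroup V] [Module ℝ V]

/-- Pairing with the orthonormal basis recovers each coordinate of `v` up to sign. -/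
theorem IsLorentzian.eq_zero {B : V →ₗ[ℝ] V →ₗ[ℝ] ℝ} (hB : IsLorentzian m fun v w => B v w)
    {v : V} (hv : ∀ w, B v w = 0) : v = 0 := by
  obtain ⟨b, hb⟩ := hB
  refine b.ext_elem fun i => ?_
  have h1 : B v (b i) = b.repr v i * (if i = 0 then -1 else 1) := by
    have hb' : ∀ i j, B (b i) (b j) = if i = j then (if i = 0 then -1 else 1) else 0 := hb
    conv_lhs => rw [← b.sum_repr v]
    simp only [map_sum, map_smul, LinearMap.sum_apply, LinearMap.smul_apply, hb', smul_eq_mul,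
      mul_ite, mul_zero]
    simp
  rw [hv] at h1
  have h2 : (if i = 0 then (-1 : ℝ) else 1) ≠ 0 := by split_ifs <;> norm_num
  simpa using (mul_eq_zero.1 h1.symm).resolve_right h2

theorem IsLorentzian.det_ne_zero {ι : Type*} [Fintype ι] [DecidableEq ι]
    {B : V →ₗ[ℝ] V →ₗ[ℝ] ℝ} (hB : IsLorentzian m fun v w => B v w) (e : Basis ι ℝ V) :
    (Matrix.of fun i j => B (e i) (e j)).det ≠ 0 := by
  intro hdet
  -- A null vector of the Gram matrix gives a vector orthogonal to the whole space.
  obtain ⟨c, hc, hc0⟩ := Matrix.exists_vecMul_eq_zero_iff.2 hdet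
  have hz : ∑ i, c i • e i = 0 := by
    refine hB.eq_zero fun w => ?_
    have h1 : (B (∑ i, c i • e i) : V →ₗ[ℝ] ℝ) = 0 := e.ext fun j => by
      have := congrFun hc0 j
      simpa [Matrix.vecMul, dotProduct] using this
    rw [h1]
    rfl
  exact hc (funext fun i => by
    simpa using Fintype.linearIndependent_iff.1 e.linearIndependent c hz i)

end Nondegenerate

/-! ### Smooth components of vector fields along maps -/

section VectorFields

variable {k n : ℕ} {X Z : Type*} [TopologicalSpace X] [ChartedSpace (EuclideanSpace ℝ (Fin k)) X]
  [TopologicalSpace Z] [ChartedSpace (EuclideanSpace ℝ (Fin n)) Z] [IsManifold (𝓡 n) ∞ Z]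

/-- While `F q` stays in the domain of the chart at `F q₀`, the differential of that chart is the
fibre coordinate of the tangent bundle trivialization there, so bundle smoothness is smoothness of
components. -/
theorem contMDiffAt_vecComp {F : X → Z} {V : ∀ q : X, TangentSpace (𝓡 n) (F q)} {q₀ : X}
    (h : ContMDiffAt (𝓡 k) (𝓡 n).tangent ∞
      (fun q => (⟨F q, V q⟩ : TangentBundle (𝓡 n) Z)) q₀) (μ : Fin n) :
    ContMDiffAt (𝓡 k) 𝓘(ℝ, ℝ) ∞
      (fun q => vecComp (chartAt (EuclideanSpace ℝ (Fin n)) (F q₀)) (F q) (V q) μ) q₀ := by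
  have h1 := (Bundle.contMDiffAt_totalSpace.1 h)
  have hc : ContinuousAt F q₀ := h1.1.continuousAt
  have hev : ∀ᶠ q in 𝓝 q₀, F q ∈ (chartAt (EuclideanSpace ℝ (Fin n)) (F q₀)).source :=
    hc.eventually ((chartAt (EuclideanSpace ℝ (Fin n)) (F q₀)).open_source.mem_nhds
      (mem_chart_source _ _))
  have h2 := (EuclideanSpace.proj μ : EuclideanSpace ℝ (Fin n) →L[ℝ] ℝ).contMDiff.contMDiffAt.comp
    q₀ h1.2
  refine h2.congr_of_eventuallyEq ?_
  filter_upwards [hev] with q hq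
  rw [vecComp, mfderiv_chartAt_eq_tangentCoordChange hq]
  rfl

end VectorFields

/-! ### Embedded hypersurface data in charts -/

section EmbeddedInCharts

variable {m : ℕ} {S M : Type*}
  [TopologicalSpace S] [ChartedSpace (EuclideanSpace ℝ (Fin m)) S]
  [TopologicalSpace M] [ChartedSpace (EuclideanSpace ℝ (Fin (m + 1))) M]

/-- The matrix of the metric in a chart. -/
def SpacetimeMetric.matrix (g : SpacetimeMetric m M)
    (ψ : OpenPartialHomeomorph M (EuclideanSpace ℝ (Fin (m + 1))))
    (y : EuclideanSpace ℝ (Fin (m + 1))) : Matrix (Fin (m + 1)) (Fin (m + 1)) ℝ :=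
  Matrix.of fun α β => bilinComp g.val ψ y α β

theorem SpacetimeMetric.christoffel_eq (g : SpacetimeMetric m M)
    (ψ : OpenPartialHomeomorph M (EuclideanSpace ℝ (Fin (m + 1)))) :
    g.christoffel ψ = leviCivita (g.matrix ψ) := rfl

theorem SpacetimeMetric.matrix_symm (g : SpacetimeMetric m M)
    (ψ : OpenPartialHomeomorph M (EuclideanSpace ℝ (Fin (m + 1))))
    (y : EuclideanSpace ℝ (Fin (m + 1))) (α β : Fin (m + 1)) :
    g.matrix ψ y α β = g.matrix ψ y β α := g.symm _ _ _

theorem SpacetimeMetric.matContDiffAt_matrix (g : SpacetimeMetric m M)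
    {ψ : OpenPartialHomeomorph M (EuclideanSpace ℝ (Fin (m + 1)))}
    (hψ : ψ ∈ IsManifold.maximalAtlas (𝓡 (m + 1)) ∞ M) {y : EuclideanSpace ℝ (Fin (m + 1))}
    (hy : y ∈ ψ.target) : MatContDiffAt 2 (g.matrix ψ) y :=
  fun α β => (g.contDiff ψ hψ α β).contDiffAt (ψ.open_target.mem_nhds hy)

theorem SpacetimeMetric.det_matrix_ne_zero (g : SpacetimeMetric m M)
    {ψ : OpenPartialHomeomorph M (EuclideanSpace ℝ (Fin (m + 1)))}
    (hψ : ψ ∈ IsManifold.maximalAtlas (𝓡 (m + 1)) ∞ M) {y : EuclideanSpace ℝ (Fin (m + 1))}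
    (hy : y ∈ ψ.target) : (g.matrix ψ y).det ≠ 0 := by
  have h := IsLorentzian.det_ne_zero (m := m)
    (B := LinearMap.mk₂ ℝ (fun v w => g.val (ψ.symm y) v w) (by simp) (by simp) (by simp)
      (by simp)) (g.lorentzian (ψ.symm y)) (coordBasis hψ (ψ.map_target hy))
  simpa [coordBasis_apply] using! h

/-- The matrix `[[γ_{ab}, ℓ_a], [ℓ_b, ℓ⁽²⁾]]` in the coordinate basis of a chart. -/
def MetricHypersurfaceData.coordMat (D : MetricHypersurfaceData m S)
    (φ : OpenPartialHomeomorph S (EuclideanSpace ℝ (Fin m))) (x : EuclideanSpace ℝ (Fin m)) :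
    Matrix (Fin m ⊕ Unit) (Fin m ⊕ Unit) ℝ :=
  D.mat (φ.symm x) (coordVec φ (φ.symm x))

namespace MetricHypersurfaceData

variable (D : MetricHypersurfaceData m S)
  {φ : OpenPartialHomeomorph S (EuclideanSpace ℝ (Fin m))} {x : EuclideanSpace ℝ (Fin m)}

theorem mat_symm (p : S) (e : Fin m → TangentSpace (𝓡 m) p) (A B : Fin m ⊕ Unit) :
    D.mat p e A B = D.mat p e B A := by
  rcases A with a | a <;> rcases B with b | b
  · exact D.gam_symm p _ _
  all_goals rfl

theorem matContDiffAt_coordMat (hφ : φ ∈ IsManifold.maximalAtlas (𝓡 m) ∞ S)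
    (hx : x ∈ φ.target) : MatContDiffAt 2 (D.coordMat φ) x := by
  have hn := φ.open_target.mem_nhds hx
  have hl (a : Fin m) : ContDiffAt ℝ 2 (fun y => formComp D.ell φ y a) x :=
    (D.ell_contDiff φ hφ a).contDiffAt hn
  rintro (a | a) (b | b)
  · exact (D.gam_contDiff φ hφ a b).contDiffAt hn
  · exact hl a
  · exact hl b
  · change ContDiffAt ℝ 2 (fun y => D.ell2 (φ.symm y)) x
    rw [← contMDiffAt_iff_contDiffAt]
    exact D.ell2_contMDiff.contMDiffAt.comp x
      ((contMDiffAt_symm_of_mem_maximalAtlas hφ hx).of_le (by norm_cast))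

/-- The matrix is the Gram matrix of the form on `T_p S ⊕ ℝ` in the basis formed by `e` and `1`. `γ`
itself may be degenerate; only the bordered form is not. -/
theorem det_mat_ne_zero {p : S} (e : Basis (Fin m) ℝ (TangentSpace (𝓡 m) p)) :
    (D.mat p e).det ≠ 0 := by
  let B : (TangentSpace (𝓡 m) p × ℝ) →ₗ[ℝ] (TangentSpace (𝓡 m) p × ℝ) →ₗ[ℝ] ℝ :=
    LinearMap.mk₂ ℝ (fun v w => D.gam p v.1 w.1 + v.2 * D.ell p w.1 + w.2 * D.ell p v.1
      + v.2 * w.2 * D.ell2 p) (by intros; simp; ring) (by intros; simp; ring)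
      (by intros; simp; ring) (by intros; simp; ring)
  have h := IsLorentzian.det_ne_zero (m := m) (B := B) (D.lorentzian p)
    (e.prod (Basis.singleton Unit ℝ))
  convert h using 2
  ext A C
  rcases A with a | a <;> rcases C with c | c <;> simp [B, mat]

theorem det_coordMat_ne_zero (hφ : φ ∈ IsManifold.maximalAtlas (𝓡 m) ∞ S)
    (hx : x ∈ φ.target) : (D.coordMat φ x).det ≠ 0 := by
  have h := D.det_mat_ne_zero (coordBasis hφ (φ.map_target hx))
  rwa [show ⇑(coordBasis hφ (φ.map_target hx)) = coordVec φ (φ.symm x) from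
    funext (coordBasis_apply hφ _)] at h

end MetricHypersurfaceData

end EmbeddedInCharts

/-! ### The embedding conditions as matrix identities in charts -/

section EmbeddedInCharts

variable {m : ℕ} {S M : Type*}
  [TopologicalSpace S] [ChartedSpace (EuclideanSpace ℝ (Fin m)) S]
  [TopologicalSpace M] [ChartedSpace (EuclideanSpace ℝ (Fin (m + 1))) M]
  {g : SpacetimeMetric m M} {D : HypersurfaceData m S} {Φ : S → M}
  {l : ∀ p : S, TangentSpace (𝓡 (m + 1)) (Φ p)}
  {φ : OpenPartialHomeomorph S (EuclideanSpace ℝ (Fin m))}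
  {ψ ψ' : OpenPartialHomeomorph M (EuclideanSpace ℝ (Fin (m + 1)))}
  {x : EuclideanSpace ℝ (Fin m)}

/-- The coordinate expression of a map. -/
def mapComp (φ : OpenPartialHomeomorph S (EuclideanSpace ℝ (Fin m)))
    (ψ : OpenPartialHomeomorph M (EuclideanSpace ℝ (Fin (m + 1)))) (Φ : S → M)
    (x : EuclideanSpace ℝ (Fin m)) : EuclideanSpace ℝ (Fin (m + 1)) :=
  ψ (Φ (φ.symm x))

/-- The coordinate expression of a vector field along a map. -/
def alongComp (φ : OpenPartialHomeomorph S (EuclideanSpace ℝ (Fin m)))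
    (ψ : OpenPartialHomeomorph M (EuclideanSpace ℝ (Fin (m + 1)))) {Φ : S → M}
    (l : ∀ p : S, TangentSpace (𝓡 (m + 1)) (Φ p)) (x : EuclideanSpace ℝ (Fin m))
    (μ : Fin (m + 1)) : ℝ :=
  vecComp ψ (Φ (φ.symm x)) (l (φ.symm x)) μ

/-- The vectors `∂_a, l` along the hypersurface. -/
def rigVec (φ : OpenPartialHomeomorph S (EuclideanSpace ℝ (Fin m))) (Φ : S → M)
    (l : ∀ p : S, TangentSpace (𝓡 (m + 1)) (Φ p)) (q : S) :
    Fin m ⊕ Unit → TangentSpace (𝓡 (m + 1)) (Φ q) :=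
  Sum.elim (fun a => mfderiv (𝓡 m) (𝓡 (m + 1)) Φ q (coordVec φ q a)) (fun _ => l q)

theorem rigFrame_eq_vecComp (hφ : φ ∈ IsManifold.maximalAtlas (𝓡 m) ∞ S)
    (hψ : ψ ∈ IsManifold.maximalAtlas (𝓡 (m + 1)) ∞ M) (hΦ : ContMDiff (𝓡 m) (𝓡 (m + 1)) ∞ Φ)
    (hx : x ∈ φ.target) (hx' : Φ (φ.symm x) ∈ ψ.source) (μ : Fin (m + 1)) (A : Fin m ⊕ Unit) :
    rigFrame (mapComp φ ψ Φ) (alongComp φ ψ l) x μ A =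
      vecComp ψ (Φ (φ.symm x)) (rigVec φ Φ l (φ.symm x) A) μ := by
  rcases A with a | a
  · exact pd_chart_comp hφ hψ hΦ hx hx' a μ
  · rfl

theorem transpose_mul_mul_apply {ι κ : Type*} [Fintype ι] (E : Matrix ι κ ℝ) (G : Matrix ι ι ℝ)
    (A B : κ) : (Eᵀ * G * E) A B = ∑ μ, ∑ ν, E μ A * (G μ ν * E ν B) := by
  rw [Matrix.mul_assoc, Matrix.mul_apply]
  refine Finset.sum_congr rfl fun μ _ => ?_
  rw [Matrix.mul_apply, Finset.mul_sum]
  rfl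

theorem SpacetimeMetric.matrix_change_chart (g : SpacetimeMetric m M)
    (hψ : ψ ∈ IsManifold.maximalAtlas (𝓡 (m + 1)) ∞ M)
    (hψ' : ψ' ∈ IsManifold.maximalAtlas (𝓡 (m + 1)) ∞ M)
    {y : EuclideanSpace ℝ (Fin (m + 1))} (hy : y ∈ ψ.target) (hy' : ψ.symm y ∈ ψ'.source) :
    g.matrix ψ y = (jacobian (fun z => ψ' (ψ.symm z)) y)ᵀ * g.matrix ψ' (ψ' (ψ.symm y)) *
      jacobian (fun z => ψ' (ψ.symm z)) y := by
  ext α β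
  rw [transpose_mul_mul_apply]
  change g.val (ψ.symm y) (coordVec ψ (ψ.symm y) α) (coordVec ψ (ψ.symm y) β) = _
  rw [bilin_apply_eq_sum hψ' hy']
  have h (c i : Fin (m + 1)) : vecComp ψ' (ψ.symm y) (coordVec ψ (ψ.symm y) c) i =
      jacobian (fun z => ψ' (ψ.symm z)) y i c := by
    rw [vecComp_change_chart hψ hψ' (ψ.map_target hy) hy']
    simp [vecComp_coordVec hψ (ψ.map_target hy), ψ.right_inv hy, jacobian]
  simp only [h]
  rfl

variable [IsManifold (𝓡 (m + 1)) ∞ M]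

theorem HypersurfaceData.IsEmbedded.contMDiff (hD : D.IsEmbedded g Φ l) :
    ContMDiff (𝓡 m) (𝓡 (m + 1)) ∞ Φ := hD.embedding.contMDiff

/-- The three algebraic embedding conditions are the blocks of a single Gram matrix identity. -/
theorem HypersurfaceData.IsEmbedded.coordMat_eq (hD : D.IsEmbedded g Φ l)
    (hφ : φ ∈ IsManifold.maximalAtlas (𝓡 m) ∞ S)
    (hψ : ψ ∈ IsManifold.maximalAtlas (𝓡 (m + 1)) ∞ M)
    (hx : x ∈ φ.target) (hx' : Φ (φ.symm x) ∈ ψ.source) :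
    D.coordMat φ x = (rigFrame (mapComp φ ψ Φ) (alongComp φ ψ l) x)ᵀ *
      g.matrix ψ (mapComp φ ψ Φ x) * rigFrame (mapComp φ ψ Φ) (alongComp φ ψ l) x := by
  ext A B
  have h1 : ((rigFrame (mapComp φ ψ Φ) (alongComp φ ψ l) x)ᵀ * g.matrix ψ (mapComp φ ψ Φ x) *
      rigFrame (mapComp φ ψ Φ) (alongComp φ ψ l) x) A B =
      g.val (Φ (φ.symm x)) (rigVec φ Φ l (φ.symm x) A) (rigVec φ Φ l (φ.symm x) B) := by
    rw [bilin_apply_eq_sum hψ hx', transpose_mul_mul_apply]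
    simp only [rigFrame_eq_vecComp hφ hψ hD.contMDiff hx hx']
    rfl
  rw [h1]
  rcases A with a | a <;> rcases B with b | b
  · exact (hD.gam_eq _ _ _).symm
  · exact ((g.symm _ _ _).trans (hD.ell_eq _ _)).symm
  · exact (hD.ell_eq _ _).symm
  · exact (hD.ell2_eq _).symm

theorem contDiffAt_mapComp (hD : D.IsEmbedded g Φ l) (hφ : φ ∈ IsManifold.maximalAtlas (𝓡 m) ∞ S)
    (hψ : ψ ∈ IsManifold.maximalAtlas (𝓡 (m + 1)) ∞ M)
    (hx : x ∈ φ.target) (hx' : Φ (φ.symm x) ∈ ψ.source) :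
    ContDiffAt ℝ ∞ (mapComp φ ψ Φ) x :=
  contDiffAt_chart_comp hφ hψ hD.contMDiff hx hx'

theorem contDiffAt_alongComp (hD : D.IsEmbedded g Φ l)
    (hφ : φ ∈ IsManifold.maximalAtlas (𝓡 m) ∞ S) (hx : x ∈ φ.target) (μ : Fin (m + 1)) :
    ContDiffAt ℝ ∞ (fun y => alongComp φ
      (chartAt (EuclideanSpace ℝ (Fin (m + 1))) (Φ (φ.symm x))) l y μ) x := by
  rw [← contMDiffAt_iff_contDiffAt]
  exact (contMDiffAt_vecComp hD.rigging.smooth.contMDiffAt μ).comp x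
    (contMDiffAt_symm_of_mem_maximalAtlas hφ hx)

theorem eventually_mem_source (hD : D.IsEmbedded g Φ l) (hx : x ∈ φ.target)
    (hx' : Φ (φ.symm x) ∈ ψ.source) :
    ∀ᶠ y in 𝓝 x, y ∈ φ.target ∧ Φ (φ.symm y) ∈ ψ.source := by
  have hc : ContinuousAt (fun y => Φ (φ.symm y)) x :=
    hD.contMDiff.continuous.continuousAt.comp (φ.continuousAt_symm hx)
  filter_upwards [φ.open_target.mem_nhds hx, hc.eventually (ψ.open_source.mem_nhds hx')]
    with y y1 y2 using ⟨y1, y2⟩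

/-- The tensor `Y` in terms of the chart of the atlas at the image point. -/
theorem HypersurfaceData.IsEmbedded.two_mul_Y_chartAt (hD : D.IsEmbedded g Φ l)
    (hφ : φ ∈ IsManifold.maximalAtlas (𝓡 m) ∞ S) (hx : x ∈ φ.target)
    (hψ : ψ = chartAt (EuclideanSpace ℝ (Fin (m + 1))) (Φ (φ.symm x))) (a b : Fin m) :
    2 * bilinComp D.Y φ x a b =
      pullLie (g.matrix ψ) (mapComp φ ψ Φ) (alongComp φ ψ l) x a b := by
  have hψm : ψ ∈ IsManifold.maximalAtlas (𝓡 (m + 1)) ∞ M :=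
    hψ ▸ IsManifold.chart_mem_maximalAtlas _
  have hx' : Φ (φ.symm x) ∈ ψ.source := hψ ▸ mem_chart_source _ _
  obtain ⟨L, hL, hY⟩ := hD.Y_eq (φ.symm x)
  have hLx : L (Φ (φ.symm x)) = l (φ.symm x) := hL.extends_rigging.self_of_nhds
  have hLd (μ : Fin (m + 1)) :
      DifferentiableAt ℝ (fun y => fieldComp L ψ y μ) (mapComp φ ψ Φ x) := by
    have h1 := contMDiffAt_vecComp hL.smooth μ
    rw [← hψ] at h1
    have h2 : ContMDiffAt (𝓡 (m + 1)) 𝓘(ℝ, ℝ) ∞ (fun y => fieldComp L ψ y μ)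
        (mapComp φ ψ Φ x) := by
      refine ContMDiffAt.comp (mapComp φ ψ Φ x)
        (g := fun q => vecComp ψ q (L q) μ) ?_
        (contMDiffAt_symm_of_mem_maximalAtlas hψm (ψ.map_source hx'))
      rw [mapComp, ψ.left_inv hx']
      exact h1
    exact (contMDiffAt_iff_contDiffAt.1 h2).differentiableAt (by simp)
  have hl : ∀ᶠ y in 𝓝 x, ∀ μ, alongComp φ ψ l y μ = fieldComp L ψ (mapComp φ ψ Φ y) μ := by
    filter_upwards [(φ.continuousAt_symm hx).eventually hL.extends_rigging,
      eventually_mem_source hD hx hx'] with y y1 y2 μ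
    rw [fieldComp, mapComp, ψ.left_inv y2.2, y1]
    rfl
  -- The Lie derivative differentiates the extension `L` only in tangential directions; there the
  -- chain rule replaces it by `l` itself.
  have hdl (c : Fin m) (μ : Fin (m + 1)) : pd (fun y => alongComp φ ψ l y μ) c x =
      ∑ α, rigFrame (mapComp φ ψ Φ) (alongComp φ ψ l) x α (Sum.inl c) *
        pd (fun y => fieldComp L ψ y μ) α (mapComp φ ψ Φ x) := by
    rw [pd_congr (hl.mono fun y hy => hy μ)]
    exact pd_comp ((contDiffAt_mapComp hD hφ hψm hx hx').differentiableAt (by simp)) (hLd μ) c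
  have hY' := hY (coordVec φ (φ.symm x) a) (coordVec φ (φ.symm x) b)
  have hE (α : Fin (m + 1)) (c : Fin m) :
      vecComp ψ (Φ (φ.symm x)) (mfderiv (𝓡 m) (𝓡 (m + 1)) Φ (φ.symm x)
        (coordVec φ (φ.symm x) c)) α =
      rigFrame (mapComp φ ψ Φ) (alongComp φ ψ l) x α (Sum.inl c) :=
    (rigFrame_eq_vecComp hφ hψm hD.contMDiff hx hx' α (Sum.inl c)).symm
  simp only [SpacetimeMetric.lieDeriv, ← hψ, hE] at hY'
  rw [bilinComp, ← hY', ← mul_assoc, show (2 : ℝ) * (1 / 2) = 1 by norm_num, one_mul]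
  set E := rigFrame (mapComp φ ψ Φ) (alongComp φ ψ l) x with hEdef
  have hLl (μ : Fin (m + 1)) : fieldComp L ψ (ψ (Φ (φ.symm x))) μ = alongComp φ ψ l x μ :=
    (hl.self_of_nhds μ).symm
  have hdE (c : Fin m) (μ : Fin (m + 1)) :
      matPd (rigFrame (mapComp φ ψ Φ) (alongComp φ ψ l)) c x μ (Sum.inr ()) =
      ∑ α, E α (Sum.inl c) * pd (fun y => fieldComp L ψ y μ) α (mapComp φ ψ Φ x) := hdl c μ
  have hsplit (v w : Fin (m + 1) → ℝ) (X1 X2 X3 : Fin (m + 1) → Fin (m + 1) → Fin (m + 1) → ℝ) :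
      ∑ α, ∑ β, v α * w β * ∑ μ, (X1 α β μ + X2 α β μ + X3 α β μ) =
      (∑ α, ∑ β, v α * w β * ∑ μ, X1 α β μ) + (∑ α, ∑ β, v α * w β * ∑ μ, X2 α β μ)
        + ∑ α, ∑ β, v α * w β * ∑ μ, X3 α β μ := by
    simp only [Finset.sum_add_distrib, mul_add]
  rw [hsplit, pullLie]
  congr 1
  · congr 1
    · rw [transpose_mul_mul_apply]
      refine Finset.sum_congr rfl fun α _ => Finset.sum_congr rfl fun β _ => ?_
      simp only [hLl, Matrix.sum_apply, Matrix.smul_apply, smul_eq_mul]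
      simp only [mapComp, matPd, Matrix.of_apply, SpacetimeMetric.matrix]
      ring
    · rw [Matrix.mul_assoc, Matrix.mul_apply]
      simp only [Matrix.mul_apply, hdE, Finset.mul_sum, Matrix.transpose_apply]
      rw [Finset.sum_comm]
      refine Finset.sum_congr rfl fun β _ => ?_
      rw [Finset.sum_comm]
      refine Finset.sum_congr rfl fun μ _ => Finset.sum_congr rfl fun α _ => ?_
      rw [g.matrix_symm ψ _ β μ]
      simp only [mapComp, SpacetimeMetric.matrix, Matrix.of_apply]
      ring
  · rw [Matrix.mul_assoc, Matrix.mul_apply]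
    simp only [Matrix.mul_apply, hdE, Finset.mul_sum, Matrix.transpose_apply]
    refine Finset.sum_congr rfl fun α _ => ?_
    rw [Finset.sum_comm]
    refine Finset.sum_congr rfl fun μ _ => Finset.sum_congr rfl fun β _ => ?_
    simp only [mapComp, SpacetimeMetric.matrix, Matrix.of_apply]
    ring

/-- The preferred chart `ψ'` at the image depends on the point. Moving to a fixed `ψ` gives one
formula valid near a given point, hence one that can be differentiated. -/
theorem HypersurfaceData.IsEmbedded.two_mul_Y (hD : D.IsEmbedded g Φ l)
    (hφ : φ ∈ IsManifold.maximalAtlas (𝓡 m) ∞ S)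
    (hψ : ψ ∈ IsManifold.maximalAtlas (𝓡 (m + 1)) ∞ M)
    (hx : x ∈ φ.target) (hx' : Φ (φ.symm x) ∈ ψ.source)
    (hl : ∀ μ, ContDiffAt ℝ 1 (fun y => alongComp φ ψ l y μ) x) (a b : Fin m) :
    2 * bilinComp D.Y φ x a b =
      pullLie (g.matrix ψ) (mapComp φ ψ Φ) (alongComp φ ψ l) x a b := by
  set ψ' := chartAt (EuclideanSpace ℝ (Fin (m + 1))) (Φ (φ.symm x)) with hψ'
  have hψm : ψ' ∈ IsManifold.maximalAtlas (𝓡 (m + 1)) ∞ M := IsManifold.chart_mem_maximalAtlas _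
  have hx'' : Φ (φ.symm x) ∈ ψ'.source := mem_chart_source _ _
  rw [hD.two_mul_Y_chartAt hφ hx hψ']
  have hfx : ψ.symm (mapComp φ ψ Φ x) = Φ (φ.symm x) := ψ.left_inv hx'
  have hft : mapComp φ ψ Φ x ∈ ψ.target := ψ.map_source hx'
  refine pullLie_change_coord (t := fun z => ψ' (ψ.symm z)) ?_ (g.matrix_symm ψ') ?_
    ((contDiffAt_mapComp hD hφ hψ hx hx').of_le (by norm_cast)) hl ?_ ?_ ?_ a b
  · rw [hfx]
    exact (g.matContDiffAt_matrix hψm (ψ'.map_source hx'')).of_le (by norm_num)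
  · exact (contDiffAt_chart_comp hψ hψm (contMDiff_id (I := 𝓡 (m + 1)) (M := M)) hft
      (by rwa [id_eq, hfx])).of_le (by norm_cast)
  · have h1 : ∀ᶠ y in 𝓝 (mapComp φ ψ Φ x), ψ.symm y ∈ ψ'.source :=
      (ψ.continuousAt_symm hft).eventually (ψ'.open_source.mem_nhds (by rwa [hfx]))
    filter_upwards [h1, ψ.open_target.mem_nhds hft] with y y1 y2
    exact g.matrix_change_chart hψ hψm y2 y1
  · filter_upwards [eventually_mem_source hD hx hx'] with y hy
    simp only [mapComp, ψ.left_inv hy.2]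
  · filter_upwards [eventually_mem_source hD hx hx', eventually_mem_source hD hx hx'']
      with y y1 y2
    ext i
    exact vecComp_change_chart hψ hψm y1.2 y2.2 _ i

end EmbeddedInCharts

/-! ### The Einstein tensor along an embedded hypersurface -/

section EinsteinFrame

theorem matCurv_swap {k : ℕ} {ι : Type*} [Fintype ι]
    (Θ : Fin k → EuclideanSpace ℝ (Fin k) → Matrix ι ι ℝ) (c d : Fin k)
    (x : EuclideanSpace ℝ (Fin k)) : matCurv Θ c d x = -matCurv Θ d c x := by
  simp only [matCurv]
  abel

/-! ### Antisymmetries of the frame curvature -/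

section FrameCurv

variable {m : ℕ} {E : Matrix (Fin (m + 1)) (Fin m ⊕ Unit) ℝ}
  {G : Matrix (Fin (m + 1)) (Fin (m + 1)) ℝ}
  {K : Fin (m + 1) → Fin (m + 1) → Matrix (Fin (m + 1)) (Fin (m + 1)) ℝ}

theorem frameCurv_antisymm_left (hK : ∀ γ δ, (G * K γ δ)ᵀ = -(G * K γ δ))
    (A B C D : Fin m ⊕ Unit) : frameCurv E G K A B C D = -frameCurv E G K B A C D := by
  simp only [frameCurv, ← Finset.sum_neg_distrib]
  refine Finset.sum_congr rfl fun γ _ => Finset.sum_congr rfl fun δ _ => ?_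
  have h : (Eᵀ * (G * K γ δ) * E)ᵀ = -(Eᵀ * (G * K γ δ) * E) := by
    rw [Matrix.transpose_mul, Matrix.transpose_mul, hK, Matrix.transpose_transpose,
      Matrix.neg_mul, Matrix.mul_neg]
    simp only [Matrix.mul_assoc]
  have h1 : (Eᵀ * (G * K γ δ) * E) B A = -(Eᵀ * (G * K γ δ) * E) A B := congrFun (congrFun h A) B
  rw [h1]
  ring

theorem frameCurv_antisymm_right (hK : ∀ γ δ, K γ δ = -K δ γ)
    (A B C D : Fin m ⊕ Unit) : frameCurv E G K A B C D = -frameCurv E G K A B D C := by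
  simp only [frameCurv, ← Finset.sum_neg_distrib]
  rw [Finset.sum_comm]
  refine Finset.sum_congr rfl fun γ _ => Finset.sum_congr rfl fun δ _ => ?_
  rw [hK δ γ, Matrix.mul_neg, Matrix.mul_neg, Matrix.neg_mul, Matrix.neg_apply]
  ring

end FrameCurv

variable {m : ℕ} {S M : Type*}
  [TopologicalSpace S] [ChartedSpace (EuclideanSpace ℝ (Fin m)) S]
  [TopologicalSpace M] [ChartedSpace (EuclideanSpace ℝ (Fin (m + 1))) M]
  [IsManifold (𝓡 (m + 1)) ∞ M]
  {g : SpacetimeMetric m M} {D : HypersurfaceData m S} {Φ : S → M}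
  {l : ∀ p : S, TangentSpace (𝓡 (m + 1)) (Φ p)}
  {φ : OpenPartialHomeomorph S (EuclideanSpace ℝ (Fin m))}
  {x : EuclideanSpace ℝ (Fin m)}

/-- The curvature `R(e_c, e_d)` of the ambient connection in the frame `(e_a, l)`. -/
def HypersurfaceData.frameCurvature (D : HypersurfaceData m S)
    (φ : OpenPartialHomeomorph S (EuclideanSpace ℝ (Fin m))) (x : EuclideanSpace ℝ (Fin m))
    (c d : Fin m) : Matrix (Fin m ⊕ Unit) (Fin m ⊕ Unit) ℝ :=
  matCurv (frameConn (D.coordMat φ) (bilinComp D.Y φ)) c d x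

/-- This isolates what the contractions need to know about the ambient space: an array with two
antisymmetries whose entries with tangential last pair come from the data. Its remaining entries
stay unspecified. -/
theorem HypersurfaceData.IsEmbedded.exists_frameCurv (hD : D.IsEmbedded g Φ l)
    (hφ : φ ∈ IsManifold.maximalAtlas (𝓡 m) ∞ S) (hx : x ∈ φ.target)
    {ν : TangentSpace (𝓡 (m + 1)) (Φ (φ.symm x)) →L[ℝ] ℝ}
    (hν : IsNormalForm Φ l (φ.symm x) ν) :
    ∃ R : Fin m ⊕ Unit → Fin m ⊕ Unit → Fin m ⊕ Unit → Fin m ⊕ Unit → ℝ,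
      (∀ A B C D, R A B C D = -R B A C D) ∧ (∀ A B C D, R A B C D = -R A B D C) ∧
      (∀ c d A B, R A B (Sum.inl c) (Sum.inl d) =
        (D.coordMat φ x * D.frameCurvature φ x c d) A B) ∧
      ∀ A, g.einstein (Φ (φ.symm x)) ν (rigVec φ Φ l (φ.symm x) A) =
        (∑ B, (D.coordMat φ x)⁻¹ (Sum.inr ()) B * ∑ A', ∑ C, (D.coordMat φ x)⁻¹ A' C * R A' B C A)
        - (1 / 2) * (if A = Sum.inr () then 1 else 0) *
          ∑ B, ∑ A'', (D.coordMat φ x)⁻¹ B A'' *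
            ∑ A', ∑ C, (D.coordMat φ x)⁻¹ A' C * R A' B C A'' := by
  set ψ := chartAt (EuclideanSpace ℝ (Fin (m + 1))) (Φ (φ.symm x)) with hψdef
  have hψ : ψ ∈ IsManifold.maximalAtlas (𝓡 (m + 1)) ∞ M := IsManifold.chart_mem_maximalAtlas _
  have hx' : Φ (φ.symm x) ∈ ψ.source := mem_chart_source _ _
  set f := mapComp φ ψ Φ with hf
  set lc := alongComp φ ψ l with hlc
  set E := rigFrame f lc x with hE
  set G := g.matrix ψ (f x) with hG
  set h := D.coordMat φ x with hh
  set K := fun γ δ => matCurv (connMat (leviCivita (g.matrix ψ))) γ δ (f x) with hK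
  have hft : f x ∈ ψ.target := ψ.map_source hx'
  have hGc := g.matContDiffAt_matrix hψ hft
  have hGdet := g.det_matrix_ne_zero hψ hft
  have hhE : h = Eᵀ * G * E := hD.coordMat_eq hφ hψ hx hx'
  have hhdet : h.det ≠ 0 := D.det_coordMat_ne_zero hφ hx
  have hht : hᵀ = h := Matrix.ext fun A B => D.mat_symm _ _ _ _
  have hHsymm (A B) : h⁻¹ A B = h⁻¹ B A := by
    have : (h⁻¹)ᵀ = h⁻¹ := by rw [Matrix.transpose_nonsing_inv, hht]
    exact congrFun (congrFun this B) A
  have hfc : ContDiffAt ℝ ∞ f x := contDiffAt_mapComp hD hφ hψ hx hx'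
  have hlcc (μ : Fin (m + 1)) : ContDiffAt ℝ 2 (fun y => lc y μ) x :=
    (contDiffAt_alongComp hD hφ hx μ).of_le (by norm_cast)
  -- The chart `ψ` is fixed at the point `x` while `y` varies.
  have hY : ∀ᶠ y in 𝓝 x, ∀ a b, 2 * bilinComp D.Y φ y a b = pullLie (g.matrix ψ) f lc y a b := by
    have e1 : ∀ᶠ y in 𝓝 x, ∀ μ, ContDiffAt ℝ 1 (fun y => lc y μ) y :=
      eventually_all.2 fun μ => ((hlcc μ).of_le (by norm_num)).eventually (by simp)
    filter_upwards [e1, eventually_mem_source hD hx hx'] with y y1 y2 a b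
    exact hD.two_mul_Y hφ hψ y2.1 y2.2 y1 a b
  have hcurv (c d : Fin m) : matCurv (pullConn (leviCivita (g.matrix ψ)) f) c d x * E =
      E * D.frameCurvature φ x c d := by
    refine matCurv_pullConn_mul_rigFrame (g.matrix_symm ψ) hGc hGdet (hfc.of_le (by norm_cast))
      hlcc ?_ (D.matContDiffAt_coordMat hφ hx) hhdet (fun a b => ?_) hY c d
    · filter_upwards [eventually_mem_source hD hx hx'] with y hy
      exact hD.coordMat_eq hφ hψ hy.1 hy.2
    · exact (D.Y_contDiff φ hφ a b).contDiffAt (φ.open_target.mem_nhds hx)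
  refine ⟨frameCurv E G K,
    frameCurv_antisymm_left fun γ δ => curvature_leviCivita_antisymm (g.matrix_symm ψ) hGc hGdet _ _,
    frameCurv_antisymm_right fun γ δ => matCurv_swap _ _ _ _, fun c d A B => ?_, fun A => ?_⟩
  · have h1 : h * D.frameCurvature φ x c d =
        Eᵀ * (G * matCurv (pullConn (leviCivita (g.matrix ψ)) f) c d x) * E := by
      rw [hhE, Matrix.mul_assoc, ← hcurv]
      simp only [Matrix.mul_assoc]
    rw [h1, matCurv_pullConn (hfc.of_le (by norm_cast)) (matContDiffAt_leviCivita hGc hGdet)]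
    simp only [Matrix.mul_sum, Matrix.sum_mul, Matrix.mul_smul, Matrix.smul_mul,
      Matrix.sum_apply, Matrix.smul_apply, smul_eq_mul]
    rfl
  -- The two defining properties of the normal one-form make it the dual of the last frame vector.
  · have hρ (A) : ∑ μ, ν (coordVec ψ (Φ (φ.symm x)) μ) * E μ A =
        if A = Sum.inr () then 1 else 0 := by
      have h1 : ∑ μ, ν (coordVec ψ (Φ (φ.symm x)) μ) * E μ A = ν (rigVec φ Φ l (φ.symm x) A) := by
        have h2 := form_apply_eq_sum hψ hx' (ν : TangentSpace (𝓡 (m + 1)) (Φ (φ.symm x)) →ₗ[ℝ] ℝ)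
          (rigVec φ Φ l (φ.symm x) A)
        simp only [ContinuousLinearMap.coe_coe] at h2
        rw [h2]
        refine Finset.sum_congr rfl fun μ _ => ?_
        rw [hE, rigFrame_eq_vecComp hφ hψ hD.contMDiff hx hx', smul_eq_mul, mul_comm]
      rw [h1]
      rcases A with a | a
      · simpa [rigVec] using hν.tangent _
      · simpa [rigVec] using hν.rigging
    simp only [sum_frameCurv K hhE hhdet hHsymm]
    rw [← sum_einstein_eq (Q := Matrix.of fun β δ => ∑ α, K α δ α β) hhE hhdet hρ]
    simp only [SpacetimeMetric.einstein, SpacetimeMetric.einsteinComp, SpacetimeMetric.scalarComp,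
      SpacetimeMetric.ricciComp, SpacetimeMetric.christoffel_eq, curvatureCoeff_eq_matCurv,
      ← hψdef]
    refine Finset.sum_congr rfl fun μ _ => Finset.sum_congr rfl fun ν' _ => ?_
    rw [hE, rigFrame_eq_vecComp hφ hψ hD.contMDiff hx hx']
    rfl

variable {ν : TangentSpace (𝓡 (m + 1)) (Φ (φ.symm x)) →L[ℝ] ℝ}

theorem MetricHypersurfaceData.inv_coordMat_symm (D : MetricHypersurfaceData m S)
    (A B : Fin m ⊕ Unit) : (D.coordMat φ x)⁻¹ A B = (D.coordMat φ x)⁻¹ B A := by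
  have h1 : (D.coordMat φ x)ᵀ = D.coordMat φ x := Matrix.ext fun A B => D.mat_symm _ _ _ _
  have : ((D.coordMat φ x)⁻¹)ᵀ = (D.coordMat φ x)⁻¹ := by rw [Matrix.transpose_nonsing_inv, h1]
  exact congrFun (congrFun this B) A

theorem HypersurfaceData.IsEmbedded.einstein_rigging (hD : D.IsEmbedded g Φ l)
    (hφ : φ ∈ IsManifold.maximalAtlas (𝓡 m) ∞ S) (hx : x ∈ φ.target)
    (hν : IsNormalForm Φ l (φ.symm x) ν) :
    -g.einstein (Φ (φ.symm x)) ν (l (φ.symm x)) =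
      (1 / 2) * ((∑ b, ∑ c, ∑ d, D.PComp φ x b d *
        D.frameCurvature φ x c d (Sum.inl c) (Sum.inl b))
      + ∑ b, ∑ c, ∑ d, D.PComp φ x b d * D.nComp φ x c
        * (D.coordMat φ x * D.frameCurvature φ x c d) (Sum.inr ()) (Sum.inl b)) := by
  obtain ⟨R, h1, h2, h3, h4⟩ := hD.exists_frameCurv hφ hx hν
  have h5 := h4 (Sum.inr ())
  rw [if_pos rfl, mul_one, sum_contract_inr
    (Matrix.nonsing_inv_mul _ (Ne.isUnit (D.det_coordMat_ne_zero hφ hx)))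
    D.inv_coordMat_symm h1 h2 h3] at h5
  change -g.einstein (Φ (φ.symm x)) ν (rigVec φ Φ l (φ.symm x) (Sum.inr ())) = _
  rw [h5, neg_mul, neg_neg]
  rfl

theorem HypersurfaceData.IsEmbedded.einstein_tangent (hD : D.IsEmbedded g Φ l)
    (hφ : φ ∈ IsManifold.maximalAtlas (𝓡 m) ∞ S) (hx : x ∈ φ.target)
    (hν : IsNormalForm Φ l (φ.symm x) ν) (c : Fin m) :
    g.einstein (Φ (φ.symm x)) ν
      (mfderiv (𝓡 m) (𝓡 (m + 1)) Φ (φ.symm x) (coordVec φ (φ.symm x) c)) =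
      -(∑ b, ∑ d, D.PComp φ x b d * D.frameCurvature φ x d c (Sum.inr ()) (Sum.inl b))
      + ∑ b, ∑ d, D.nComp φ x b * D.nComp φ x d
        * (D.coordMat φ x * D.frameCurvature φ x d c) (Sum.inr ()) (Sum.inl b) := by
  obtain ⟨R, h1, h2, h3, h4⟩ := hD.exists_frameCurv hφ hx hν
  have h5 := h4 (Sum.inl c)
  rw [if_neg (by simp), mul_zero, zero_mul, sub_zero, sum_contract_inl
    (Matrix.nonsing_inv_mul _ (Ne.isUnit (D.det_coordMat_ne_zero hφ hx)))
    D.inv_coordMat_symm h1 h3] at h5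
  exact h5

end EinsteinFrame

/-! ### The connection of the frame in terms of the hypersurface data -/

section DataConnection

variable {m : ℕ} {S : Type*} [TopologicalSpace S] [ChartedSpace (EuclideanSpace ℝ (Fin m)) S]
  {φ : OpenPartialHomeomorph S (EuclideanSpace ℝ (Fin m))} {x : EuclideanSpace ℝ (Fin m)}

theorem lowConn_add_transpose
    {h : EuclideanSpace ℝ (Fin m) → Matrix (Fin m ⊕ Unit) (Fin m ⊕ Unit) ℝ}
    (hsymm : ∀ y A B, h y A B = h y B A) (Y : EuclideanSpace ℝ (Fin m) → Fin m → Fin m → ℝ)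
    (a : Fin m) : lowConn h Y a x + (lowConn h Y a x)ᵀ = matPd h a x := by
  ext A B
  rcases A with b | u <;> rcases B with c | v
  · simp only [lowConn, matPd, Matrix.add_apply, Matrix.transpose_apply,
      Matrix.fromBlocks_apply₁₁, Matrix.of_apply]
    simp only [fun y => hsymm y (Sum.inl c) (Sum.inl b)]
    ring
  · simp only [lowConn, matPd, Matrix.add_apply, Matrix.transpose_apply,
      Matrix.fromBlocks_apply₁₂, Matrix.fromBlocks_apply₂₁, Matrix.of_apply]
    ring
  · simp only [lowConn, matPd, Matrix.add_apply, Matrix.transpose_apply,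
      Matrix.fromBlocks_apply₁₂, Matrix.fromBlocks_apply₂₁, Matrix.of_apply]
    simp only [fun y => hsymm y (Sum.inr u) (Sum.inl c)]
    ring
  · simp only [lowConn, matPd, Matrix.add_apply, Matrix.transpose_apply,
      Matrix.fromBlocks_apply₂₂, Matrix.of_apply]
    ring

theorem matPd_inv_add {ι : Type*} [Fintype ι] [DecidableEq ι]
    {h : EuclideanSpace ℝ (Fin m) → Matrix ι ι ℝ} (hh : MatContDiffAt 1 h x)
    (hdet : (h x).det ≠ 0) (a : Fin m) :
    matPd (fun y => (h y)⁻¹) a x * h x + (h x)⁻¹ * matPd h a x = 0 := by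
  rw [← matPd_mul (hh.inv hdet) hh]
  have e : (fun y => (h y)⁻¹ * h y) =ᶠ[𝓝 x] fun _ => 1 := by
    filter_upwards [hh.det.continuousAt.eventually_ne hdet] with y hy
    exact Matrix.nonsing_inv_mul _ (Ne.isUnit hy)
  rw [matPd_congr e]
  ext i j
  exact pd_const _ _

theorem matPd_inv {ι : Type*} [Fintype ι] [DecidableEq ι]
    {h : EuclideanSpace ℝ (Fin m) → Matrix ι ι ℝ} (hh : MatContDiffAt 1 h x)
    (hdet : (h x).det ≠ 0) (a : Fin m) :
    matPd (fun y => (h y)⁻¹) a x = -((h x)⁻¹ * matPd h a x * (h x)⁻¹) := by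
  have h1 := congrArg (· * (h x)⁻¹) (matPd_inv_add hh hdet a)
  simp only [Matrix.add_mul, Matrix.zero_mul, Matrix.mul_assoc,
    Matrix.mul_nonsing_inv _ (Ne.isUnit hdet), Matrix.mul_one] at h1
  rw [eq_neg_of_add_eq_zero_left h1, Matrix.mul_assoc]

namespace HypersurfaceData

variable (D : HypersurfaceData m S)

/-- The components of `dℓ⁽²⁾`. -/
def dell2Comp (φ : OpenPartialHomeomorph S (EuclideanSpace ℝ (Fin m)))
    (x : EuclideanSpace ℝ (Fin m)) (a : Fin m) : ℝ :=
  pd (fun y => D.ell2 (φ.symm y)) a x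

/-- Here the metric hypersurface connection originates: it is the tangential part of `∇_a e_b` with
the term in `Y` removed. -/
theorem frameConn_inl_inl (a b c : Fin m) :
    frameConn (D.coordMat φ) (bilinComp D.Y φ) a x (Sum.inl c) (Sum.inl b) =
      D.conn φ x c a b - D.nComp φ x c * bilinComp D.Y φ x a b := by
  rw [frameConn, Matrix.mul_apply, Fintype.sum_sum_type]
  simp only [lowConn, Matrix.fromBlocks_apply₁₁, Matrix.fromBlocks_apply₂₁, Matrix.of_apply,
    Finset.univ_unique, Finset.sum_singleton, MetricHypersurfaceData.conn, Finset.mul_sum]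
  rw [mul_sub, ← add_sub_assoc]
  congr 2
  · exact Finset.sum_congr rfl fun d _ => mul_left_comm _ _ _
  · exact (mul_left_comm _ _ _).trans (mul_assoc _ _ _).symm

/-- The tangential part of `∇_a l`; `F` and `Y` are the two halves of `⟨e_c, ∇_a l⟩`. -/
theorem frameConn_inl_inr (a b : Fin m) :
    frameConn (D.coordMat φ) (bilinComp D.Y φ) a x (Sum.inl b) (Sum.inr ()) =
      (∑ c, D.PComp φ x b c * (D.FComp φ x a c + bilinComp D.Y φ x a c))
        + (1 / 2) * D.nComp φ x b * D.dell2Comp φ x a := by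
  rw [frameConn, Matrix.mul_apply, Fintype.sum_sum_type]
  simp only [lowConn, Matrix.fromBlocks_apply₁₂, Matrix.fromBlocks_apply₂₂, Matrix.of_apply,
    Finset.univ_unique, Finset.sum_singleton]
  congr 1
  exact (mul_left_comm _ _ _).trans (mul_assoc _ _ _).symm

theorem frameConn_inr_inr (a : Fin m) :
    frameConn (D.coordMat φ) (bilinComp D.Y φ) a x (Sum.inr ()) (Sum.inr ()) =
      (∑ c, D.nComp φ x c * (D.FComp φ x a c + bilinComp D.Y φ x a c))
        + (1 / 2) * D.n2Comp φ x * D.dell2Comp φ x a := by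
  rw [frameConn, Matrix.mul_apply, Fintype.sum_sum_type]
  simp only [lowConn, Matrix.fromBlocks_apply₁₂, Matrix.fromBlocks_apply₂₂, Matrix.of_apply,
    Finset.univ_unique, Finset.sum_singleton]
  congr 1
  · refine Finset.sum_congr rfl fun c _ => ?_
    rw [D.inv_coordMat_symm]
    rfl
  · exact (mul_left_comm _ _ _).trans (mul_assoc _ _ _).symm

/-- The definition of `U` differentiates `n` and `n⁽²⁾`. Differentiating `n^f γ_fd + n⁽²⁾ ℓ_d = 0`
trades these for derivatives of `γ` and `ℓ`, the form in which the frame connection produces them.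
-/
theorem UComp_eq (hφ : φ ∈ IsManifold.maximalAtlas (𝓡 m) ∞ S) (hx : x ∈ φ.target) (a b : Fin m) :
    D.UComp φ x a b = -((∑ d, D.nComp φ x d * ((1 / 2) * (pd (fun y => bilinComp D.gam φ y b d) a x
        + pd (fun y => bilinComp D.gam φ y a d) b x - pd (fun y => bilinComp D.gam φ y a b) d x)))
      + D.n2Comp φ x * ((1 / 2) * (pd (fun y => formComp D.ell φ y b) a x
        + pd (fun y => formComp D.ell φ y a) b x))) := by
  have key (c d : Fin m) : (∑ f, pd (fun y => D.nComp φ y f) c x * bilinComp D.gam φ x f d)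
      + pd (D.n2Comp φ) c x * formComp D.ell φ x d
      + ((∑ f, D.nComp φ x f * pd (fun y => bilinComp D.gam φ y d f) c x)
      + D.n2Comp φ x * pd (fun y => formComp D.ell φ y d) c x) = 0 := by
    -- One off-diagonal entry of the derivative of `𝔸⁻¹ 𝔸 = 1`.
    have h1 := congrFun (congrFun (matPd_inv_add
      ((D.matContDiffAt_coordMat hφ hx).of_le (by norm_num)) (D.det_coordMat_ne_zero hφ hx) c)
      (Sum.inr ())) (Sum.inl d)
    rw [Matrix.add_apply, Matrix.mul_apply, Matrix.mul_apply, Fintype.sum_sum_type,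
      Fintype.sum_sum_type] at h1
    simp only [Finset.univ_unique, Finset.sum_singleton, Matrix.zero_apply, matPd, Matrix.of_apply,
      D.inv_coordMat_symm (Sum.inr ()) (Sum.inl _)] at h1
    have h2 (f : Fin m) : (fun y => bilinComp D.gam φ y d f) = fun y => bilinComp D.gam φ y f d :=
      funext fun y => D.gam_symm _ _ _
    simp only [h2]
    exact h1
  have k1 := key a b
  have k2 := key b a
  have hg (c d : Fin m) : bilinComp D.gam φ x c d = bilinComp D.gam φ x d c := D.gam_symm _ _ _
  have e1 : D.lieGamComp φ x a b =
      (∑ c, D.nComp φ x c * pd (fun y => bilinComp D.gam φ y a b) c x)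
      + (∑ f, pd (fun y => D.nComp φ y f) a x * bilinComp D.gam φ x f b)
      + ∑ f, pd (fun y => D.nComp φ y f) b x * bilinComp D.gam φ x f a := by
    simp only [MetricHypersurfaceData.lieGamComp, Finset.sum_add_distrib]
    congr 1
    · congr 1
      exact Finset.sum_congr rfl fun c _ => mul_comm _ _
    · exact Finset.sum_congr rfl fun c _ => by rw [hg a c, mul_comm]
  have e2 : ∑ d, D.nComp φ x d * ((1 / 2) * (pd (fun y => bilinComp D.gam φ y b d) a x
        + pd (fun y => bilinComp D.gam φ y a d) b x - pd (fun y => bilinComp D.gam φ y a b) d x)) =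
      (1 / 2) * ((∑ f, D.nComp φ x f * pd (fun y => bilinComp D.gam φ y b f) a x)
      + (∑ f, D.nComp φ x f * pd (fun y => bilinComp D.gam φ y a f) b x)
      - ∑ c, D.nComp φ x c * pd (fun y => bilinComp D.gam φ y a b) c x) := by
    rw [← Finset.sum_add_distrib, ← Finset.sum_sub_distrib, Finset.mul_sum]
    exact Finset.sum_congr rfl fun d _ => by ring
  rw [MetricHypersurfaceData.UComp, e1, e2]
  linear_combination (1 / 2) * k1 + (1 / 2) * k2

/-- The transverse part of `∇_a e_b`, that is, the second fundamental form up to sign. -/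
theorem frameConn_inr_inl (hφ : φ ∈ IsManifold.maximalAtlas (𝓡 m) ∞ S) (hx : x ∈ φ.target)
    (a b : Fin m) :
    frameConn (D.coordMat φ) (bilinComp D.Y φ) a x (Sum.inr ()) (Sum.inl b) =
      -(D.UComp φ x a b + D.n2Comp φ x * bilinComp D.Y φ x a b) := by
  rw [frameConn, Matrix.mul_apply, Fintype.sum_sum_type, D.UComp_eq hφ hx]
  simp only [lowConn, Matrix.fromBlocks_apply₁₁, Matrix.fromBlocks_apply₂₁, Matrix.of_apply,
    Finset.univ_unique, Finset.sum_singleton, D.inv_coordMat_symm (Sum.inr ()) (Sum.inl _)]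
  rw [mul_sub, neg_add, neg_neg, ← sub_eq_add_neg, ← add_sub_assoc]
  rfl

/-- The inverse of the metric of the frame is covariantly constant. -/
theorem matPd_inv_coordMat (hφ : φ ∈ IsManifold.maximalAtlas (𝓡 m) ∞ S) (hx : x ∈ φ.target)
    (a : Fin m) (A B : Fin m ⊕ Unit) :
    pd (fun y => (D.coordMat φ y)⁻¹ A B) a x =
      -(∑ C, frameConn (D.coordMat φ) (bilinComp D.Y φ) a x A C * (D.coordMat φ x)⁻¹ C B)
      - ∑ C, frameConn (D.coordMat φ) (bilinComp D.Y φ) a x B C * (D.coordMat φ x)⁻¹ C A := by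
  -- Inserting `∂_a h = W_a + W_aᵀ` into `-h⁻¹ (∂_a h) h⁻¹` brings out the connection matrix `h⁻¹
  -- W_a`.
  have h1 := matPd_inv ((D.matContDiffAt_coordMat hφ hx).of_le (s := 1) (by norm_num))
    (D.det_coordMat_ne_zero hφ hx) a
  rw [← lowConn_add_transpose (h := D.coordMat φ) (fun y => D.mat_symm _ _) (bilinComp D.Y φ)] at h1
  have ht : ((D.coordMat φ x)⁻¹)ᵀ = (D.coordMat φ x)⁻¹ :=
    Matrix.ext fun A B => D.inv_coordMat_symm _ _
  have h2 : (D.coordMat φ x)⁻¹ * (lowConn (D.coordMat φ) (bilinComp D.Y φ) a x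
      + (lowConn (D.coordMat φ) (bilinComp D.Y φ) a x)ᵀ) * (D.coordMat φ x)⁻¹ =
      frameConn (D.coordMat φ) (bilinComp D.Y φ) a x * (D.coordMat φ x)⁻¹
      + (frameConn (D.coordMat φ) (bilinComp D.Y φ) a x * (D.coordMat φ x)⁻¹)ᵀ := by
    simp only [frameConn, Matrix.transpose_mul, ht, Matrix.mul_add, Matrix.add_mul,
      Matrix.mul_assoc]
  rw [h2, neg_add'] at h1
  exact congrFun (congrFun h1 A) B

end HypersurfaceData

end DataConnection

/-! ### Covariant derivatives of `P`, `n`, `n⁽²⁾` and the Gauss-Codazzi equations -/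

section GaussCodazzi

/-- The contraction `P^{bf} T_{af}`. -/
def raiseSnd {m : ℕ} (P T : Fin m → Fin m → ℝ) (a b : Fin m) : ℝ := ∑ f, P b f * T a f

/-- The contraction `T_{af} n^f`. -/
def contrSnd {m : ℕ} (T : Fin m → Fin m → ℝ) (n : Fin m → ℝ) (a : Fin m) : ℝ := ∑ f, T a f * n f

namespace HypersurfaceData

variable {m : ℕ} {S : Type*} [TopologicalSpace S] [ChartedSpace (EuclideanSpace ℝ (Fin m)) S]
  {φ : OpenPartialHomeomorph S (EuclideanSpace ℝ (Fin m))} {x : EuclideanSpace ℝ (Fin m)}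
  (D : HypersurfaceData m S)

theorem PComp_symm (b c : Fin m) : D.PComp φ x b c = D.PComp φ x c b :=
  D.inv_coordMat_symm _ _

theorem frameConn_inl_inr' (a b : Fin m) :
    frameConn (D.coordMat φ) (bilinComp D.Y φ) a x (Sum.inl b) (Sum.inr ()) =
      raiseSnd (D.PComp φ x) (D.FComp φ x) a b + raiseSnd (D.PComp φ x) (bilinComp D.Y φ x) a b
        + (1 / 2) * D.nComp φ x b * D.dell2Comp φ x a := by
  rw [D.frameConn_inl_inr, raiseSnd, raiseSnd, ← Finset.sum_add_distrib]
  congr 1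
  exact Finset.sum_congr rfl fun c _ => by ring

theorem frameConn_inr_inr' (a : Fin m) :
    frameConn (D.coordMat φ) (bilinComp D.Y φ) a x (Sum.inr ()) (Sum.inr ()) =
      contrSnd (D.FComp φ x) (D.nComp φ x) a + contrSnd (bilinComp D.Y φ x) (D.nComp φ x) a
        + (1 / 2) * D.n2Comp φ x * D.dell2Comp φ x a := by
  rw [D.frameConn_inr_inr, contrSnd, contrSnd, ← Finset.sum_add_distrib]
  congr 1
  exact Finset.sum_congr rfl fun c _ => by ring

/-- A block of the constancy of `𝔸⁻¹`. The terms in `Y` cancel, as they must: neither `n` nor `∇°`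
involves `Y`. -/
theorem covVec_nComp (hφ : φ ∈ IsManifold.maximalAtlas (𝓡 m) ∞ S) (hx : x ∈ φ.target)
    (a c : Fin m) :
    D.covVec φ (D.nComp φ) x a c =
      -D.n2Comp φ x * raiseSnd (D.PComp φ x) (D.FComp φ x) a c
      + raiseSnd (D.PComp φ x) (D.UComp φ x) a c
      - D.nComp φ x c * contrSnd (D.FComp φ x) (D.nComp φ x) a
      - D.n2Comp φ x * D.nComp φ x c * D.dell2Comp φ x a := by
  have h1 : pd (fun y => D.nComp φ y c) a x = _ :=
    D.matPd_inv_coordMat hφ hx a (Sum.inl c) (Sum.inr ())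
  rw [MetricHypersurfaceData.covVec, h1, Fintype.sum_sum_type, Fintype.sum_sum_type]
  simp only [Finset.univ_unique, Finset.sum_singleton, PUnit.default_eq_unit,
    D.frameConn_inl_inl, D.frameConn_inr_inl hφ hx, D.frameConn_inl_inr', D.frameConn_inr_inr']
  change -((∑ f, (D.conn φ x c a f - D.nComp φ x c * bilinComp D.Y φ x a f) * D.nComp φ x f)
      + _ * D.n2Comp φ x) - ((∑ f, -(D.UComp φ x a f + D.n2Comp φ x * bilinComp D.Y φ x a f) *
        D.PComp φ x f c) + _ * (D.coordMat φ x)⁻¹ (Sum.inr ()) (Sum.inl c)) + _ = _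
  have e0 : (D.coordMat φ x)⁻¹ (Sum.inr ()) (Sum.inl c) = D.nComp φ x c :=
    D.inv_coordMat_symm _ _
  have e1 : ∑ f, (D.conn φ x c a f - D.nComp φ x c * bilinComp D.Y φ x a f) * D.nComp φ x f =
      (∑ f, D.conn φ x c a f * D.nComp φ x f)
        - D.nComp φ x c * contrSnd (bilinComp D.Y φ x) (D.nComp φ x) a := by
    rw [contrSnd, Finset.mul_sum, ← Finset.sum_sub_distrib]
    exact Finset.sum_congr rfl fun f _ => by ring
  have e2 : ∑ f, -(D.UComp φ x a f + D.n2Comp φ x * bilinComp D.Y φ x a f) * D.PComp φ x f c =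
      -(raiseSnd (D.PComp φ x) (D.UComp φ x) a c
        + D.n2Comp φ x * raiseSnd (D.PComp φ x) (bilinComp D.Y φ x) a c) := by
    rw [raiseSnd, raiseSnd, Finset.mul_sum, ← Finset.sum_add_distrib, ← Finset.sum_neg_distrib]
    exact Finset.sum_congr rfl fun f _ => by rw [D.PComp_symm f c]; ring
  rw [e0, e1, e2]
  ring

/-- The covariant derivative `∇°_a M^{bc}`. -/
def covBiv (φ : OpenPartialHomeomorph S (EuclideanSpace ℝ (Fin m)))
    (M : EuclideanSpace ℝ (Fin m) → Fin m → Fin m → ℝ) (x : EuclideanSpace ℝ (Fin m))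
    (a b c : Fin m) : ℝ :=
  pd (fun y => M y b c) a x + (∑ f, D.conn φ x b a f * M x f c) + ∑ f, D.conn φ x c a f * M x b f

/-- The tangential block of the same identity. It shows that `P` fails to be parallel only through
`F` and `dℓ⁽²⁾`. -/
theorem covBiv_PComp (hφ : φ ∈ IsManifold.maximalAtlas (𝓡 m) ∞ S) (hx : x ∈ φ.target)
    (a b c : Fin m) :
    D.covBiv φ (D.PComp φ) x a b c = -(D.nComp φ x c * raiseSnd (D.PComp φ x) (D.FComp φ x) a b
      + D.nComp φ x b * raiseSnd (D.PComp φ x) (D.FComp φ x) a c)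
      - D.nComp φ x b * D.nComp φ x c * D.dell2Comp φ x a := by
  have h1 : pd (fun y => D.PComp φ y b c) a x = _ :=
    D.matPd_inv_coordMat hφ hx a (Sum.inl b) (Sum.inl c)
  rw [covBiv, h1, Fintype.sum_sum_type, Fintype.sum_sum_type]
  simp only [Finset.univ_unique, Finset.sum_singleton, PUnit.default_eq_unit,
    D.frameConn_inl_inl, D.frameConn_inl_inr']
  have e0 (d : Fin m) : (D.coordMat φ x)⁻¹ (Sum.inr ()) (Sum.inl d) = D.nComp φ x d :=
    D.inv_coordMat_symm _ _
  have e1 (d e : Fin m) : ∑ f, (D.conn φ x d a f - D.nComp φ x d * bilinComp D.Y φ x a f) *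
      (D.coordMat φ x)⁻¹ (Sum.inl f) (Sum.inl e) = (∑ f, D.conn φ x d a f * D.PComp φ x f e)
        - D.nComp φ x d * raiseSnd (D.PComp φ x) (bilinComp D.Y φ x) a e := by
    rw [raiseSnd, Finset.mul_sum, ← Finset.sum_sub_distrib]
    refine Finset.sum_congr rfl fun f _ => ?_
    rw [show (D.coordMat φ x)⁻¹ (Sum.inl f) (Sum.inl e) = D.PComp φ x f e from rfl,
      D.PComp_symm e f]
    ring
  rw [e0, e0, e1, e1]
  simp only [D.PComp_symm b]
  ring

/-- The corner entry of the same identity. -/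
theorem pd_n2Comp (hφ : φ ∈ IsManifold.maximalAtlas (𝓡 m) ∞ S) (hx : x ∈ φ.target) (a : Fin m) :
    pd (D.n2Comp φ) a x = 2 * contrSnd (D.UComp φ x) (D.nComp φ x) a
      - 2 * D.n2Comp φ x * contrSnd (D.FComp φ x) (D.nComp φ x) a
      - D.n2Comp φ x ^ 2 * D.dell2Comp φ x a := by
  have h1 : pd (D.n2Comp φ) a x = _ := D.matPd_inv_coordMat hφ hx a (Sum.inr ()) (Sum.inr ())
  rw [h1, Fintype.sum_sum_type]
  simp only [Finset.univ_unique, Finset.sum_singleton, PUnit.default_eq_unit,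
    D.frameConn_inr_inl hφ hx, D.frameConn_inr_inr']
  have e1 : ∑ f, -(D.UComp φ x a f + D.n2Comp φ x * bilinComp D.Y φ x a f) *
      (D.coordMat φ x)⁻¹ (Sum.inl f) (Sum.inr ()) =
      -(contrSnd (D.UComp φ x) (D.nComp φ x) a
        + D.n2Comp φ x * contrSnd (bilinComp D.Y φ x) (D.nComp φ x) a) := by
    rw [contrSnd, contrSnd, Finset.mul_sum, ← Finset.sum_add_distrib, ← Finset.sum_neg_distrib]
    refine Finset.sum_congr rfl fun f _ => ?_
    rw [show (D.coordMat φ x)⁻¹ (Sum.inl f) (Sum.inr ()) = D.nComp φ x f from rfl]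
    ring
  rw [e1, show (D.coordMat φ x)⁻¹ (Sum.inr ()) (Sum.inr ()) = D.n2Comp φ x from rfl]
  ring

theorem conn_symm (c a b : Fin m) : D.conn φ x c a b = D.conn φ x c b a := by
  simp only [MetricHypersurfaceData.conn]
  have h (d : Fin m) : pd (fun y => bilinComp D.gam φ y a b) d x =
      pd (fun y => bilinComp D.gam φ y b a) d x :=
    congrArg (fun F => pd F d x) (funext fun y => D.gam_symm _ _ _)
  congr 1
  · congr 1
    exact Finset.sum_congr rfl fun d _ => by rw [h]; ring
  · ring

theorem YComp_symm (a b : Fin m) : bilinComp D.Y φ x a b = bilinComp D.Y φ x b a :=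
  D.Y_symm _ _ _

theorem UComp_symm (a b : Fin m) : D.UComp φ x a b = D.UComp φ x b a := by
  simp only [MetricHypersurfaceData.UComp, MetricHypersurfaceData.lieGamComp]
  have h (c d : Fin m) : bilinComp D.gam φ x c d = bilinComp D.gam φ x d c := D.gam_symm _ _ _
  have h' (c : Fin m) : pd (fun y => bilinComp D.gam φ y a b) c x =
      pd (fun y => bilinComp D.gam φ y b a) c x :=
    congrArg (fun F => pd F c x) (funext fun y => D.gam_symm _ _ _)
  have e : ∑ c, (D.nComp φ x c * pd (fun y => bilinComp D.gam φ y a b) c x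
      + bilinComp D.gam φ x c b * pd (fun y => D.nComp φ y c) a x
      + bilinComp D.gam φ x a c * pd (fun y => D.nComp φ y c) b x) =
      ∑ c, (D.nComp φ x c * pd (fun y => bilinComp D.gam φ y b a) c x
      + bilinComp D.gam φ x c a * pd (fun y => D.nComp φ y c) b x
      + bilinComp D.gam φ x b c * pd (fun y => D.nComp φ y c) a x) :=
    Finset.sum_congr rfl fun c _ => by rw [h', h a c, h b c]; ring
  rw [e]
  ring

theorem FComp_antisymm (a b : Fin m) : D.FComp φ x a b = -D.FComp φ x b a := by
  simp only [MetricHypersurfaceData.FComp]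
  ring

/-! Regularity of the components. -/

theorem matContDiffAt_inv_coordMat (hφ : φ ∈ IsManifold.maximalAtlas (𝓡 m) ∞ S)
    (hx : x ∈ φ.target) : MatContDiffAt 2 (fun y => (D.coordMat φ y)⁻¹) x :=
  (D.matContDiffAt_coordMat hφ hx).inv (D.det_coordMat_ne_zero hφ hx)

theorem differentiableAt_PComp (hφ : φ ∈ IsManifold.maximalAtlas (𝓡 m) ∞ S)
    (hx : x ∈ φ.target) (a b : Fin m) : DifferentiableAt ℝ (fun y => D.PComp φ y a b) x :=
  (D.matContDiffAt_inv_coordMat hφ hx (Sum.inl a) (Sum.inl b)).differentiableAt (by norm_num)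

theorem differentiableAt_nComp (hφ : φ ∈ IsManifold.maximalAtlas (𝓡 m) ∞ S)
    (hx : x ∈ φ.target) (a : Fin m) : DifferentiableAt ℝ (fun y => D.nComp φ y a) x :=
  (D.matContDiffAt_inv_coordMat hφ hx (Sum.inl a) (Sum.inr ())).differentiableAt (by norm_num)

theorem differentiableAt_n2Comp (hφ : φ ∈ IsManifold.maximalAtlas (𝓡 m) ∞ S)
    (hx : x ∈ φ.target) : DifferentiableAt ℝ (D.n2Comp φ) x :=
  (D.matContDiffAt_inv_coordMat hφ hx (Sum.inr ()) (Sum.inr ())).differentiableAt (by norm_num)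

theorem differentiableAt_YComp (hφ : φ ∈ IsManifold.maximalAtlas (𝓡 m) ∞ S)
    (hx : x ∈ φ.target) (a b : Fin m) : DifferentiableAt ℝ (fun y => bilinComp D.Y φ y a b) x :=
  ((D.Y_contDiff φ hφ a b).contDiffAt (φ.open_target.mem_nhds hx)).differentiableAt (by norm_num)

theorem matContDiffAt_frameConn (hφ : φ ∈ IsManifold.maximalAtlas (𝓡 m) ∞ S)
    (hx : x ∈ φ.target) (a : Fin m) :
    MatContDiffAt 1 (frameConn (D.coordMat φ) (bilinComp D.Y φ) a) x :=
  ((D.matContDiffAt_inv_coordMat hφ hx).of_le (by norm_num)).mul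
    (matContDiffAt_lowConn (D.matContDiffAt_coordMat hφ hx)
      (fun b c => (D.Y_contDiff φ hφ b c).contDiffAt (φ.open_target.mem_nhds hx)) a)

/-- Read off from the frame connection, whose regularity is known, by adding back `n^c Y_ab`. -/
theorem differentiableAt_conn (hφ : φ ∈ IsManifold.maximalAtlas (𝓡 m) ∞ S)
    (hx : x ∈ φ.target) (c a b : Fin m) : DifferentiableAt ℝ (fun y => D.conn φ y c a b) x := by
  have h1 := ((D.matContDiffAt_frameConn hφ hx a).differentiableAt (Sum.inl c) (Sum.inl b)).fun_add
    ((D.differentiableAt_nComp hφ hx c).fun_mul (D.differentiableAt_YComp hφ hx a b))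
  simpa only [D.frameConn_inl_inl, sub_add_cancel] using h1

theorem differentiableAt_UComp (hφ : φ ∈ IsManifold.maximalAtlas (𝓡 m) ∞ S)
    (hx : x ∈ φ.target) (a b : Fin m) : DifferentiableAt ℝ (fun y => D.UComp φ y a b) x := by
  have h1 := ((D.matContDiffAt_frameConn hφ hx a).differentiableAt (Sum.inr ())
    (Sum.inl b)).fun_neg.fun_sub
    ((D.differentiableAt_n2Comp hφ hx).fun_mul (D.differentiableAt_YComp hφ hx a b))
  refine h1.congr_of_eventuallyEq ?_
  filter_upwards [φ.open_target.mem_nhds hx] with y hy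
  rw [D.frameConn_inr_inl hφ hy]
  ring

end HypersurfaceData

end GaussCodazzi

/-! ### The Gauss and Codazzi equations and the lowered curvature row -/

section GaussCodazzi

namespace HypersurfaceData

variable {m : ℕ} {S : Type*} [TopologicalSpace S] [ChartedSpace (EuclideanSpace ℝ (Fin m)) S]
  {φ : OpenPartialHomeomorph S (EuclideanSpace ℝ (Fin m))} {x : EuclideanSpace ℝ (Fin m)}
  (D : HypersurfaceData m S)

/-- The components of `K_{ab} = U_{ab} + n⁽²⁾ Y_{ab}`. -/
def KComp (φ : OpenPartialHomeomorph S (EuclideanSpace ℝ (Fin m))) (x : EuclideanSpace ℝ (Fin m))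
    (a b : Fin m) : ℝ :=
  D.UComp φ x a b + D.n2Comp φ x * bilinComp D.Y φ x a b

theorem frameCurvature_apply (c d : Fin m) (A B : Fin m ⊕ Unit) :
    D.frameCurvature φ x c d A B =
      pd (fun y => frameConn (D.coordMat φ) (bilinComp D.Y φ) d y A B) c x
      - pd (fun y => frameConn (D.coordMat φ) (bilinComp D.Y φ) c y A B) d x
      + (((∑ f, frameConn (D.coordMat φ) (bilinComp D.Y φ) c x A (Sum.inl f)
          * frameConn (D.coordMat φ) (bilinComp D.Y φ) d x (Sum.inl f) B)
        + frameConn (D.coordMat φ) (bilinComp D.Y φ) c x A (Sum.inr ())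
          * frameConn (D.coordMat φ) (bilinComp D.Y φ) d x (Sum.inr ()) B)
      - ((∑ f, frameConn (D.coordMat φ) (bilinComp D.Y φ) d x A (Sum.inl f)
          * frameConn (D.coordMat φ) (bilinComp D.Y φ) c x (Sum.inl f) B)
        + frameConn (D.coordMat φ) (bilinComp D.Y φ) d x A (Sum.inr ())
          * frameConn (D.coordMat φ) (bilinComp D.Y φ) c x (Sum.inr ()) B)) := by
  simp only [frameCurvature, matCurv, matPd, Matrix.add_apply, Matrix.sub_apply, Matrix.of_apply,
    Matrix.mul_apply, Fintype.sum_sum_type, Finset.univ_unique, Finset.sum_singleton,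
    PUnit.default_eq_unit]

/-- The Gauss equation. -/
theorem frameCurvature_inl_inl (hφ : φ ∈ IsManifold.maximalAtlas (𝓡 m) ∞ S) (hx : x ∈ φ.target)
    (a b c d : Fin m) :
    D.frameCurvature φ x c d (Sum.inl a) (Sum.inl b) = curvatureCoeff (D.conn φ) x a b c d
      - D.covVec φ (D.nComp φ) x c a * bilinComp D.Y φ x d b
      + D.covVec φ (D.nComp φ) x d a * bilinComp D.Y φ x c b
      - D.nComp φ x a * (D.covBilin φ (bilinComp D.Y φ) x c d b
        - D.covBilin φ (bilinComp D.Y φ) x d c b)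
      + D.nComp φ x a * (contrSnd (bilinComp D.Y φ x) (D.nComp φ x) c * bilinComp D.Y φ x d b
        - contrSnd (bilinComp D.Y φ x) (D.nComp φ x) d * bilinComp D.Y φ x c b)
      - frameConn (D.coordMat φ) (bilinComp D.Y φ) c x (Sum.inl a) (Sum.inr ()) * D.KComp φ x d b
      + frameConn (D.coordMat φ) (bilinComp D.Y φ) d x (Sum.inl a) (Sum.inr ())
        * D.KComp φ x c b := by
  have hn := D.differentiableAt_nComp hφ hx a
  have e0 (c d : Fin m) : pd (fun y => D.conn φ y a d b - D.nComp φ y a * bilinComp D.Y φ y d b) c x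
      = pd (fun y => D.conn φ y a d b) c x - (pd (fun y => D.nComp φ y a) c x * bilinComp D.Y φ x d b
        + D.nComp φ x a * pd (fun y => bilinComp D.Y φ y d b) c x) := by
    have hY := D.differentiableAt_YComp hφ hx d b
    rw [pd_sub (D.differentiableAt_conn hφ hx a d b) (hn.fun_mul hY), pd_mul hn hY]
  have e1 (c d : Fin m) : ∑ f, (D.conn φ x a c f - D.nComp φ x a * bilinComp D.Y φ x c f)
        * (D.conn φ x f d b - D.nComp φ x f * bilinComp D.Y φ x d b) =
      (∑ f, D.conn φ x a c f * D.conn φ x f d b)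
      - D.nComp φ x a * (∑ f, D.conn φ x f d b * bilinComp D.Y φ x c f)
      - (∑ f, D.conn φ x a c f * D.nComp φ x f) * bilinComp D.Y φ x d b
      + D.nComp φ x a * contrSnd (bilinComp D.Y φ x) (D.nComp φ x) c * bilinComp D.Y φ x d b := by
    simp only [contrSnd, Finset.mul_sum, Finset.sum_mul, ← Finset.sum_sub_distrib,
      ← Finset.sum_add_distrib]
    exact Finset.sum_congr rfl fun f _ => by ring
  -- Since `∇°` has no torsion, the connection terms on the antisymmetrized pair drop out of `∇°_c
  -- Y_db - ∇°_d Y_cb`.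
  have e2 : ∑ f, D.conn φ x f c d * bilinComp D.Y φ x f b =
      ∑ f, D.conn φ x f d c * bilinComp D.Y φ x f b :=
    Finset.sum_congr rfl fun f _ => by rw [D.conn_symm]
  rw [D.frameCurvature_apply]
  simp only [D.frameConn_inl_inl, D.frameConn_inr_inl hφ hx, e0, e1]
  simp only [curvatureCoeff, MetricHypersurfaceData.covVec, MetricHypersurfaceData.covBilin, KComp,
    Finset.sum_sub_distrib]
  linear_combination (-D.nComp φ x a) * e2

/-- The Codazzi equation. -/
theorem frameCurvature_inr_inl (hφ : φ ∈ IsManifold.maximalAtlas (𝓡 m) ∞ S) (hx : x ∈ φ.target)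
    (b c d : Fin m) :
    D.frameCurvature φ x c d (Sum.inr ()) (Sum.inl b) =
      -(D.covBilin φ (D.UComp φ) x c d b - D.covBilin φ (D.UComp φ) x d c b)
      - (pd (D.n2Comp φ) c x * bilinComp D.Y φ x d b - pd (D.n2Comp φ) d x * bilinComp D.Y φ x c b)
      - D.n2Comp φ x * (D.covBilin φ (bilinComp D.Y φ) x c d b
        - D.covBilin φ (bilinComp D.Y φ) x d c b)
      + (contrSnd (D.KComp φ x) (D.nComp φ x) c * bilinComp D.Y φ x d b
        - contrSnd (D.KComp φ x) (D.nComp φ x) d * bilinComp D.Y φ x c b)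
      - (frameConn (D.coordMat φ) (bilinComp D.Y φ) c x (Sum.inr ()) (Sum.inr ()) * D.KComp φ x d b
      - frameConn (D.coordMat φ) (bilinComp D.Y φ) d x (Sum.inr ()) (Sum.inr ())
        * D.KComp φ x c b) := by
  have hn := D.differentiableAt_n2Comp hφ hx
  have e0 (c d : Fin m) :
      pd (fun y => frameConn (D.coordMat φ) (bilinComp D.Y φ) d y (Sum.inr ()) (Sum.inl b)) c x
      = -(pd (fun y => D.UComp φ y d b) c x + (pd (D.n2Comp φ) c x * bilinComp D.Y φ x d b
        + D.n2Comp φ x * pd (fun y => bilinComp D.Y φ y d b) c x)) := by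
    have hY := D.differentiableAt_YComp hφ hx d b
    -- The formula for this block is available only on the chart domain, so it is differentiated as
    -- a germ at `x`.
    have hev : (fun y => frameConn (D.coordMat φ) (bilinComp D.Y φ) d y (Sum.inr ()) (Sum.inl b))
        =ᶠ[𝓝 x] fun y => -(D.UComp φ y d b + D.n2Comp φ y * bilinComp D.Y φ y d b) := by
      filter_upwards [φ.open_target.mem_nhds hx] with y hy
      rw [D.frameConn_inr_inl hφ hy]
    rw [pd_congr hev, pd_neg, pd_add (D.differentiableAt_UComp hφ hx d b) (hn.fun_mul hY),
      pd_mul hn hY]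
  have e1 (c d : Fin m) : ∑ f, -(D.UComp φ x c f + D.n2Comp φ x * bilinComp D.Y φ x c f)
        * (D.conn φ x f d b - D.nComp φ x f * bilinComp D.Y φ x d b) =
      -(∑ f, D.conn φ x f d b * D.UComp φ x c f)
      - D.n2Comp φ x * (∑ f, D.conn φ x f d b * bilinComp D.Y φ x c f)
      + contrSnd (D.KComp φ x) (D.nComp φ x) c * bilinComp D.Y φ x d b := by
    simp only [contrSnd, KComp, Finset.mul_sum, Finset.sum_mul, ← Finset.sum_sub_distrib,
      ← Finset.sum_add_distrib, ← Finset.sum_neg_distrib]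
    exact Finset.sum_congr rfl fun f _ => by ring
  have e2 (T : Fin m → Fin m → ℝ) : ∑ f, D.conn φ x f c d * T f b =
      ∑ f, D.conn φ x f d c * T f b :=
    Finset.sum_congr rfl fun f _ => by rw [D.conn_symm]
  rw [D.frameCurvature_apply, e0, e0]
  simp only [D.frameConn_inl_inl, D.frameConn_inr_inl hφ hx, e1]
  simp only [MetricHypersurfaceData.covBilin, KComp]
  linear_combination (-1) * e2 (D.UComp φ x) - D.n2Comp φ x * e2 (bilinComp D.Y φ x)

/-! The algebraic relations between the data and the blocks of the inverse matrix. -/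

/-- An entry of the bottom row of `𝔸 𝔸⁻¹ = 1`; `sum_ell_mul_P` comes from the same row. -/
theorem sum_ell_mul_n (hφ : φ ∈ IsManifold.maximalAtlas (𝓡 m) ∞ S) (hx : x ∈ φ.target) :
    ∑ a, formComp D.ell φ x a * D.nComp φ x a = 1 - D.n2Comp φ x * D.ell2 (φ.symm x) := by
  have h := congrFun (congrFun (Matrix.mul_nonsing_inv _
    (Ne.isUnit (D.det_coordMat_ne_zero hφ hx))) (Sum.inr ())) (Sum.inr ())
  rw [Matrix.mul_apply, Fintype.sum_sum_type, Matrix.one_apply_eq] at h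
  simp only [Finset.univ_unique, Finset.sum_singleton] at h
  rw [mul_comm (D.n2Comp φ x)]
  exact eq_sub_of_add_eq h

theorem sum_ell_mul_P (hφ : φ ∈ IsManifold.maximalAtlas (𝓡 m) ∞ S) (hx : x ∈ φ.target)
    (b : Fin m) :
    ∑ a, formComp D.ell φ x a * D.PComp φ x a b = -(D.nComp φ x b * D.ell2 (φ.symm x)) := by
  have h := congrFun (congrFun (Matrix.mul_nonsing_inv _
    (Ne.isUnit (D.det_coordMat_ne_zero hφ hx))) (Sum.inr ())) (Sum.inl b)
  rw [Matrix.mul_apply, Fintype.sum_sum_type, Matrix.one_apply_ne (by simp)] at h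
  simp only [Finset.univ_unique, Finset.sum_singleton,
    D.inv_coordMat_symm (Sum.inr _) (Sum.inl _)] at h
  rw [mul_comm (D.nComp φ x b)]
  exact eq_neg_of_add_eq_zero_left h

theorem sum_ell_mul_raiseSnd (hφ : φ ∈ IsManifold.maximalAtlas (𝓡 m) ∞ S) (hx : x ∈ φ.target)
    (T : Fin m → Fin m → ℝ) (c : Fin m) :
    ∑ a, formComp D.ell φ x a * raiseSnd (D.PComp φ x) T c a =
      -(D.ell2 (φ.symm x) * contrSnd T (D.nComp φ x) c) := by
  simp only [raiseSnd, contrSnd, Finset.mul_sum]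
  rw [Finset.sum_comm, ← Finset.sum_neg_distrib]
  refine Finset.sum_congr rfl fun f _ => ?_
  have := D.sum_ell_mul_P hφ hx f
  have e : ∑ a, formComp D.ell φ x a * (D.PComp φ x a f * T c f) =
      (∑ a, formComp D.ell φ x a * D.PComp φ x a f) * T c f := by
    rw [Finset.sum_mul]
    exact Finset.sum_congr rfl fun a _ => by ring
  rw [e, this]
  ring

/-- The last row of `𝔸` combines `ℓ_a` times Gauss with `ℓ⁽²⁾` times Codazzi. As `ℓ_a n^a = 1 - n⁽²⁾
ℓ⁽²⁾` and `ℓ_a P^ab = -ℓ⁽²⁾ n^b`, the terms `n⁽²⁾ ℓ⁽²⁾ ∇°Y` cancel and `∇°Y` keeps coefficient `-1`.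
-/
theorem coordMat_mul_frameCurvature (hφ : φ ∈ IsManifold.maximalAtlas (𝓡 m) ∞ S)
    (hx : x ∈ φ.target) (b c d : Fin m) :
    (D.coordMat φ x * D.frameCurvature φ x c d) (Sum.inr ()) (Sum.inl b) =
      (∑ a, formComp D.ell φ x a * curvatureCoeff (D.conn φ) x a b c d)
      - (D.covBilin φ (bilinComp D.Y φ) x c d b - D.covBilin φ (bilinComp D.Y φ) x d c b)
      - D.ell2 (φ.symm x) * (D.covBilin φ (D.UComp φ) x c d b - D.covBilin φ (D.UComp φ) x d c b)
      + (1 / 2) * ((D.n2Comp φ x * bilinComp D.Y φ x d b - D.UComp φ x d b) * D.dell2Comp φ x c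
        - (D.n2Comp φ x * bilinComp D.Y φ x c b - D.UComp φ x c b) * D.dell2Comp φ x d)
      + (bilinComp D.Y φ x d b * (contrSnd (D.FComp φ x) (D.nComp φ x) c
          + contrSnd (bilinComp D.Y φ x) (D.nComp φ x) c)
        - bilinComp D.Y φ x c b * (contrSnd (D.FComp φ x) (D.nComp φ x) d
          + contrSnd (bilinComp D.Y φ x) (D.nComp φ x) d)) := by
  have hK (c : Fin m) : contrSnd (D.KComp φ x) (D.nComp φ x) c =
      contrSnd (D.UComp φ x) (D.nComp φ x) c
        + D.n2Comp φ x * contrSnd (bilinComp D.Y φ x) (D.nComp φ x) c := by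
    simp only [contrSnd, KComp, Finset.mul_sum, ← Finset.sum_add_distrib]
    exact Finset.sum_congr rfl fun f _ => by ring
  rw [Matrix.mul_apply, Fintype.sum_sum_type]
  simp only [Finset.univ_unique, Finset.sum_singleton, PUnit.default_eq_unit]
  change (∑ a, formComp D.ell φ x a * _) + D.ell2 (φ.symm x) * _ = _
  rw [D.frameCurvature_inr_inl hφ hx]
  simp only [D.frameCurvature_inl_inl hφ hx, D.covVec_nComp hφ hx, D.frameConn_inl_inr',
    D.frameConn_inr_inr', D.pd_n2Comp hφ hx, hK]
  have hn := D.sum_ell_mul_n hφ hx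
  have hr := D.sum_ell_mul_raiseSnd hφ hx
  -- The Gauss equation expresses its upper index solely through the curvature, `n^a`, and the
  -- raised forms of `F`, `U`, `Y`, so contraction with `ℓ_a` is evaluated once for this general
  -- shape.
  have key : ∀ (X1 X2 X3 X4 X5 X6 X7 : ℝ) (V : Fin m → ℝ),
      ∑ a, formComp D.ell φ x a * (V a + D.nComp φ x a * X1
        + raiseSnd (D.PComp φ x) (D.FComp φ x) c a * X2
        + raiseSnd (D.PComp φ x) (D.FComp φ x) d a * X3
        + raiseSnd (D.PComp φ x) (D.UComp φ x) c a * X4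
        + raiseSnd (D.PComp φ x) (D.UComp φ x) d a * X5
        + raiseSnd (D.PComp φ x) (bilinComp D.Y φ x) c a * X6
        + raiseSnd (D.PComp φ x) (bilinComp D.Y φ x) d a * X7) =
      (∑ a, formComp D.ell φ x a * V a)
        + (∑ a, formComp D.ell φ x a * D.nComp φ x a) * X1
        + (∑ a, formComp D.ell φ x a * raiseSnd (D.PComp φ x) (D.FComp φ x) c a) * X2
        + (∑ a, formComp D.ell φ x a * raiseSnd (D.PComp φ x) (D.FComp φ x) d a) * X3
        + (∑ a, formComp D.ell φ x a * raiseSnd (D.PComp φ x) (D.UComp φ x) c a) * X4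
        + (∑ a, formComp D.ell φ x a * raiseSnd (D.PComp φ x) (D.UComp φ x) d a) * X5
        + (∑ a, formComp D.ell φ x a * raiseSnd (D.PComp φ x) (bilinComp D.Y φ x) c a) * X6
        + (∑ a, formComp D.ell φ x a * raiseSnd (D.PComp φ x) (bilinComp D.Y φ x) d a) * X7 := by
    intros
    simp only [Finset.sum_mul, ← Finset.sum_add_distrib]
    exact Finset.sum_congr rfl fun a _ => by ring
  rw [hn, hr, hr, hr, hr, hr, hr] at key
  set Fc := contrSnd (D.FComp φ x) (D.nComp φ x) c
  set Fd := contrSnd (D.FComp φ x) (D.nComp φ x) d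
  set Yc := contrSnd (bilinComp D.Y φ x) (D.nComp φ x) c
  set Yd := contrSnd (bilinComp D.Y φ x) (D.nComp φ x) d
  set ydb := bilinComp D.Y φ x d b
  set ycb := bilinComp D.Y φ x c b
  set n2 := D.n2Comp φ x
  set lc := D.dell2Comp φ x c
  set ld := D.dell2Comp φ x d
  set kdb := D.KComp φ x d b with hkdb
  set kcb := D.KComp φ x c b with hkcb
  set W := D.covBilin φ (bilinComp D.Y φ) x c d b - D.covBilin φ (bilinComp D.Y φ) x d c b
  have hk := key ((Fc + n2 * lc) * ydb - (Fd + n2 * ld) * ycb - W + (Yc * ydb - Yd * ycb)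
      - 1 / 2 * lc * kdb + 1 / 2 * ld * kcb) (n2 * ydb - kdb) (kcb - n2 * ycb) (-ydb) ycb (-kdb) kcb
    (fun a => curvatureCoeff (D.conn φ) x a b c d)
  have hs : kdb = D.UComp φ x d b + n2 * ydb := rfl
  have hs' : kcb = D.UComp φ x c b + n2 * ycb := rfl
  -- The summand is regrouped into the shape of `key`; the coefficients are those listed in `hk`.
  rw [Finset.sum_congr rfl fun a _ => congrArg (formComp D.ell φ x a * ·) (by ring :
    _ = curvatureCoeff (D.conn φ) x a b c d + D.nComp φ x a *
      ((Fc + n2 * lc) * ydb - (Fd + n2 * ld) * ycb - W + (Yc * ydb - Yd * ycb)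
      - 1 / 2 * lc * kdb + 1 / 2 * ld * kcb)
        + raiseSnd (D.PComp φ x) (D.FComp φ x) c a * (n2 * ydb - kdb)
        + raiseSnd (D.PComp φ x) (D.FComp φ x) d a * (kcb - n2 * ycb)
        + raiseSnd (D.PComp φ x) (D.UComp φ x) c a * (-ydb)
        + raiseSnd (D.PComp φ x) (D.UComp φ x) d a * ycb
        + raiseSnd (D.PComp φ x) (bilinComp D.Y φ x) c a * (-kdb)
        + raiseSnd (D.PComp φ x) (bilinComp D.Y φ x) d a * kcb), hk, hs, hs']
  ring

end HypersurfaceData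

end GaussCodazzi

/-! ### Leibniz rules for contractions -/

section Leibniz

/-- Moves a connection matrix from one factor of a contraction to the other, where it cancels. -/
theorem sum_adjoint {m : ℕ} (A : Fin m → Fin m → ℝ) (p q : Fin m → ℝ) :
    ∑ b, (∑ f, A b f * p f) * q b = ∑ b, p b * ∑ f, A f b * q f := by
  simp only [Finset.sum_mul, Finset.mul_sum]
  rw [Finset.sum_comm]
  exact Finset.sum_congr rfl fun b _ => Finset.sum_congr rfl fun f _ => by ring

namespace HypersurfaceData

variable {m : ℕ} {S : Type*} [TopologicalSpace S] [ChartedSpace (EuclideanSpace ℝ (Fin m)) S]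
  {φ : OpenPartialHomeomorph S (EuclideanSpace ℝ (Fin m))} {x : EuclideanSpace ℝ (Fin m)}
  (D : HypersurfaceData m S) {M T W : EuclideanSpace ℝ (Fin m) → Fin m → Fin m → ℝ}
  {v w : EuclideanSpace ℝ (Fin m) → Fin m → ℝ} {s : EuclideanSpace ℝ (Fin m) → ℝ}

/-- On the contracted index the connection acts with opposite signs on `M` and `T`, so only the free
indices see it. -/
theorem covEnd_contract (hM : ∀ b c, DifferentiableAt ℝ (fun y => M y b c) x)
    (hT : ∀ b c, DifferentiableAt ℝ (fun y => T y b c) x) (a f c : Fin m) :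
    D.covEnd φ (fun y f c => ∑ b, M y b f * T y b c) x a f c =
      ∑ b, (D.covBiv φ M x a b f * T x b c + M x b f * D.covBilin φ T x a b c) := by
  have e0 : pd (fun y => ∑ b, M y b f * T y b c) a x =
      ∑ b, (pd (fun y => M y b f) a x * T x b c + M x b f * pd (fun y => T y b c) a x) := by
    rw [pd_sum fun b _ => (hM b f).fun_mul (hT b c)]
    exact Finset.sum_congr rfl fun b _ => pd_mul (hM b f) (hT b c) a
  have e1 : ∑ g, D.conn φ x f a g * ∑ b, M x b g * T x b c =
      ∑ b, (∑ g, D.conn φ x f a g * M x b g) * T x b c := by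
    simp only [Finset.sum_mul, Finset.mul_sum]
    rw [Finset.sum_comm]
    exact Finset.sum_congr rfl fun b _ => Finset.sum_congr rfl fun f _ => by ring
  have e2 : ∑ g, D.conn φ x g a c * ∑ b, M x b f * T x b g =
      ∑ b, M x b f * ∑ g, D.conn φ x g a c * T x b g := by
    simp only [Finset.mul_sum]
    rw [Finset.sum_comm]
    exact Finset.sum_congr rfl fun b _ => Finset.sum_congr rfl fun f _ => by ring
  have e3 := sum_adjoint (fun b g => D.conn φ x b a g) (fun g => M x g f) (fun b => T x b c)
  simp only [MetricHypersurfaceData.covEnd, covBiv, MetricHypersurfaceData.covBilin, e0, e1, e2]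
  simp only [add_mul, mul_sub, Finset.sum_add_distrib, Finset.sum_sub_distrib]
  linear_combination -e3

/-- The trace of `covEnd_contract`: the connection terms on the two remaining indices also cancel.
-/
theorem pd_contract (hM : ∀ b c, DifferentiableAt ℝ (fun y => M y b c) x)
    (hT : ∀ b c, DifferentiableAt ℝ (fun y => T y b c) x) (a : Fin m) :
    pd (fun y => ∑ b, ∑ d, M y b d * T y b d) a x =
      ∑ b, ∑ d, (D.covBiv φ M x a b d * T x b d + M x b d * D.covBilin φ T x a b d) := by
  have h1 (d : Fin m) : DifferentiableAt ℝ (fun y => ∑ b, M y b d * T y b d) x :=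
    DifferentiableAt.fun_sum fun b _ => (hM b d).fun_mul (hT b d)
  have h2 : (fun y => ∑ b, ∑ d, M y b d * T y b d) = fun y => ∑ d, ∑ b, M y b d * T y b d :=
    funext fun y => Finset.sum_comm
  have h3 := fun d => D.covEnd_contract (φ := φ) hM hT a d d
  rw [h2, pd_sum fun d _ => h1 d, Finset.sum_comm, ← Finset.sum_congr rfl fun d _ => h3 d]
  simp only [MetricHypersurfaceData.covEnd, Finset.sum_add_distrib, Finset.sum_sub_distrib]
  have e : ∑ d, ∑ g, D.conn φ x d a g * ∑ b, M x b g * T x b d =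
      ∑ d, ∑ g, D.conn φ x g a d * ∑ b, M x b d * T x b g := Finset.sum_comm
  linear_combination -e

theorem covVec_contract (hW : ∀ b c, DifferentiableAt ℝ (fun y => W y b c) x)
    (hv : ∀ c, DifferentiableAt ℝ (fun y => v y c) x) (a d : Fin m) :
    D.covVec φ (fun y d => ∑ c, W y d c * v y c) x a d =
      ∑ c, (D.covEnd φ W x a d c * v x c + W x d c * D.covVec φ v x a c) := by
  have e0 : pd (fun y => ∑ c, W y d c * v y c) a x =
      ∑ c, (pd (fun y => W y d c) a x * v x c + W x d c * pd (fun y => v y c) a x) := by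
    rw [pd_sum fun c _ => (hW d c).fun_mul (hv c)]
    exact Finset.sum_congr rfl fun c _ => pd_mul (hW d c) (hv c) a
  have e1 : ∑ g, D.conn φ x d a g * ∑ c, W x g c * v x c =
      ∑ c, (∑ g, D.conn φ x d a g * W x g c) * v x c := by
    simp only [Finset.sum_mul, Finset.mul_sum]
    rw [Finset.sum_comm]
    exact Finset.sum_congr rfl fun b _ => Finset.sum_congr rfl fun f _ => by ring
  have e2 : ∑ c, W x d c * (∑ g, D.conn φ x c a g * v x g) =
      ∑ c, (∑ g, D.conn φ x g a c * W x d g) * v x c := by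
    simp only [Finset.sum_mul, Finset.mul_sum]
    rw [Finset.sum_comm]
    exact Finset.sum_congr rfl fun b _ => Finset.sum_congr rfl fun f _ => by ring
  simp only [MetricHypersurfaceData.covEnd, MetricHypersurfaceData.covVec, e0, e1]
  simp only [add_mul, sub_mul, mul_add, Finset.sum_add_distrib, Finset.sum_sub_distrib]
  linear_combination -e2

theorem covVec_sub_smul (hs : DifferentiableAt ℝ s x)
    (hv : ∀ c, DifferentiableAt ℝ (fun y => v y c) x)
    (hw : ∀ c, DifferentiableAt ℝ (fun y => w y c) x) (a d : Fin m) :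
    D.covVec φ (fun y d => w y d - s y * v y d) x a d =
      D.covVec φ w x a d - (pd s a x * v x d + s x * D.covVec φ v x a d) := by
  simp only [MetricHypersurfaceData.covVec]
  rw [pd_sub (hw d) (hs.fun_mul (hv d)), pd_mul hs (hv d)]
  have e : ∑ f, D.conn φ x d a f * (w x f - s x * v x f) =
      (∑ f, D.conn φ x d a f * w x f) - s x * ∑ f, D.conn φ x d a f * v x f := by
    rw [Finset.mul_sum, ← Finset.sum_sub_distrib]
    exact Finset.sum_congr rfl fun f _ => by ring
  rw [e]
  ring

theorem covBiv_n2_mul_P_sub (hφ : φ ∈ IsManifold.maximalAtlas (𝓡 m) ∞ S) (hx : x ∈ φ.target)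
    (a b d : Fin m) :
    D.covBiv φ (fun y b d => D.n2Comp φ y * D.PComp φ y b d - D.nComp φ y b * D.nComp φ y d) x
        a b d =
      pd (D.n2Comp φ) a x * D.PComp φ x b d + D.n2Comp φ x * D.covBiv φ (D.PComp φ) x a b d
      - (D.covVec φ (D.nComp φ) x a b * D.nComp φ x d
        + D.nComp φ x b * D.covVec φ (D.nComp φ) x a d) := by
  have hP := D.differentiableAt_PComp hφ hx b d
  have hn := D.differentiableAt_nComp hφ hx
  have hn2 := D.differentiableAt_n2Comp hφ hx
  have e1 : ∑ f, D.conn φ x b a f * (D.n2Comp φ x * D.PComp φ x f d - D.nComp φ x f * D.nComp φ x d)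
      = D.n2Comp φ x * (∑ f, D.conn φ x b a f * D.PComp φ x f d)
        - (∑ f, D.conn φ x b a f * D.nComp φ x f) * D.nComp φ x d := by
    rw [Finset.mul_sum, Finset.sum_mul, ← Finset.sum_sub_distrib]
    exact Finset.sum_congr rfl fun f _ => by ring
  have e2 : ∑ f, D.conn φ x d a f * (D.n2Comp φ x * D.PComp φ x b f - D.nComp φ x b * D.nComp φ x f)
      = D.n2Comp φ x * (∑ f, D.conn φ x d a f * D.PComp φ x b f)
        - D.nComp φ x b * ∑ f, D.conn φ x d a f * D.nComp φ x f := by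
    rw [Finset.mul_sum, Finset.mul_sum, ← Finset.sum_sub_distrib]
    exact Finset.sum_congr rfl fun f _ => by ring
  simp only [covBiv, MetricHypersurfaceData.covVec]
  rw [pd_sub (hn2.fun_mul hP) ((hn b).fun_mul (hn d)), pd_mul hn2 hP, pd_mul (hn b) (hn d), e1, e2]
  ring

/-- The divergence of the vector field `(P^{bd} n^c - P^{bc} n^d) Y_{bc}`. -/
theorem covVec_divFieldComp (hφ : φ ∈ IsManifold.maximalAtlas (𝓡 m) ∞ S) (hx : x ∈ φ.target)
    (a d : Fin m) :
    D.covVec φ (D.divFieldComp φ) x a d =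
      (∑ c, ((∑ b, (D.covBiv φ (D.PComp φ) x a b d * bilinComp D.Y φ x b c
          + D.PComp φ x b d * D.covBilin φ (bilinComp D.Y φ) x a b c)) * D.nComp φ x c
        + (∑ b, D.PComp φ x b d * bilinComp D.Y φ x b c) * D.covVec φ (D.nComp φ) x a c))
      - ((∑ b, ∑ c, (D.covBiv φ (D.PComp φ) x a b c * bilinComp D.Y φ x b c
          + D.PComp φ x b c * D.covBilin φ (bilinComp D.Y φ) x a b c)) * D.nComp φ x d
        + (∑ b, ∑ c, D.PComp φ x b c * bilinComp D.Y φ x b c)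
          * D.covVec φ (D.nComp φ) x a d) := by
  have hP := D.differentiableAt_PComp hφ hx
  have hY := D.differentiableAt_YComp hφ hx
  have hn := D.differentiableAt_nComp hφ hx
  have hW (d c : Fin m) : DifferentiableAt ℝ
      (fun y => ∑ b, D.PComp φ y b d * bilinComp D.Y φ y b c) x :=
    DifferentiableAt.fun_sum fun b _ => (hP b d).fun_mul (hY b c)
  -- Written as an endomorphism applied to `n` minus a scalar multiple of `n`, the field is
  -- accessible to the Leibniz rules.
  have h1 : D.divFieldComp φ = fun y d =>
      (∑ c, (∑ b, D.PComp φ y b d * bilinComp D.Y φ y b c) * D.nComp φ y c)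
      - (∑ b, ∑ c, D.PComp φ y b c * bilinComp D.Y φ y b c) * D.nComp φ y d := by
    funext y d
    simp only [divFieldComp, Finset.sum_mul]
    rw [Finset.sum_comm (f := fun c b => D.PComp φ y b d * bilinComp D.Y φ y b c * D.nComp φ y c)]
    simp only [← Finset.sum_sub_distrib]
    exact Finset.sum_congr rfl fun b _ => Finset.sum_congr rfl fun c _ => by ring
  rw [h1, D.covVec_sub_smul (w := fun y d =>
      ∑ c, (∑ b, D.PComp φ y b d * bilinComp D.Y φ y b c) * D.nComp φ y c)
      (s := fun y => ∑ b, ∑ c, D.PComp φ y b c * bilinComp D.Y φ y b c)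
      (DifferentiableAt.fun_sum fun b _ => DifferentiableAt.fun_sum fun c _ =>
        (hP b c).fun_mul (hY b c)) hn
      (fun d => DifferentiableAt.fun_sum fun c _ => (hW d c).fun_mul (hn c)),
    D.covVec_contract (W := fun y d c => ∑ b, D.PComp φ y b d * bilinComp D.Y φ y b c) hW hn,
    D.pd_contract (φ := φ) hP hY]
  simp only [D.covEnd_contract hP hY]

/-- The divergence of the tensor `(n⁽²⁾ P^{bd} - n^b n^d) (δ^f_d Y_{bc} - δ^f_c Y_{bd})`. -/
theorem sum_covEnd_divTensorComp (hφ : φ ∈ IsManifold.maximalAtlas (𝓡 m) ∞ S) (hx : x ∈ φ.target)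
    (M : EuclideanSpace ℝ (Fin m) → Fin m → Fin m → ℝ)
    (hM : M = fun y b d => D.n2Comp φ y * D.PComp φ y b d - D.nComp φ y b * D.nComp φ y d)
    (c : Fin m) :
    ∑ f, D.covEnd φ (D.divTensorComp φ) x f f c =
      (∑ b, ∑ d, (D.covBiv φ M x d b d * bilinComp D.Y φ x b c
        + M x b d * D.covBilin φ (bilinComp D.Y φ) x d b c))
      - ∑ b, ∑ d, (D.covBiv φ M x c b d * bilinComp D.Y φ x b d
        + M x b d * D.covBilin φ (bilinComp D.Y φ) x c b d) := by
  have hMd (b d : Fin m) : DifferentiableAt ℝ (fun y => M y b d) x := by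
    subst hM
    exact ((D.differentiableAt_n2Comp hφ hx).fun_mul (D.differentiableAt_PComp hφ hx b d)).fun_sub
      ((D.differentiableAt_nComp hφ hx b).fun_mul (D.differentiableAt_nComp hφ hx d))
  have hY := D.differentiableAt_YComp hφ hx
  -- Resolving the Kronecker deltas leaves a contraction and a multiple of the identity.
  have h1 (y f c) : D.divTensorComp φ y f c = (∑ b, M y b f * bilinComp D.Y φ y b c)
      - (if f = c then ∑ b, ∑ d, M y b d * bilinComp D.Y φ y b d else 0) := by
    subst hM
    simp only [divTensorComp, mul_sub, Finset.sum_sub_distrib, mul_ite, mul_zero,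
      Finset.sum_ite_eq, Finset.mem_univ, if_true]
    split_ifs <;> simp
  have hs : DifferentiableAt ℝ (fun y => ∑ b, ∑ d, M y b d * bilinComp D.Y φ y b d) x :=
    DifferentiableAt.fun_sum fun b _ => DifferentiableAt.fun_sum fun c _ =>
        (hMd b c).fun_mul (hY b c)
  have hW (d c : Fin m) : DifferentiableAt ℝ (fun y => ∑ b, M y b d * bilinComp D.Y φ y b c) x :=
    DifferentiableAt.fun_sum fun b _ => (hMd b d).fun_mul (hY b c)
  -- The identity tensor is parallel, so its multiple contributes only the gradient of the scalar
  -- factor.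
  have h2 (f : Fin m) : D.covEnd φ (D.divTensorComp φ) x f f c =
      D.covEnd φ (fun y f c => ∑ b, M y b f * bilinComp D.Y φ y b c) x f f c
      - (if f = c then pd (fun y => ∑ b, ∑ d, M y b d * bilinComp D.Y φ y b d) f x else 0) := by
    simp only [MetricHypersurfaceData.covEnd, h1]
    have e1 : pd (fun y => (∑ b, M y b f * bilinComp D.Y φ y b c)
        - if f = c then ∑ b, ∑ d, M y b d * bilinComp D.Y φ y b d else 0) f x =
        pd (fun y => ∑ b, M y b f * bilinComp D.Y φ y b c) f x
        - (if f = c then pd (fun y => ∑ b, ∑ d, M y b d * bilinComp D.Y φ y b d) f x else 0) := by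
      split_ifs with h
      · rw [pd_sub (hW f c) hs]
      · simp
    rw [e1]
    simp only [mul_sub, Finset.sum_sub_distrib, mul_ite, mul_zero, Finset.sum_ite_eq,
      Finset.sum_ite_eq', Finset.mem_univ, if_true]
    ring
  simp only [h2, Finset.sum_sub_distrib, Finset.sum_ite_eq', Finset.mem_univ, if_true,
    D.covEnd_contract hMd hY, D.pd_contract (φ := φ) hMd hY]
  rw [Finset.sum_comm]

end HypersurfaceData

end Leibniz

/-! ### Algebra of contractions -/

section Contraction

variable {m : ℕ} {P Y U F T : Fin m → Fin m → ℝ} {n : Fin m → ℝ}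

theorem sum_raiseSnd_diag_eq_zero (hP : ∀ a b, P a b = P b a) (hF : ∀ a b, F a b = -F b a) :
    ∑ c, raiseSnd P F c c = 0 := by
  have h : ∑ c, raiseSnd P F c c = -∑ c, raiseSnd P F c c := by
    simp only [raiseSnd, ← Finset.sum_neg_distrib]
    rw [Finset.sum_comm]
    exact Finset.sum_congr rfl fun b _ => Finset.sum_congr rfl fun c _ => by
      rw [hP c b, hF c b]; ring
  linarith

theorem sum_n_mul_contrSnd_eq_zero (hF : ∀ a b, F a b = -F b a) :
    ∑ c, n c * contrSnd F n c = 0 := by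
  have h : ∑ c, n c * contrSnd F n c = -∑ c, n c * contrSnd F n c := by
    simp only [contrSnd, Finset.mul_sum, ← Finset.sum_neg_distrib]
    rw [Finset.sum_comm]
    exact Finset.sum_congr rfl fun b _ => Finset.sum_congr rfl fun c _ => by
      rw [hF c b]; ring
  linarith

theorem sum_n_mul_raiseSnd (b : Fin m) :
    ∑ d, n d * raiseSnd P T d b = ∑ f, P b f * ∑ d, T d f * n d := by
  simp only [raiseSnd, Finset.mul_sum]
  rw [Finset.sum_comm]
  exact Finset.sum_congr rfl fun b _ => Finset.sum_congr rfl fun c _ => by ring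

theorem sum_n_mul_raiseSnd_of_antisymm (hF : ∀ a b, F a b = -F b a) (b : Fin m) :
    ∑ d, n d * raiseSnd P F d b = -∑ f, P b f * contrSnd F n f := by
  rw [sum_n_mul_raiseSnd, ← Finset.sum_neg_distrib]
  refine Finset.sum_congr rfl fun f _ => ?_
  rw [contrSnd, ← mul_neg, ← Finset.sum_neg_distrib]
  exact congrArg _ (Finset.sum_congr rfl fun d _ => by rw [hF d f]; ring)

/-- Raising both indices of the antisymmetric `F` with `P` and pairing the result with a symmetric
tensor gives zero. -/
theorem sum_P_mul_raiseSnd_mul_eq_zero (hF : ∀ a b, F a b = -F b a)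
    (hT : ∀ a b, T a b = T b a) :
    ∑ b, ∑ c, ∑ d, P b d * (raiseSnd P F d c * T c b) = 0 := by
  have h : ∑ b, ∑ c, ∑ d, P b d * (raiseSnd P F d c * T c b)
      = -∑ b, ∑ c, ∑ d, P b d * (raiseSnd P F d c * T c b) := by
    simp only [raiseSnd, Finset.mul_sum, Finset.sum_mul, ← Finset.sum_neg_distrib]
    rw [Finset.sum_comm]
    refine Finset.sum_congr rfl fun b _ => Finset.sum_congr rfl fun c _ => ?_
    rw [Finset.sum_comm]
    exact Finset.sum_congr rfl fun f _ => Finset.sum_congr rfl fun d _ => by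
      rw [hF d f, hT b c]; ring
  linarith

/-- The contraction of three slots of `P^{bd} n^c v_d T_{cb}`. -/
theorem sum_P_mul_n_mul (hT : ∀ a b, T a b = T b a) (v : Fin m → ℝ) :
    ∑ b, ∑ c, ∑ d, P b d * (n c * v d * T c b) = ∑ b, ∑ d, P b d * (contrSnd T n b * v d) := by
  refine Finset.sum_congr rfl fun b _ => ?_
  rw [Finset.sum_comm]
  refine Finset.sum_congr rfl fun d _ => ?_
  simp only [contrSnd, Finset.mul_sum, Finset.sum_mul]
  exact Finset.sum_congr rfl fun c _ => by rw [hT c b]; ring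

theorem sum_diag_mul_sum (w : Fin m → ℝ) :
    ∑ b, ∑ c, ∑ d, P b d * (w c * T d b) = (∑ c, w c) * ∑ b, ∑ d, P b d * T d b := by
  rw [Finset.sum_comm, Finset.sum_mul]
  simp only [Finset.mul_sum]
  exact Finset.sum_congr rfl fun c _ => Finset.sum_congr rfl fun b _ =>
    Finset.sum_congr rfl fun d _ => by ring

end Contraction

/-! ### The contracted Gauss equation -/

section ContractedGauss

variable {m : ℕ} {P Y U F Dn : Fin m → Fin m → ℝ} {n dl : Fin m → ℝ} {n2 l2 : ℝ}
  {DP DY DU : Fin m → Fin m → Fin m → ℝ}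

theorem sum_swap_pairs (X : Fin m → Fin m → Fin m → Fin m → ℝ) :
    ∑ b, ∑ c, ∑ d, ∑ f, X b c d f = ∑ b, ∑ c, ∑ d, ∑ f, X d f b c := by
  have h (d : Fin m) : ∑ b, ∑ c, ∑ f, X b c d f = ∑ f, ∑ b, ∑ c, X b c d f := by
    rw [Finset.sum_comm]
    exact (Finset.sum_congr rfl fun b _ => Finset.sum_comm).trans
      (Finset.sum_comm.trans (Finset.sum_congr rfl fun c _ => Finset.sum_comm))
  rw [Finset.sum_congr rfl fun b _ => Finset.sum_comm, Finset.sum_comm]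
  exact Finset.sum_congr rfl fun d _ => h d

/-- Eliminates `∇°n` through its formula; the `P`-raised part in `F` drops by antisymmetry. -/
theorem sum_P_mul_covVec (hY : ∀ a b, Y a b = Y b a)
    (hF : ∀ a b, F a b = -F b a)
    (hDn : ∀ a c, Dn a c = -n2 * raiseSnd P F a c + raiseSnd P U a c - n c * contrSnd F n a
      - n2 * n c * dl a) :
    ∑ b, ∑ c, ∑ d, P b d * (Dn d c * Y c b) =
      (∑ b, ∑ c, ∑ d, P b d * (raiseSnd P U d c * Y c b))
      - (∑ b, ∑ d, P b d * (contrSnd Y n b * contrSnd F n d))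
      - n2 * ∑ b, ∑ d, P b d * (contrSnd Y n b * dl d) := by
  rw [← sum_P_mul_n_mul hY, ← sum_P_mul_n_mul hY]
  have h0 := sum_P_mul_raiseSnd_mul_eq_zero (P := P) hF hY
  have h1 : ∑ b, ∑ c, ∑ d, P b d * (Dn d c * Y c b) =
      -n2 * (∑ b, ∑ c, ∑ d, P b d * (raiseSnd P F d c * Y c b))
      + (∑ b, ∑ c, ∑ d, P b d * (raiseSnd P U d c * Y c b))
      - (∑ b, ∑ c, ∑ d, P b d * (n c * contrSnd F n d * Y c b))
      - n2 * ∑ b, ∑ c, ∑ d, P b d * (n c * dl d * Y c b) := by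
    simp only [hDn, Finset.mul_sum, ← Finset.sum_add_distrib, ← Finset.sum_sub_distrib]
    exact Finset.sum_congr rfl fun b _ => Finset.sum_congr rfl fun c _ =>
      Finset.sum_congr rfl fun d _ => by ring
  rw [h1, h0]
  ring

/-- In the divergence of `n` both terms in `F` vanish as traces of antisymmetric objects. -/
theorem sum_covVec_diag (hP : ∀ a b, P a b = P b a) (hU : ∀ a b, U a b = U b a)
    (hF : ∀ a b, F a b = -F b a)
    (hDn : ∀ a c, Dn a c = -n2 * raiseSnd P F a c + raiseSnd P U a c - n c * contrSnd F n a
      - n2 * n c * dl a) :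
    ∑ c, Dn c c = (∑ b, ∑ d, P b d * U d b) - n2 * ∑ c, n c * dl c := by
  have h1 : ∑ c, Dn c c = -n2 * (∑ c, raiseSnd P F c c) + (∑ c, raiseSnd P U c c)
      - (∑ c, n c * contrSnd F n c) - n2 * ∑ c, n c * dl c := by
    simp only [hDn, Finset.mul_sum, ← Finset.sum_add_distrib, ← Finset.sum_sub_distrib]
    exact Finset.sum_congr rfl fun c _ => by ring
  have h2 : ∑ c, raiseSnd P U c c = ∑ b, ∑ d, P b d * U d b :=
    Finset.sum_congr rfl fun b _ => Finset.sum_congr rfl fun d _ => by rw [hU]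
  rw [h1, sum_raiseSnd_diag_eq_zero hP hF, sum_n_mul_contrSnd_eq_zero hF, h2]
  ring

/-- Reduces the trace of the Gauss equation to the basic scalar contractions. The `F` part of `∇_a
l` drops out, both from its trace and against the symmetric `K`. -/
theorem sum_gauss (hP : ∀ a b, P a b = P b a) (hY : ∀ a b, Y a b = Y b a)
    (hU : ∀ a b, U a b = U b a)
    (hF : ∀ a b, F a b = -F b a) (R : Fin m → Fin m → Fin m → Fin m → ℝ)
    (ψ K : Fin m → Fin m → ℝ)
    (hψ : ∀ a b, ψ a b = raiseSnd P F a b + raiseSnd P Y a b + (1 / 2) * n b * dl a)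
    (hK : ∀ a b, K a b = U a b + n2 * Y a b) :
    ∑ b, ∑ c, ∑ d, P b d * (R c b c d - Dn c c * Y d b + Dn d c * Y c b
        - n c * (DY c d b - DY d c b)
        + n c * (contrSnd Y n c * Y d b - contrSnd Y n d * Y c b)
        - ψ c c * K d b + ψ d c * K c b) =
      (∑ b, ∑ c, ∑ d, R c b c d * P b d) - (∑ c, Dn c c) * (∑ b, ∑ d, P b d * Y d b)
      + (∑ b, ∑ c, ∑ d, P b d * (Dn d c * Y c b))
      + (∑ b, ∑ c, ∑ d, P b d * n c * (DY d c b - DY c d b))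
      + (∑ c, n c * contrSnd Y n c) * (∑ b, ∑ d, P b d * Y d b)
      - (∑ b, ∑ d, P b d * (contrSnd Y n b * contrSnd Y n d))
      - ((∑ b, ∑ d, P b d * Y d b) + (1 / 2) * ∑ c, n c * dl c)
        * ((∑ b, ∑ d, P b d * U d b) + n2 * ∑ b, ∑ d, P b d * Y d b)
      + (∑ b, ∑ c, ∑ d, P b d * (raiseSnd P U d c * Y c b))
      + n2 * (∑ b, ∑ c, ∑ d, P b d * (raiseSnd P Y d c * Y c b))
      + (1 / 2) * ((∑ b, ∑ d, P b d * (contrSnd U n b * dl d))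
        + n2 * ∑ b, ∑ d, P b d * (contrSnd Y n b * dl d)) := by
  have hKs (a b) : K a b = K b a := by rw [hK, hK, hU, hY]
  have e1 : ∑ b, ∑ c, ∑ d, P b d * (R c b c d - Dn c c * Y d b + Dn d c * Y c b
        - n c * (DY c d b - DY d c b)
        + n c * (contrSnd Y n c * Y d b - contrSnd Y n d * Y c b)
        - ψ c c * K d b + ψ d c * K c b) =
      (∑ b, ∑ c, ∑ d, R c b c d * P b d) - (∑ b, ∑ c, ∑ d, P b d * (Dn c c * Y d b))
      + (∑ b, ∑ c, ∑ d, P b d * (Dn d c * Y c b))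
      + (∑ b, ∑ c, ∑ d, P b d * n c * (DY d c b - DY c d b))
      + (∑ b, ∑ c, ∑ d, P b d * (n c * contrSnd Y n c * Y d b))
      - (∑ b, ∑ c, ∑ d, P b d * (n c * contrSnd Y n d * Y c b))
      - (∑ b, ∑ c, ∑ d, P b d * (ψ c c * K d b))
      + (∑ b, ∑ c, ∑ d, P b d * (raiseSnd P F d c * K c b))
      + (∑ b, ∑ c, ∑ d, P b d * (raiseSnd P Y d c * K c b))
      + (1 / 2) * (∑ b, ∑ c, ∑ d, P b d * (n c * dl d * K c b)) := by
    simp only [Finset.mul_sum, ← Finset.sum_add_distrib, ← Finset.sum_sub_distrib]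
    exact Finset.sum_congr rfl fun b _ => Finset.sum_congr rfl fun c _ =>
      Finset.sum_congr rfl fun d _ => by rw [hψ d c]; ring
  have e2 : ∑ b, ∑ d, P b d * K d b = (∑ b, ∑ d, P b d * U d b)
      + n2 * ∑ b, ∑ d, P b d * Y d b := by
    simp only [hK, Finset.mul_sum, ← Finset.sum_add_distrib]
    exact Finset.sum_congr rfl fun b _ => Finset.sum_congr rfl fun d _ => by ring
  have e3 : ∑ c, ψ c c = (∑ b, ∑ d, P b d * Y d b) + (1 / 2) * ∑ c, n c * dl c := by
    have : ∑ c, ψ c c = (∑ c, raiseSnd P F c c) + (∑ c, raiseSnd P Y c c)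
        + (1 / 2) * ∑ c, n c * dl c := by
      simp only [hψ, Finset.mul_sum, ← Finset.sum_add_distrib]
      exact Finset.sum_congr rfl fun c _ => by ring
    rw [this, sum_raiseSnd_diag_eq_zero hP hF, zero_add]
    congr 1
    exact Finset.sum_congr rfl fun b _ => Finset.sum_congr rfl fun d _ => by rw [hY]
  have e4 : ∑ b, ∑ c, ∑ d, P b d * (raiseSnd P Y d c * K c b) =
      (∑ b, ∑ c, ∑ d, P b d * (raiseSnd P U d c * Y c b))
      + n2 * ∑ b, ∑ c, ∑ d, P b d * (raiseSnd P Y d c * Y c b) := by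
    -- `Y` and `U` may be exchanged in the twice raised product.
    have h1 : ∑ b, ∑ c, ∑ d, P b d * (raiseSnd P Y d c * U c b) =
        ∑ b, ∑ c, ∑ d, P b d * (raiseSnd P U d c * Y c b) := by
      simp only [raiseSnd, Finset.mul_sum, Finset.sum_mul]
      rw [sum_swap_pairs]
      exact Finset.sum_congr rfl fun b _ => Finset.sum_congr rfl fun c _ =>
        Finset.sum_congr rfl fun d _ => Finset.sum_congr rfl fun f _ => by
          rw [hP d b, hP f c, hY b c, hU f d]; ring
    rw [← h1]
    simp only [hK, Finset.mul_sum, ← Finset.sum_add_distrib]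
    exact Finset.sum_congr rfl fun b _ => Finset.sum_congr rfl fun c _ =>
      Finset.sum_congr rfl fun d _ => by ring
  have e5 : ∑ b, ∑ d, P b d * (contrSnd K n b * dl d) =
      (∑ b, ∑ d, P b d * (contrSnd U n b * dl d))
        + n2 * ∑ b, ∑ d, P b d * (contrSnd Y n b * dl d) := by
    simp only [hK, contrSnd, add_mul, Finset.sum_add_distrib, mul_add, Finset.mul_sum,
      Finset.sum_mul]
    congr 1
    exact Finset.sum_congr rfl fun b _ => Finset.sum_congr rfl fun d _ =>
      Finset.sum_congr rfl fun f _ => by ring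
  rw [e1, sum_diag_mul_sum (fun c => Dn c c), sum_diag_mul_sum (fun c => n c * contrSnd Y n c),
    sum_diag_mul_sum (fun c => ψ c c), sum_P_mul_n_mul hY, sum_P_mul_n_mul hKs,
    sum_P_mul_raiseSnd_mul_eq_zero hF hKs, e2, e3, e4, e5]
  ring

end ContractedGauss

/-! ### The energy along the rigging in terms of contractions -/

section RiggingEnergy

variable {m : ℕ} {P Y U F Dn : Fin m → Fin m → ℝ} {n dl : Fin m → ℝ} {n2 l2 : ℝ}
  {DP DY DU : Fin m → Fin m → Fin m → ℝ}

/-- Contributes the same contraction of `∇°Y` as `sum_gauss`. Each enters the energy with weight one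
half, which together match the single divergence in the formula. -/
theorem sum_lowered_gauss (hY : ∀ a b, Y a b = Y b a) (hU : ∀ a b, U a b = U b a)
    (hF : ∀ a b, F a b = -F b a) (r : Fin m → Fin m → Fin m → ℝ) :
    ∑ b, ∑ c, ∑ d, P b d * n c * (r b c d - (DY c d b - DY d c b) - l2 * (DU c d b - DU d c b)
      + (1 / 2) * ((n2 * Y d b - U d b) * dl c - (n2 * Y c b - U c b) * dl d)
      + (Y d b * (contrSnd F n c + contrSnd Y n c) - Y c b * (contrSnd F n d + contrSnd Y n d))) =
      (∑ b, ∑ c, ∑ d, P b d * n c * r b c d)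
      + (∑ b, ∑ c, ∑ d, P b d * n c * (DY d c b - DY c d b))
      + l2 * (∑ b, ∑ c, ∑ d, P b d * n c * (DU d c b - DU c d b))
      + (1 / 2) * ((∑ c, n c * dl c)
        * (n2 * (∑ b, ∑ d, P b d * Y d b) - ∑ b, ∑ d, P b d * U d b))
      - (1 / 2) * (n2 * (∑ b, ∑ d, P b d * (contrSnd Y n b * dl d))
        - ∑ b, ∑ d, P b d * (contrSnd U n b * dl d))
      + (∑ c, n c * contrSnd Y n c) * (∑ b, ∑ d, P b d * Y d b)
      - (∑ b, ∑ d, P b d * (contrSnd Y n b * contrSnd F n d))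
      - (∑ b, ∑ d, P b d * (contrSnd Y n b * contrSnd Y n d)) := by
  have h0 := sum_n_mul_contrSnd_eq_zero (n := n) hF
  have e1 : ∑ b, ∑ c, ∑ d, P b d * n c *
      (r b c d - (DY c d b - DY d c b) - l2 * (DU c d b - DU d c b)
      + (1 / 2) * ((n2 * Y d b - U d b) * dl c - (n2 * Y c b - U c b) * dl d)
      + (Y d b * (contrSnd F n c + contrSnd Y n c) - Y c b * (contrSnd F n d + contrSnd Y n d))) =
      (∑ b, ∑ c, ∑ d, P b d * n c * r b c d)
      + (∑ b, ∑ c, ∑ d, P b d * n c * (DY d c b - DY c d b))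
      + l2 * (∑ b, ∑ c, ∑ d, P b d * n c * (DU d c b - DU c d b))
      + (1 / 2) * (n2 * (∑ b, ∑ c, ∑ d, P b d * (n c * dl c * Y d b))
        - ∑ b, ∑ c, ∑ d, P b d * (n c * dl c * U d b))
      - (1 / 2) * (n2 * (∑ b, ∑ c, ∑ d, P b d * (n c * dl d * Y c b))
        - ∑ b, ∑ c, ∑ d, P b d * (n c * dl d * U c b))
      + (∑ b, ∑ c, ∑ d, P b d * (n c * contrSnd F n c * Y d b))
      + (∑ b, ∑ c, ∑ d, P b d * (n c * contrSnd Y n c * Y d b))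
      - (∑ b, ∑ c, ∑ d, P b d * (n c * contrSnd F n d * Y c b))
      - (∑ b, ∑ c, ∑ d, P b d * (n c * contrSnd Y n d * Y c b)) := by
    simp only [Finset.mul_sum, ← Finset.sum_add_distrib, ← Finset.sum_sub_distrib]
    exact Finset.sum_congr rfl fun b _ => Finset.sum_congr rfl fun c _ =>
      Finset.sum_congr rfl fun d _ => by ring
  rw [e1, sum_diag_mul_sum (fun c => n c * dl c), sum_diag_mul_sum (fun c => n c * dl c),
    sum_diag_mul_sum (fun c => n c * contrSnd F n c),
    sum_diag_mul_sum (fun c => n c * contrSnd Y n c), sum_P_mul_n_mul hY, sum_P_mul_n_mul hU,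
    sum_P_mul_n_mul hY, sum_P_mul_n_mul hY, h0]
  ring

/-- Expands the divergence on the energy side. The `dℓ⁽²⁾` terms of `∇°P` cancel between the two
halves of the field, and only one contraction of `Y` with `F` is left of the rest of `∇°P`. -/
theorem sum_covVec_divField (hP : ∀ a b, P a b = P b a) (hY : ∀ a b, Y a b = Y b a)
    (hF : ∀ a b, F a b = -F b a) (hDY : ∀ a b c, DY a b c = DY a c b)
    (hDP : ∀ a b c, DP a b c = -(n c * raiseSnd P F a b + n b * raiseSnd P F a c)
      - n b * n c * dl a) :
    ∑ d, ((∑ c, ((∑ b, (DP d b d * Y b c + P b d * DY d b c)) * n c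
        + (∑ b, P b d * Y b c) * Dn d c))
      - ((∑ b, ∑ c, (DP d b c * Y b c + P b c * DY d b c)) * n d
        + (∑ b, ∑ c, P b c * Y b c) * Dn d d)) =
      (∑ b, ∑ c, ∑ d, P b d * (Dn d c * Y c b)) - (∑ c, Dn c c) * (∑ b, ∑ d, P b d * Y d b)
      + (∑ b, ∑ c, ∑ d, P b d * n c * (DY d c b - DY c d b))
      - (∑ b, ∑ d, P b d * (contrSnd Y n b * contrSnd F n d)) := by
  have hPF (v : Fin m → ℝ) : ∑ b, ∑ d, n d * raiseSnd P F d b * v b =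
      -∑ b, ∑ d, P b d * (v b * contrSnd F n d) := by
    rw [← Finset.sum_neg_distrib]
    refine Finset.sum_congr rfl fun b _ => ?_
    rw [← Finset.sum_mul, sum_n_mul_raiseSnd_of_antisymm hF, neg_mul, Finset.sum_mul]
    exact congrArg _ (Finset.sum_congr rfl fun d _ => by ring)
  have e1 : ∑ d, ∑ c, (∑ b, DP d b d * Y b c) * n c =
      -(∑ b, ∑ d, n d * raiseSnd P F d b * contrSnd Y n b)
      - (∑ d, raiseSnd P F d d) * (∑ c, n c * contrSnd Y n c)
      - (∑ c, n c * dl c) * ∑ c, n c * contrSnd Y n c := by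
    have : ∑ d, ∑ c, (∑ b, DP d b d * Y b c) * n c = ∑ b, ∑ d, DP d b d * contrSnd Y n b := by
      rw [Finset.sum_comm (γ := Fin m) (f := fun b d => DP d b d * contrSnd Y n b)]
      refine Finset.sum_congr rfl fun d _ => ?_
      simp only [contrSnd, Finset.mul_sum, Finset.sum_mul]
      rw [Finset.sum_comm]
      exact Finset.sum_congr rfl fun b _ => Finset.sum_congr rfl fun c _ => by ring
    rw [this]
    simp only [hDP, Finset.sum_mul, Finset.mul_sum, ← Finset.sum_neg_distrib,
      ← Finset.sum_sub_distrib]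
    refine Finset.sum_congr rfl fun b _ => Finset.sum_congr rfl fun d _ => by ring
  have e2 : ∑ d, (∑ b, ∑ c, DP d b c * Y b c) * n d =
      -2 * (∑ b, ∑ d, n d * raiseSnd P F d b * contrSnd Y n b)
      - (∑ c, n c * dl c) * ∑ c, n c * contrSnd Y n c := by
    have h1 (d : Fin m) : ∑ b, ∑ c, DP d b c * Y b c =
        -2 * (∑ b, raiseSnd P F d b * contrSnd Y n b) - dl d * ∑ c, n c * contrSnd Y n c := by
      have h2 : ∑ b, ∑ c, DP d b c * Y b c = -(∑ b, ∑ c, raiseSnd P F d b * (Y b c * n c))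
          - (∑ b, ∑ c, raiseSnd P F d c * (Y c b * n b)) - dl d * ∑ b, ∑ c, n b * (Y b c * n c) := by
        simp only [hDP, Finset.mul_sum, ← Finset.sum_neg_distrib, ← Finset.sum_sub_distrib]
        exact Finset.sum_congr rfl fun b _ => Finset.sum_congr rfl fun c _ => by
          rw [hY c b]; ring
      rw [h2, Finset.sum_comm (γ := Fin m) (f := fun b c => raiseSnd P F d c * (Y c b * n b))]
      simp only [contrSnd, ← Finset.mul_sum]
      ring
    simp only [h1, sub_mul, Finset.sum_sub_distrib]
    rw [Finset.sum_comm (γ := Fin m) (f := fun b d => n d * raiseSnd P F d b * contrSnd Y n b)]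
    simp only [Finset.mul_sum, Finset.sum_mul]
    congr 1
    · exact Finset.sum_congr rfl fun b _ => Finset.sum_congr rfl fun c _ => by ring
    · rw [Finset.sum_comm]
      exact Finset.sum_congr rfl fun b _ => Finset.sum_congr rfl fun c _ => by ring
  have e3 : ∑ d, ∑ c, (∑ b, P b d * DY d b c) * n c =
      ∑ b, ∑ c, ∑ d, P b d * n c * DY d c b := by
    rw [Finset.sum_comm' (s := Finset.univ) (t := fun _ => Finset.univ) (t' := Finset.univ)
      (s' := fun _ => Finset.univ) (by simp)]
    simp only [Finset.sum_mul]
    rw [Finset.sum_congr rfl fun c _ => Finset.sum_comm, Finset.sum_comm]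
    exact Finset.sum_congr rfl fun b _ => Finset.sum_congr rfl fun c _ =>
      Finset.sum_congr rfl fun d _ => by rw [hDY d b c]; ring
  have e4 : ∑ d, (∑ b, ∑ c, P b c * DY d b c) * n d =
      ∑ b, ∑ c, ∑ d, P b d * n c * DY c d b := by
    simp only [Finset.sum_mul]
    rw [Finset.sum_comm]
    exact Finset.sum_congr rfl fun b _ => Finset.sum_congr rfl fun c _ =>
      Finset.sum_congr rfl fun d _ => by rw [hDY c b d]; ring
  have e5 : ∑ d, ∑ c, (∑ b, P b d * Y b c) * Dn d c =
      ∑ b, ∑ c, ∑ d, P b d * (Dn d c * Y c b) := by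
    simp only [Finset.sum_mul]
    rw [Finset.sum_comm, Finset.sum_congr rfl fun c _ => Finset.sum_comm, Finset.sum_comm]
    exact Finset.sum_congr rfl fun b _ => Finset.sum_congr rfl fun c _ =>
      Finset.sum_congr rfl fun d _ => by rw [hY b c]; ring
  have e6 : ∑ b, ∑ c, P b c * Y b c = ∑ b, ∑ d, P b d * Y d b :=
    Finset.sum_congr rfl fun b _ => Finset.sum_congr rfl fun d _ => by rw [hY]
  simp only [Finset.sum_add_distrib, Finset.sum_sub_distrib, add_mul, mul_sub]
  rw [e1, e2, e3, e4, e5, e6, hPF, sum_raiseSnd_diag_eq_zero hP hF, ← Finset.mul_sum]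
  ring

/-- The quadratic term in `Y`. -/
theorem sum_quadratic (hY : ∀ a b, Y a b = Y b a) (hP : ∀ a b, P a b = P b a) :
    ∑ a, ∑ b, ∑ c, ∑ d, P b d * P a c * (Y b c * Y d a - Y b d * Y c a) =
      (∑ b, ∑ c, ∑ d, P b d * (raiseSnd P Y d c * Y c b))
      - (∑ b, ∑ d, P b d * Y d b) * ∑ b, ∑ d, P b d * Y d b := by
  have e1 : ∑ a, ∑ b, ∑ c, ∑ d, P b d * P a c * (Y b c * Y d a) =
      ∑ b, ∑ c, ∑ d, P b d * (raiseSnd P Y d c * Y c b) := by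
    simp only [raiseSnd, Finset.mul_sum, Finset.sum_mul]
    rw [Finset.sum_comm]
    refine Finset.sum_congr rfl fun b _ => ?_
    rw [Finset.sum_comm]
    refine Finset.sum_congr rfl fun c _ => ?_
    rw [Finset.sum_comm]
    exact Finset.sum_congr rfl fun d _ => Finset.sum_congr rfl fun a _ => by
      rw [hY b c, hP a c]; ring
  have e2 : ∑ a, ∑ b, ∑ c, ∑ d, P b d * P a c * (Y b d * Y c a) =
      (∑ b, ∑ d, P b d * Y d b) * ∑ b, ∑ d, P b d * Y d b := by
    have h1 (a : Fin m) : ∑ b, ∑ c, ∑ d, P b d * P a c * (Y b d * Y c a) =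
        (∑ b, ∑ d, P b d * Y d b) * ∑ c, P a c * Y c a := by
      rw [Finset.sum_comm, Finset.mul_sum]
      refine Finset.sum_congr rfl fun c _ => ?_
      simp only [Finset.sum_mul]
      exact Finset.sum_congr rfl fun b _ => Finset.sum_congr rfl fun d _ => by
        rw [hY b d]; ring
    simp only [h1, ← Finset.mul_sum]
  simp only [mul_sub, Finset.sum_sub_distrib]
  rw [← e2, ← e1]

/-- The bracket is evaluated after moving the antisymmetrization in `c`, `d` from `P^bd n^c` onto
the other factor. -/
theorem sum_rigging_flux (hY : ∀ a b, Y a b = Y b a) (hU : ∀ a b, U a b = U b a)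
    (hDU : ∀ a b c, DU a b c = DU a c b) (hF : ∀ a b, F a b = -F b a) :
    ∑ b, ∑ c, ∑ d, (P b d * n c - P b c * n d) *
        (l2 * DU d b c + (U b c + n2 * Y b c) * dl d + 2 * Y b c * ∑ f, (F d f - Y d f) * n f) =
      l2 * (∑ b, ∑ c, ∑ d, P b d * n c * (DU d c b - DU c d b))
      + (∑ b, ∑ d, P b d * (contrSnd U n b * dl d))
      + n2 * (∑ b, ∑ d, P b d * (contrSnd Y n b * dl d))
      - ((∑ b, ∑ d, P b d * U d b) + n2 * ∑ b, ∑ d, P b d * Y d b) * (∑ c, n c * dl c)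
      + 2 * ((∑ b, ∑ d, P b d * (contrSnd Y n b * contrSnd F n d))
        - ∑ b, ∑ d, P b d * (contrSnd Y n b * contrSnd Y n d))
      + 2 * (∑ b, ∑ d, P b d * Y d b) * ∑ c, n c * contrSnd Y n c := by
  have h0 := sum_n_mul_contrSnd_eq_zero (n := n) hF
  have hf (d : Fin m) : ∑ f, (F d f - Y d f) * n f = contrSnd F n d - contrSnd Y n d := by
    simp only [contrSnd, sub_mul, Finset.sum_sub_distrib]
  have hs (X : Fin m → Fin m → Fin m → ℝ) :
      ∑ b, ∑ c, ∑ d, (P b d * n c - P b c * n d) * X b c d =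
      ∑ b, ∑ c, ∑ d, P b d * n c * (X b c d - X b d c) := by
    refine Finset.sum_congr rfl fun b _ => ?_
    simp only [sub_mul, mul_sub, Finset.sum_sub_distrib]
    congr 1
    exact Finset.sum_comm
  rw [hs]
  have e1 : ∑ b, ∑ c, ∑ d, P b d * n c * ((l2 * DU d b c + (U b c + n2 * Y b c) * dl d
        + 2 * Y b c * ∑ f, (F d f - Y d f) * n f)
        - (l2 * DU c b d + (U b d + n2 * Y b d) * dl c
        + 2 * Y b d * ∑ f, (F c f - Y c f) * n f)) =
      l2 * (∑ b, ∑ c, ∑ d, P b d * n c * (DU d c b - DU c d b))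
      + (∑ b, ∑ c, ∑ d, P b d * (n c * dl d * U c b))
      + n2 * (∑ b, ∑ c, ∑ d, P b d * (n c * dl d * Y c b))
      + 2 * (∑ b, ∑ c, ∑ d, P b d * (n c * contrSnd F n d * Y c b))
      - 2 * (∑ b, ∑ c, ∑ d, P b d * (n c * contrSnd Y n d * Y c b))
      - (∑ b, ∑ c, ∑ d, P b d * (n c * dl c * U d b))
      - n2 * (∑ b, ∑ c, ∑ d, P b d * (n c * dl c * Y d b))
      - 2 * (∑ b, ∑ c, ∑ d, P b d * (n c * contrSnd F n c * Y d b))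
      + 2 * (∑ b, ∑ c, ∑ d, P b d * (n c * contrSnd Y n c * Y d b)) := by
    simp only [hf, Finset.mul_sum, ← Finset.sum_add_distrib, ← Finset.sum_sub_distrib]
    exact Finset.sum_congr rfl fun b _ => Finset.sum_congr rfl fun c _ =>
      Finset.sum_congr rfl fun d _ => by
        rw [hDU d b c, hDU c b d, hU b c, hY b c, hU b d, hY b d]; ring
  rw [e1, sum_diag_mul_sum (fun c => n c * dl c), sum_diag_mul_sum (fun c => n c * dl c),
    sum_diag_mul_sum (fun c => n c * contrSnd F n c),
    sum_diag_mul_sum (fun c => n c * contrSnd Y n c), sum_P_mul_n_mul hY, sum_P_mul_n_mul hU,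
    sum_P_mul_n_mul hY, sum_P_mul_n_mul hY, h0]
  ring

end RiggingEnergy

/-! ### The energy along the rigging in coordinates -/

section RiggingCoordinates

variable {m : ℕ} {S M : Type*}
  [TopologicalSpace S] [ChartedSpace (EuclideanSpace ℝ (Fin m)) S]
  {φ : OpenPartialHomeomorph S (EuclideanSpace ℝ (Fin m))} {x : EuclideanSpace ℝ (Fin m)}

theorem MetricHypersurfaceData.covBilin_symm (D : MetricHypersurfaceData m S)
    {T : EuclideanSpace ℝ (Fin m) → Fin m → Fin m → ℝ} (hT : ∀ y a b, T y a b = T y b a)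
    (a b c : Fin m) : D.covBilin φ T x a b c = D.covBilin φ T x a c b := by
  simp only [MetricHypersurfaceData.covBilin, fun y => hT y b c]
  rw [sub_right_comm]
  simp only [hT x b, hT x c]

variable [TopologicalSpace M] [ChartedSpace (EuclideanSpace ℝ (Fin (m + 1))) M]
  [IsManifold (𝓡 (m + 1)) ∞ M]
  {g : SpacetimeMetric m M} {D : HypersurfaceData m S} {Φ : S → M}
  {l : ∀ p : S, TangentSpace (𝓡 (m + 1)) (Φ p)}
  {ν : TangentSpace (𝓡 (m + 1)) (Φ (φ.symm x)) →L[ℝ] ℝ}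

/-- The components are kept abstract, tied to the data only by equations, so that the last
comparison is a polynomial identity in a few contractions. -/
theorem HypersurfaceData.IsEmbedded.einstein_rigging_coord (hD : D.IsEmbedded g Φ l)
    (hφ : φ ∈ IsManifold.maximalAtlas (𝓡 m) ∞ S) (hx : x ∈ φ.target)
    (hν : IsNormalForm Φ l (φ.symm x) ν)
    {P Y F U : Fin m → Fin m → ℝ} {n ℓ dl : Fin m → ℝ} {n2 l2 : ℝ}
    {DU : Fin m → Fin m → Fin m → ℝ} {R : Fin m → Fin m → Fin m → Fin m → ℝ}
    (hP : P = D.PComp φ x) (hn : n = D.nComp φ x) (hn2 : n2 = D.n2Comp φ x)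
    (hℓ : ℓ = formComp D.ell φ x) (hl2 : l2 = D.ell2 (φ.symm x)) (hdl : dl = D.dell2Comp φ x)
    (hY : Y = bilinComp D.Y φ x) (hF : F = D.FComp φ x) (hU : U = D.UComp φ x)
    (hDU : DU = D.covBilin φ (D.UComp φ) x) (hR : R = curvatureCoeff (D.conn φ) x) :
    -g.einstein (Φ (φ.symm x)) ν (l (φ.symm x)) =
      (1 / 2) * (∑ b, ∑ c, ∑ d, R c b c d * P b d)
      + (1 / 2) * (∑ a, ∑ b, ∑ c, ∑ d, ℓ a * R a b c d * P b d * n c)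
      + (∑ d, D.covVec φ (D.divFieldComp φ) x d d)
      + (1 / 2) * n2 * (∑ a, ∑ b, ∑ c, ∑ d,
          P b d * P a c * (Y b c * Y d a - Y b d * Y c a))
      + (1 / 2) * (∑ b, ∑ c, ∑ d, (P b d * n c - P b c * n d) *
          (l2 * DU d b c + (U b c + n2 * Y b c) * dl d
            + 2 * Y b c * ∑ f, (F d f - Y d f) * n f)) := by
  have sP : ∀ a b, P a b = P b a := by subst hP; exact D.PComp_symm
  have sY : ∀ a b, Y a b = Y b a := by subst hY; exact D.YComp_symm
  have sU : ∀ a b, U a b = U b a := by subst hU; exact D.UComp_symm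
  have sF : ∀ a b, F a b = -F b a := by subst hF; exact D.FComp_antisymm
  have sDU : ∀ a b c, DU a b c = DU a c b := by
    subst hDU; exact D.covBilin_symm fun y => D.UComp_symm
  obtain ⟨DY, hDY⟩ : ∃ DY, DY = D.covBilin φ (bilinComp D.Y φ) x := ⟨_, rfl⟩
  have sDY : ∀ a b c, DY a b c = DY a c b := by
    subst hDY; exact D.covBilin_symm fun y => D.YComp_symm
  obtain ⟨Dn, hDn⟩ : ∃ Dn, Dn = D.covVec φ (D.nComp φ) x := ⟨_, rfl⟩
  obtain ⟨DP, hDP⟩ : ∃ DP, DP = D.covBiv φ (D.PComp φ) x := ⟨_, rfl⟩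
  have eDn (a c) : Dn a c = -n2 * raiseSnd P F a c + raiseSnd P U a c - n c * contrSnd F n a
      - n2 * n c * dl a := by
    subst hDn hP hn hn2 hF hU hdl
    exact D.covVec_nComp hφ hx a c
  have eDP (a b c) : DP a b c = -(n c * raiseSnd P F a b + n b * raiseSnd P F a c)
      - n b * n c * dl a := by
    subst hDP hP hn hF hdl
    exact D.covBiv_PComp hφ hx a b c
  rw [hD.einstein_rigging hφ hx hν]
  have h1 := sum_gauss (Dn := Dn) (n := n) (dl := dl) (n2 := n2) (DY := DY) sP sY sU sF R
    (fun a b => frameConn (D.coordMat φ) (bilinComp D.Y φ) a x (Sum.inl b) (Sum.inr ()))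
    (D.KComp φ x)
    (by subst hP hn hF hY hdl; exact D.frameConn_inl_inr')
    (by subst hU hn2 hY; exact fun _ _ => rfl)
  have h2 := sum_lowered_gauss (P := P) (n := n) (dl := dl) (n2 := n2) (l2 := l2) (DY := DY)
    (DU := DU) sY sU sF (fun b c d => ∑ a, ℓ a * R a b c d)
  have h3 := sum_covVec_divField (P := P) (n := n) (dl := dl) (Dn := Dn) sP sY sF sDY eDP
  have h4 := sum_quadratic (P := P) sY sP
  have h5 := sum_rigging_flux (P := P) (n := n) (dl := dl) (n2 := n2) (l2 := l2) sY sU sDU sF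
  have h6 := sum_P_mul_covVec (P := P) (U := U) sY sF eDn
  have h7 := sum_covVec_diag sP sU sF eDn
  have h8 : ∑ a, ∑ b, ∑ c, ∑ d, ℓ a * R a b c d * P b d * n c =
      ∑ b, ∑ c, ∑ d, P b d * n c * ∑ a, ℓ a * R a b c d := by
    simp only [Finset.mul_sum]
    rw [Finset.sum_comm]
    refine Finset.sum_congr rfl fun b _ => ?_
    rw [Finset.sum_comm]
    refine Finset.sum_congr rfl fun c _ => ?_
    rw [Finset.sum_comm]
    exact Finset.sum_congr rfl fun d _ => Finset.sum_congr rfl fun a _ => by ring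
  have h9 : ∑ b, ∑ c, ∑ d, D.PComp φ x b d * D.frameCurvature φ x c d (Sum.inl c) (Sum.inl b) =
      ∑ b, ∑ c, ∑ d, P b d * (R c b c d - Dn c c * Y d b + Dn d c * Y c b
        - n c * (DY c d b - DY d c b)
        + n c * (contrSnd Y n c * Y d b - contrSnd Y n d * Y c b)
        - frameConn (D.coordMat φ) (bilinComp D.Y φ) c x (Sum.inl c) (Sum.inr ()) * D.KComp φ x d b
        + frameConn (D.coordMat φ) (bilinComp D.Y φ) d x (Sum.inl c) (Sum.inr ())
          * D.KComp φ x c b) := by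
    subst hP hR hDn hY hDY hn
    simp only [D.frameCurvature_inl_inl hφ hx]
  have h10 : ∑ b, ∑ c, ∑ d, D.PComp φ x b d * D.nComp φ x c
        * (D.coordMat φ x * D.frameCurvature φ x c d) (Sum.inr ()) (Sum.inl b) =
      ∑ b, ∑ c, ∑ d, P b d * n c * ((∑ a, ℓ a * R a b c d) - (DY c d b - DY d c b)
      - l2 * (DU c d b - DU d c b)
      + (1 / 2) * ((n2 * Y d b - U d b) * dl c - (n2 * Y c b - U c b) * dl d)
      + (Y d b * (contrSnd F n c + contrSnd Y n c)
        - Y c b * (contrSnd F n d + contrSnd Y n d))) := by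
    subst hP hR hY hDY hn hDU hU hF hdl hn2 hl2 hℓ
    simp only [D.coordMat_mul_frameCurvature hφ hx]
  have h11 : ∑ d, D.covVec φ (D.divFieldComp φ) x d d =
      ∑ d, ((∑ c, ((∑ b, (DP d b d * Y b c + P b d * DY d b c)) * n c
        + (∑ b, P b d * Y b c) * Dn d c))
      - ((∑ b, ∑ c, (DP d b c * Y b c + P b c * DY d b c)) * n d
        + (∑ b, ∑ c, P b c * Y b c) * Dn d d)) := by
    subst hP hDn hY hDY hn hDP
    simp only [D.covVec_divFieldComp hφ hx]
  -- Once `∇°n` is eliminated, both sides contain the same contractions.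
  rw [h9, h1, h10, h2, h11, h3, h4, h5, h8, h6, h7]
  ring

end RiggingCoordinates

/-! ### The energy flux in terms of contractions -/

section Flux

variable {m : ℕ} {P Y U F Dn : Fin m → Fin m → ℝ} {n dl dn2 : Fin m → ℝ} {n2 l2 : ℝ}
  {DP DM DY DU : Fin m → Fin m → Fin m → ℝ}

theorem sum_n_mul_n (v w : Fin m → ℝ) :
    ∑ b, ∑ d, n b * n d * (v b * w d) = (∑ b, n b * v b) * ∑ d, n d * w d := by
  rw [Finset.sum_mul_sum]
  exact Finset.sum_congr rfl fun b _ => Finset.sum_congr rfl fun d _ => by ring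

theorem contrSnd_eq_sum_n_mul {T : Fin m → Fin m → ℝ} (hT : ∀ a b, T a b = T b a) (c : Fin m) :
    ∑ b, n b * T b c = contrSnd T n c :=
  Finset.sum_congr rfl fun b _ => by rw [hT b c, mul_comm]

theorem sum_n_mul_n_mul_bilin {T : Fin m → Fin m → ℝ} (hT : ∀ a b, T a b = T b a) (s : ℝ) :
    ∑ b, ∑ d, n b * n d * (T d b * s) = (∑ b, n b * contrSnd T n b) * s := by
  simp only [contrSnd, Finset.mul_sum, Finset.sum_mul]
  exact Finset.sum_congr rfl fun b _ => Finset.sum_congr rfl fun d _ => by rw [hT d b]; ring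

/-- Lists the contractions coming from the Codazzi block. Those that contain `dn⁽²⁾` with a summed
index are kept, since the divergence produces them too. -/
theorem sum_codazzi (hY : ∀ a b, Y a b = Y b a)
    (hU : ∀ a b, U a b = U b a)
    (hDY : ∀ a b c, DY a b c = DY a c b) (hDU : ∀ a b c, DU a b c = DU a c b) (c : Fin m)
    (k χ : Fin m → ℝ) (K : Fin m → Fin m → ℝ)
    (hk : ∀ a, k a = contrSnd U n a + n2 * contrSnd Y n a)
    (hχ : ∀ a, χ a = contrSnd F n a + contrSnd Y n a + (1 / 2) * n2 * dl a)
    (hK : ∀ a b, K a b = U a b + n2 * Y a b) :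
    ∑ b, ∑ d, P b d * (-(DU d c b - DU c d b) - (dn2 d * Y c b - dn2 c * Y d b)
        - n2 * (DY d c b - DY c d b) + (k d * Y c b - k c * Y d b)
        - (χ d * K c b - χ c * K d b)) =
      -(∑ b, ∑ d, P b d * (DU d b c - DU c b d))
      - n2 * (∑ b, ∑ d, P b d * (DY d b c - DY c b d))
      - (∑ b, ∑ d, P b d * (dn2 d * Y b c))
      + (∑ b, ∑ d, P b d * (contrSnd U n d * Y b c))
      - (∑ b, ∑ d, P b d * (contrSnd F n d * U b c))
      - (∑ b, ∑ d, P b d * (contrSnd Y n d * U b c))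
      - (1 / 2) * n2 * (∑ b, ∑ d, P b d * (dl d * U b c))
      - n2 * (∑ b, ∑ d, P b d * (contrSnd F n d * Y b c))
      - (1 / 2) * n2 ^ 2 * (∑ b, ∑ d, P b d * (dl d * Y b c))
      + (dn2 c - k c) * (∑ b, ∑ d, P b d * Y d b)
      + χ c * ((∑ b, ∑ d, P b d * U d b) + n2 * ∑ b, ∑ d, P b d * Y d b) := by
  simp only [Finset.mul_sum, ← Finset.sum_add_distrib, ← Finset.sum_sub_distrib,
    ← Finset.sum_neg_distrib]
  refine Finset.sum_congr rfl fun b _ => Finset.sum_congr rfl fun d _ => ?_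
  rw [hK c b, hK d b, hk d, hχ d, hDU d c b, hDU c d b, hDY d c b, hDY c d b, hY c b, hU c b]
  ring

theorem sum_lowered_codazzi (hY : ∀ a b, Y a b = Y b a)
    (hU : ∀ a b, U a b = U b a) (hF : ∀ a b, F a b = -F b a)
    (hDY : ∀ a b c, DY a b c = DY a c b) (hDU : ∀ a b c, DU a b c = DU a c b)
    (r : Fin m → Fin m → ℝ) (c : Fin m) :
    ∑ b, ∑ d, n b * n d * (r b d - (DY d c b - DY c d b) - l2 * (DU d c b - DU c d b)
      + (1 / 2) * ((n2 * Y c b - U c b) * dl d - (n2 * Y d b - U d b) * dl c)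
      + (Y c b * (contrSnd F n d + contrSnd Y n d) - Y d b * (contrSnd F n c + contrSnd Y n c))) =
      (∑ b, ∑ d, n b * n d * r b d)
      - (∑ b, ∑ d, n b * n d * (DY d b c - DY c b d))
      - l2 * (∑ b, ∑ d, n b * n d * (DU d b c - DU c b d))
      + (1 / 2) * ((n2 * contrSnd Y n c - contrSnd U n c) * ∑ d, n d * dl d)
      - (1 / 2) * ((n2 * (∑ b, n b * contrSnd Y n b) - ∑ b, n b * contrSnd U n b) * dl c)
      + contrSnd Y n c * (∑ b, n b * contrSnd Y n b)
      - (∑ b, n b * contrSnd Y n b) * (contrSnd F n c + contrSnd Y n c) := by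
  have e1 : ∑ b, ∑ d, n b * n d * (r b d - (DY d c b - DY c d b) - l2 * (DU d c b - DU c d b)
      + (1 / 2) * ((n2 * Y c b - U c b) * dl d - (n2 * Y d b - U d b) * dl c)
      + (Y c b * (contrSnd F n d + contrSnd Y n d) - Y d b * (contrSnd F n c + contrSnd Y n c))) =
      (∑ b, ∑ d, n b * n d * r b d)
      - (∑ b, ∑ d, n b * n d * (DY d b c - DY c b d))
      - l2 * (∑ b, ∑ d, n b * n d * (DU d b c - DU c b d))
      + (1 / 2) * (n2 * (∑ b, ∑ d, n b * n d * (Y b c * dl d))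
        - ∑ b, ∑ d, n b * n d * (U b c * dl d))
      - (1 / 2) * (n2 * (∑ b, ∑ d, n b * n d * (Y d b * dl c))
        - ∑ b, ∑ d, n b * n d * (U d b * dl c))
      + (∑ b, ∑ d, n b * n d * (Y b c * contrSnd F n d))
      + (∑ b, ∑ d, n b * n d * (Y b c * contrSnd Y n d))
      - (∑ b, ∑ d, n b * n d * (Y d b * (contrSnd F n c + contrSnd Y n c))) := by
    simp only [Finset.mul_sum, ← Finset.sum_add_distrib, ← Finset.sum_sub_distrib]
    refine Finset.sum_congr rfl fun b _ => Finset.sum_congr rfl fun d _ => ?_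
    rw [hDU d c b, hDU c d b, hDY d c b, hDY c d b, hY c b, hU c b]
    ring
  rw [e1]
  simp only [sum_n_mul_n (fun b => Y b c), sum_n_mul_n (fun b => U b c), sum_n_mul_n_mul_bilin hY,
    sum_n_mul_n_mul_bilin hU, contrSnd_eq_sum_n_mul hY, contrSnd_eq_sum_n_mul hU,
    sum_n_mul_contrSnd_eq_zero hF]
  ring

/-- The derivative of `n` along itself. -/
theorem sum_covVec_mul_n (hU : ∀ a b, U a b = U b a) (hF : ∀ a b, F a b = -F b a)
    (hDn : ∀ a c, Dn a c = -n2 * raiseSnd P F a c + raiseSnd P U a c - n c * contrSnd F n a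
      - n2 * n c * dl a) (b : Fin m) :
    ∑ d, n d * Dn d b = n2 * (∑ f, P b f * contrSnd F n f) + (∑ f, P b f * contrSnd U n f)
      - n2 * n b * ∑ d, n d * dl d := by
  have h1 : ∑ d, n d * Dn d b = -n2 * (∑ d, n d * raiseSnd P F d b) + (∑ d, n d * raiseSnd P U d b)
      - n b * (∑ d, n d * contrSnd F n d) - n2 * n b * ∑ d, n d * dl d := by
    simp only [hDn, Finset.mul_sum, ← Finset.sum_add_distrib, ← Finset.sum_sub_distrib]
    exact Finset.sum_congr rfl fun d _ => by ring
  have h2 : ∑ f, P b f * ∑ d, U d f * n d = ∑ f, P b f * contrSnd U n f :=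
    Finset.sum_congr rfl fun f _ => congrArg _ (Finset.sum_congr rfl fun d _ => by rw [hU])
  rw [h1, sum_n_mul_raiseSnd_of_antisymm hF, sum_n_mul_raiseSnd, sum_n_mul_contrSnd_eq_zero hF, h2]
  ring

/-- The `F` contributions of `∇°P` and of `∇°n` cancel, so this divergence sees only `dn⁽²⁾`, `U`
and `dℓ⁽²⁾`. -/
theorem sum_covBiv_div (hP : ∀ a b, P a b = P b a) (hY : ∀ a b, Y a b = Y b a)
    (hU : ∀ a b, U a b = U b a) (hF : ∀ a b, F a b = -F b a)
    (hDn : ∀ a c, Dn a c = -n2 * raiseSnd P F a c + raiseSnd P U a c - n c * contrSnd F n a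
      - n2 * n c * dl a)
    (hDP : ∀ a b c, DP a b c = -(n c * raiseSnd P F a b + n b * raiseSnd P F a c)
      - n b * n c * dl a)
    (hDM : ∀ a b d, DM a b d = dn2 a * P b d + n2 * DP a b d - (Dn a b * n d + n b * Dn a d))
    (c : Fin m) :
    ∑ b, ∑ d, DM d b d * Y b c = (∑ b, ∑ d, P b d * (dn2 d * Y b c))
      - (∑ b, ∑ d, P b d * (contrSnd U n d * Y b c))
      - (∑ b, ∑ d, P b d * U d b) * contrSnd Y n c
      + n2 * (∑ d, n d * dl d) * contrSnd Y n c := by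
  have e1 : ∑ b, ∑ d, DM d b d * Y b c = (∑ b, ∑ d, P b d * (dn2 d * Y b c))
      - n2 * (∑ b, (∑ d, n d * raiseSnd P F d b) * Y b c)
      - n2 * ((∑ b, n b * Y b c) * ∑ d, raiseSnd P F d d)
      - n2 * ((∑ b, n b * Y b c) * ∑ d, n d * dl d)
      - (∑ b, (∑ d, n d * Dn d b) * Y b c) - (∑ b, n b * Y b c) * ∑ d, Dn d d := by
    simp only [Finset.sum_mul_sum]
    simp only [hDM, hDP, Finset.mul_sum, Finset.sum_mul, ← Finset.sum_sub_distrib]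
    refine Finset.sum_congr rfl fun b _ => Finset.sum_congr rfl fun d _ => ?_
    ring
  have e2 : ∑ b, (∑ d, n d * Dn d b) * Y b c = n2 * (∑ b, ∑ d, P b d * (contrSnd F n d * Y b c))
      + (∑ b, ∑ d, P b d * (contrSnd U n d * Y b c))
      - n2 * (∑ b, n b * Y b c) * ∑ d, n d * dl d := by
    have h : ∑ b, (∑ d, n d * Dn d b) * Y b c =
        n2 * (∑ b, (∑ f, P b f * contrSnd F n f) * Y b c)
        + (∑ b, (∑ f, P b f * contrSnd U n f) * Y b c)
        - n2 * (∑ b, n b * Y b c) * ∑ d, n d * dl d := by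
      rw [mul_right_comm]
      simp only [sum_covVec_mul_n hU hF hDn]
      rw [Finset.mul_sum, Finset.mul_sum, ← Finset.sum_add_distrib, ← Finset.sum_sub_distrib]
      exact Finset.sum_congr rfl fun b _ => by ring
    rw [h]
    simp only [Finset.sum_mul, mul_assoc]
  have e3 : ∑ b, (∑ d, n d * raiseSnd P F d b) * Y b c =
      -∑ b, ∑ d, P b d * (contrSnd F n d * Y b c) := by
    simp only [sum_n_mul_raiseSnd_of_antisymm hF, neg_mul, Finset.sum_neg_distrib, Finset.sum_mul,
      mul_assoc]
  rw [e1, e2, e3, sum_raiseSnd_diag_eq_zero hP hF, sum_covVec_diag hP hU hF hDn,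
    contrSnd_eq_sum_n_mul hY]
  ring

/-- Again the `P`-raised `F` from `∇°P` is compensated by the one in `∇°n`. -/
theorem sum_covBiv_grad (hP : ∀ a b, P a b = P b a) (hY : ∀ a b, Y a b = Y b a)
    (hU : ∀ a b, U a b = U b a)
    (hDn : ∀ a c, Dn a c = -n2 * raiseSnd P F a c + raiseSnd P U a c - n c * contrSnd F n a
      - n2 * n c * dl a)
    (hDP : ∀ a b c, DP a b c = -(n c * raiseSnd P F a b + n b * raiseSnd P F a c)
      - n b * n c * dl a)
    (hDM : ∀ a b d, DM a b d = dn2 a * P b d + n2 * DP a b d - (Dn a b * n d + n b * Dn a d))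
    (c : Fin m) :
    ∑ b, ∑ d, DM c b d * Y b d = dn2 c * (∑ b, ∑ d, P b d * Y d b)
      - 2 * (∑ b, ∑ d, P b d * (contrSnd Y n d * U b c))
      + 2 * (∑ b, n b * contrSnd Y n b) * contrSnd F n c
      + n2 * (∑ b, n b * contrSnd Y n b) * dl c := by
  have hv (v : Fin m → ℝ) : ∑ b, ∑ d, v b * n d * Y b d = ∑ b, v b * contrSnd Y n b := by
    simp only [contrSnd, Finset.mul_sum]
    exact Finset.sum_congr rfl fun b _ => Finset.sum_congr rfl fun d _ => by ring
  have hv' (v : Fin m → ℝ) : ∑ b, ∑ d, n b * v d * Y b d = ∑ b, v b * contrSnd Y n b := by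
    rw [← hv, Finset.sum_comm]
    exact Finset.sum_congr rfl fun b _ => Finset.sum_congr rfl fun d _ => by rw [hY d b]; ring
  have e1 : ∑ b, ∑ d, DM c b d * Y b d = dn2 c * (∑ b, ∑ d, P b d * Y d b)
      - (∑ b, ∑ d, (n2 * raiseSnd P F c b + Dn c b) * n d * Y b d)
      - (∑ b, ∑ d, n b * (n2 * raiseSnd P F c d + Dn c d) * Y b d)
      - n2 * dl c * (∑ b, ∑ d, n b * n d * Y b d) := by
    simp only [hDM, hDP, Finset.mul_sum, ← Finset.sum_sub_distrib]
    exact Finset.sum_congr rfl fun b _ => Finset.sum_congr rfl fun d _ => by rw [hY d b]; ring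
  have e2 : ∑ b, (n2 * raiseSnd P F c b + Dn c b) * contrSnd Y n b =
      (∑ b, raiseSnd P U c b * contrSnd Y n b)
      - contrSnd F n c * (∑ b, n b * contrSnd Y n b)
      - n2 * dl c * (∑ b, n b * contrSnd Y n b) := by
    simp only [hDn, Finset.mul_sum, ← Finset.sum_sub_distrib]
    exact Finset.sum_congr rfl fun b _ => by ring
  have e3 : ∑ b, raiseSnd P U c b * contrSnd Y n b =
      ∑ b, ∑ d, P b d * (contrSnd Y n d * U b c) := by
    rw [Finset.sum_comm]
    simp only [raiseSnd, Finset.sum_mul]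
    exact Finset.sum_congr rfl fun b _ => Finset.sum_congr rfl fun d _ => by
      rw [hP b d, hU c d]; ring
  rw [e1, hv, hv', hv, e2, e3]
  ring

theorem sum_flux_gradient (hY : ∀ a b, Y a b = Y b a) (hU : ∀ a b, U a b = U b a)
    (hF : ∀ a b, F a b = -F b a) (c : Fin m) :
    ∑ b, ∑ d, (n2 * P b d - n b * n d) *
          ((1 / 2) * (U b c + n2 * Y b c) * dl d - (1 / 2) * (U b d + n2 * Y b d) * dl c
            + ∑ f, (Y b c * F d f - Y b d * F c f) * n f) =
      (1 / 2) * n2 * ((∑ b, ∑ d, P b d * (dl d * U b c)) + n2 * ∑ b, ∑ d, P b d * (dl d * Y b c))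
      - (1 / 2) * (∑ d, n d * dl d) * (contrSnd U n c + n2 * contrSnd Y n c)
      - (1 / 2) * dl c * (n2 * ((∑ b, ∑ d, P b d * U d b) + n2 * ∑ b, ∑ d, P b d * Y d b)
        - (∑ b, n b * contrSnd U n b) - n2 * ∑ b, n b * contrSnd Y n b)
      + n2 * (∑ b, ∑ d, P b d * (contrSnd F n d * Y b c))
      - n2 * (∑ b, ∑ d, P b d * Y d b) * contrSnd F n c
      + (∑ b, n b * contrSnd Y n b) * contrSnd F n c := by
  have hf (b d : Fin m) : ∑ f, (Y b c * F d f - Y b d * F c f) * n f =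
      Y b c * contrSnd F n d - Y b d * contrSnd F n c := by
    simp only [contrSnd, Finset.mul_sum, ← Finset.sum_sub_distrib]
    exact Finset.sum_congr rfl fun f _ => by ring
  have e1 : ∑ b, ∑ d, (n2 * P b d - n b * n d) *
          ((1 / 2) * (U b c + n2 * Y b c) * dl d - (1 / 2) * (U b d + n2 * Y b d) * dl c
            + ∑ f, (Y b c * F d f - Y b d * F c f) * n f) =
      (1 / 2) * n2 * ((∑ b, ∑ d, P b d * (dl d * U b c)) + n2 * ∑ b, ∑ d, P b d * (dl d * Y b c))
      - (1 / 2) * ((∑ b, ∑ d, n b * n d * (U b c * dl d))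
        + n2 * ∑ b, ∑ d, n b * n d * (Y b c * dl d))
      - (1 / 2) * dl c * (n2 * ((∑ b, ∑ d, P b d * U d b) + n2 * ∑ b, ∑ d, P b d * Y d b))
      + (1 / 2) * ((∑ b, ∑ d, n b * n d * (U d b * dl c))
        + n2 * ∑ b, ∑ d, n b * n d * (Y d b * dl c))
      + n2 * (∑ b, ∑ d, P b d * (contrSnd F n d * Y b c))
      - n2 * contrSnd F n c * (∑ b, ∑ d, P b d * Y d b)
      - (∑ b, ∑ d, n b * n d * (Y b c * contrSnd F n d))
      + (∑ b, ∑ d, n b * n d * (Y d b * contrSnd F n c)) := by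
    simp only [hf, Finset.mul_sum, ← Finset.sum_add_distrib, ← Finset.sum_sub_distrib]
    exact Finset.sum_congr rfl fun b _ => Finset.sum_congr rfl fun d _ => by
      rw [hY b d, hU b d]; ring
  rw [e1]
  simp only [sum_n_mul_n (fun b => Y b c), sum_n_mul_n (fun b => U b c), sum_n_mul_n_mul_bilin hY,
    sum_n_mul_n_mul_bilin hU, contrSnd_eq_sum_n_mul hY, contrSnd_eq_sum_n_mul hU,
    sum_n_mul_contrSnd_eq_zero hF]
  ring

theorem sum_flux_quadratic (hP : ∀ a b, P a b = P b a) (hY : ∀ a b, Y a b = Y b a)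
    (hU : ∀ a b, U a b = U b a) (c : Fin m) :
    ∑ b, ∑ d, ∑ f, (P b d * n f - P b f * n d) * Y b d * U c f =
      (∑ b, ∑ d, P b d * Y d b) * contrSnd U n c
      - ∑ b, ∑ d, P b d * (contrSnd Y n d * U b c) := by
  have e1 : ∑ b, ∑ d, ∑ f, P b d * n f * Y b d * U c f =
      (∑ b, ∑ d, P b d * Y d b) * contrSnd U n c := by
    simp only [Finset.sum_mul]
    simp only [contrSnd, Finset.mul_sum]
    exact Finset.sum_congr rfl fun b _ => Finset.sum_congr rfl fun d _ =>
      Finset.sum_congr rfl fun f _ => by rw [hY b d]; ring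
  have e2 : ∑ b, ∑ d, ∑ f, P b f * n d * Y b d * U c f =
      ∑ b, ∑ d, P b d * (contrSnd Y n d * U b c) := by
    rw [Finset.sum_comm (γ := Fin m) (f := fun b d => P b d * (contrSnd Y n d * U b c))]
    refine Finset.sum_congr rfl fun b _ => ?_
    rw [Finset.sum_comm]
    refine Finset.sum_congr rfl fun d _ => ?_
    simp only [contrSnd, Finset.sum_mul, Finset.mul_sum]
    exact Finset.sum_congr rfl fun f _ => by rw [hP b d, hU c d]; ring
  rw [← e1, ← e2]
  simp only [sub_mul, Finset.sum_sub_distrib]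

theorem sum_flux_torsion (hU : ∀ a b, U a b = U b a) (c : Fin m) :
    ∑ b, ∑ d, ∑ f, P b d * n f * (U b c * F d f - U b d * F c f) =
      (∑ b, ∑ d, P b d * (contrSnd F n d * U b c))
      - (∑ b, ∑ d, P b d * U d b) * contrSnd F n c := by
  simp only [Finset.sum_mul]
  simp only [contrSnd, Finset.sum_mul, Finset.mul_sum, ← Finset.sum_sub_distrib]
  exact Finset.sum_congr rfl fun b _ => Finset.sum_congr rfl fun d _ =>
      Finset.sum_congr rfl fun f _ => by rw [hU b d]; ring

end Flux

/-! ### The energy flux in coordinates -/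

section FluxCoordinates

theorem curvatureCoeff_swap {k : ℕ}
    (C : EuclideanSpace ℝ (Fin k) → Fin k → Fin k → Fin k → ℝ)
    (x : EuclideanSpace ℝ (Fin k)) (a b c d : Fin k) :
    curvatureCoeff C x a b d c = -curvatureCoeff C x a b c d := by
  simp only [curvatureCoeff, Finset.sum_sub_distrib]
  ring

variable {m : ℕ} {S M : Type*}
  [TopologicalSpace S] [ChartedSpace (EuclideanSpace ℝ (Fin m)) S]
  [TopologicalSpace M] [ChartedSpace (EuclideanSpace ℝ (Fin (m + 1))) M]
  [IsManifold (𝓡 (m + 1)) ∞ M]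
  {φ : OpenPartialHomeomorph S (EuclideanSpace ℝ (Fin m))} {x : EuclideanSpace ℝ (Fin m)}
  {g : SpacetimeMetric m M} {D : HypersurfaceData m S} {Φ : S → M}
  {l : ∀ p : S, TangentSpace (𝓡 (m + 1)) (Φ p)}
  {ν : TangentSpace (𝓡 (m + 1)) (Φ (φ.symm x)) →L[ℝ] ℝ}

/-- The Codazzi contraction lacks a multiple of `∇°Y` along `n^b n^d`, which the lowered row
supplies; together they give the divergence with `n⁽²⁾ P^bd - n^b n^d`. -/
theorem HypersurfaceData.IsEmbedded.einstein_tangent_coord (hD : D.IsEmbedded g Φ l)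
    (hφ : φ ∈ IsManifold.maximalAtlas (𝓡 m) ∞ S) (hx : x ∈ φ.target)
    (hν : IsNormalForm Φ l (φ.symm x) ν)
    {P Y F U : Fin m → Fin m → ℝ} {n ℓ dl : Fin m → ℝ} {n2 l2 : ℝ}
    {DU : Fin m → Fin m → Fin m → ℝ} {R : Fin m → Fin m → Fin m → Fin m → ℝ}
    (hP : P = D.PComp φ x) (hn : n = D.nComp φ x) (hn2 : n2 = D.n2Comp φ x)
    (hℓ : ℓ = formComp D.ell φ x) (hl2 : l2 = D.ell2 (φ.symm x)) (hdl : dl = D.dell2Comp φ x)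
    (hY : Y = bilinComp D.Y φ x) (hF : F = D.FComp φ x) (hU : U = D.UComp φ x)
    (hDU : DU = D.covBilin φ (D.UComp φ) x) (hR : R = curvatureCoeff (D.conn φ) x) (c : Fin m) :
    g.einstein (Φ (φ.symm x)) ν
      (mfderiv (𝓡 m) (𝓡 (m + 1)) Φ (φ.symm x) (coordVec φ (φ.symm x) c)) =
      - (∑ a, ∑ b, ∑ d, ℓ a * R a b c d * n b * n d)
      + (∑ f, D.covEnd φ (D.divTensorComp φ) x f f c)
      + (∑ b, ∑ d, (P b d - l2 * n b * n d) * (DU d b c - DU c b d))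
      + (∑ b, ∑ d, (n2 * P b d - n b * n d) *
          ((1 / 2) * (U b c + n2 * Y b c) * dl d - (1 / 2) * (U b d + n2 * Y b d) * dl c
            + ∑ f, (Y b c * F d f - Y b d * F c f) * n f))
      + (∑ b, ∑ d, ∑ f, (P b d * n f - P b f * n d) * Y b d * U c f)
      + (∑ b, ∑ d, ∑ f, P b d * n f * (U b c * F d f - U b d * F c f)) := by
  have sP : ∀ a b, P a b = P b a := by subst hP; exact D.PComp_symm
  have sY : ∀ a b, Y a b = Y b a := by subst hY; exact D.YComp_symm
  have sU : ∀ a b, U a b = U b a := by subst hU; exact D.UComp_symm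
  have sF : ∀ a b, F a b = -F b a := by subst hF; exact D.FComp_antisymm
  have sDU : ∀ a b c, DU a b c = DU a c b := by
    subst hDU; exact D.covBilin_symm fun y => D.UComp_symm
  obtain ⟨DY, hDY⟩ : ∃ DY, DY = D.covBilin φ (bilinComp D.Y φ) x := ⟨_, rfl⟩
  have sDY : ∀ a b c, DY a b c = DY a c b := by
    subst hDY; exact D.covBilin_symm fun y => D.YComp_symm
  obtain ⟨Dn, hDn⟩ : ∃ Dn, Dn = D.covVec φ (D.nComp φ) x := ⟨_, rfl⟩
  obtain ⟨DP, hDP⟩ : ∃ DP, DP = D.covBiv φ (D.PComp φ) x := ⟨_, rfl⟩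
  obtain ⟨dn2, hdn2⟩ : ∃ dn2, dn2 = fun a => pd (D.n2Comp φ) a x := ⟨_, rfl⟩
  obtain ⟨M, hM⟩ : ∃ M, M = fun y b d =>
    D.n2Comp φ y * D.PComp φ y b d - D.nComp φ y b * D.nComp φ y d := ⟨_, rfl⟩
  obtain ⟨DM, hDM⟩ : ∃ DM, DM = D.covBiv φ M x := ⟨_, rfl⟩
  have eDn (a c) : Dn a c = -n2 * raiseSnd P F a c + raiseSnd P U a c - n c * contrSnd F n a
      - n2 * n c * dl a := by
    subst hDn hP hn hn2 hF hU hdl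
    exact D.covVec_nComp hφ hx a c
  have eDP (a b c) : DP a b c = -(n c * raiseSnd P F a b + n b * raiseSnd P F a c)
      - n b * n c * dl a := by
    subst hDP hP hn hF hdl
    exact D.covBiv_PComp hφ hx a b c
  have eDM (a b d) : DM a b d = dn2 a * P b d + n2 * DP a b d - (Dn a b * n d + n b * Dn a d) := by
    subst hDM hM hdn2 hP hn2 hDP hDn hn
    exact D.covBiv_n2_mul_P_sub hφ hx a b d
  have edn2 (a) : dn2 a = 2 * contrSnd U n a - 2 * n2 * contrSnd F n a - n2 ^ 2 * dl a := by
    subst hdn2 hU hn hn2 hF hdl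
    exact D.pd_n2Comp hφ hx a
  have eχ (a) : frameConn (D.coordMat φ) (bilinComp D.Y φ) a x (Sum.inr ()) (Sum.inr ()) =
      contrSnd F n a + contrSnd Y n a + (1 / 2) * n2 * dl a := by
    subst hF hn hY hn2 hdl
    exact D.frameConn_inr_inr' a
  have ek (a) : contrSnd (D.KComp φ x) (D.nComp φ x) a =
      contrSnd U n a + n2 * contrSnd Y n a := by
    subst hU hn hY hn2
    simp only [contrSnd, KComp, Finset.mul_sum, ← Finset.sum_add_distrib]
    exact Finset.sum_congr rfl fun f _ => by ring
  have eK (a b) : D.KComp φ x a b = U a b + n2 * Y a b := by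
    subst hU hn2 hY
    rfl
  rw [hD.einstein_tangent hφ hx hν]
  have h1 := sum_codazzi (P := P) (n := n) (dl := dl) (dn2 := dn2) (F := F) sY sU sDY sDU c
    (contrSnd (D.KComp φ x) (D.nComp φ x))
    (fun a => frameConn (D.coordMat φ) (bilinComp D.Y φ) a x (Sum.inr ()) (Sum.inr ()))
    (D.KComp φ x) ek eχ eK
  have h2 := sum_lowered_codazzi (n := n) (dl := dl) (n2 := n2) (l2 := l2) sY sU sF sDY sDU
    (fun b d => ∑ a, ℓ a * R a b d c) c
  have h3 := sum_covBiv_div sP sY sU sF eDn eDP eDM c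
  have h4 := sum_covBiv_grad sP sY sU eDn eDP eDM c
  have h5 := sum_flux_gradient (P := P) (n := n) (dl := dl) (n2 := n2) sY sU sF c
  have h6 := sum_flux_quadratic (n := n) sP sY sU c
  have h7 := sum_flux_torsion (P := P) (n := n) (F := F) sU c
  -- The stated formula has the free index third, the flux contraction has it last; exchanging them
  -- gives the sign.
  have h8 : ∑ a, ∑ b, ∑ d, ℓ a * R a b c d * n b * n d =
      -∑ b, ∑ d, n b * n d * ∑ a, ℓ a * R a b d c := by
    simp only [Finset.mul_sum, ← Finset.sum_neg_distrib]
    rw [Finset.sum_comm]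
    refine Finset.sum_congr rfl fun b _ => ?_
    rw [Finset.sum_comm]
    exact Finset.sum_congr rfl fun d _ => Finset.sum_congr rfl fun a _ => by
      rw [hR, curvatureCoeff_swap _ _ a b c d]; ring
  have h9 : ∑ b, ∑ d, D.PComp φ x b d * D.frameCurvature φ x d c (Sum.inr ()) (Sum.inl b) =
      ∑ b, ∑ d, P b d * (-(DU d c b - DU c d b) - (dn2 d * Y c b - dn2 c * Y d b)
        - n2 * (DY d c b - DY c d b) + (contrSnd (D.KComp φ x) (D.nComp φ x) d * Y c b
          - contrSnd (D.KComp φ x) (D.nComp φ x) c * Y d b)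
        - (frameConn (D.coordMat φ) (bilinComp D.Y φ) d x (Sum.inr ()) (Sum.inr ()) * D.KComp φ x c b
          - frameConn (D.coordMat φ) (bilinComp D.Y φ) c x (Sum.inr ()) (Sum.inr ())
            * D.KComp φ x d b)) := by
    subst hP hDU hdn2 hY hDY hn2
    simp only [D.frameCurvature_inr_inl hφ hx]
  have h10 : ∑ b, ∑ d, D.nComp φ x b * D.nComp φ x d
        * (D.coordMat φ x * D.frameCurvature φ x d c) (Sum.inr ()) (Sum.inl b) =
      ∑ b, ∑ d, n b * n d * ((∑ a, ℓ a * R a b d c) - (DY d c b - DY c d b)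
      - l2 * (DU d c b - DU c d b)
      + (1 / 2) * ((n2 * Y c b - U c b) * dl d - (n2 * Y d b - U d b) * dl c)
      + (Y c b * (contrSnd F n d + contrSnd Y n d)
        - Y d b * (contrSnd F n c + contrSnd Y n c))) := by
    subst hR hY hDY hn hDU hU hF hdl hn2 hl2 hℓ
    simp only [D.coordMat_mul_frameCurvature hφ hx]
  have h11 : ∑ f, D.covEnd φ (D.divTensorComp φ) x f f c =
      (∑ b, ∑ d, DM d b d * Y b c) - (∑ b, ∑ d, DM c b d * Y b d)
      + n2 * (∑ b, ∑ d, P b d * (DY d b c - DY c b d))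
      - ∑ b, ∑ d, n b * n d * (DY d b c - DY c b d) := by
    rw [D.sum_covEnd_divTensorComp hφ hx M hM, ← hDM, ← hDY, ← hY]
    have hMx (b d) : M x b d = n2 * P b d - n b * n d := by subst hM hn2 hn hP; rfl
    simp only [hMx, Finset.mul_sum, ← Finset.sum_add_distrib, ← Finset.sum_sub_distrib]
    exact Finset.sum_congr rfl fun b _ => Finset.sum_congr rfl fun d _ => by ring
  have h12 : ∑ b, ∑ d, (P b d - l2 * n b * n d) * (DU d b c - DU c b d) =
      (∑ b, ∑ d, P b d * (DU d b c - DU c b d))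
      - l2 * ∑ b, ∑ d, n b * n d * (DU d b c - DU c b d) := by
    simp only [Finset.mul_sum, ← Finset.sum_sub_distrib]
    exact Finset.sum_congr rfl fun b _ => Finset.sum_congr rfl fun d _ => by ring
  -- The summed `dn⁽²⁾` terms agree on both sides, so its formula is needed only for the free index
  -- `c`.
  rw [h9, h1, h10, h2, h11, h3, h4, h5, h6, h7, h8, h12, ek, eχ, edn2 c]
  ring

end FluxCoordinates

/-! ### Change of basis for arrays of components

The new basis is `e_a = A^i_a ∂_i`, with `A^i_a` written `A i a`; primed arrays are the components in
the new basis. -/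

section ChangeOfBasis

variable {m : ℕ}

/-- The covector `v` has components `v'` in the new basis. -/
def IsPull₁ (A : Fin m → Fin m → ℝ) (v v' : Fin m → ℝ) : Prop :=
  ∀ a, v' a = ∑ i, A i a * v i

/-- The covariant two-tensor `T` has components `T'` in the new basis. -/
def IsPull₂ (A : Fin m → Fin m → ℝ) (T T' : Fin m → Fin m → ℝ) : Prop :=
  ∀ a b, T' a b = ∑ i, ∑ j, A i a * A j b * T i j

/-- The covariant three-tensor `X` has components `X'` in the new basis. -/
def IsPull₃ (A : Fin m → Fin m → ℝ) (X X' : Fin m → Fin m → Fin m → ℝ) : Prop :=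
  ∀ a b c, X' a b c = ∑ i, ∑ j, ∑ k, A i a * A j b * A k c * X i j k

/-- The vector `n` has components `w` in the new basis. -/
def IsPush₁ (A : Fin m → Fin m → ℝ) (n w : Fin m → ℝ) : Prop :=
  ∀ i, n i = ∑ a, A i a * w a

/-- The contravariant two-tensor `Q` has components `Q'` in the new basis. -/
def IsPush₂ (A : Fin m → Fin m → ℝ) (Q Q' : Fin m → Fin m → ℝ) : Prop :=
  ∀ i j, Q i j = ∑ a, ∑ b, A i a * A j b * Q' a b

variable {A : Fin m → Fin m → ℝ} {v v' w w' n n' : Fin m → ℝ} {T T' W W' Q Q' : Fin m → Fin m → ℝ}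
  {X X' Z Z' : Fin m → Fin m → Fin m → ℝ}

theorem IsPull₁.add (hv : IsPull₁ A v v') (hw : IsPull₁ A w w') :
    IsPull₁ A (fun i => v i + w i) (fun a => v' a + w' a) := fun a => by
  simp only [hv a, hw a, mul_add, Finset.sum_add_distrib]

theorem IsPull₁.const_mul (hv : IsPull₁ A v v') (s : ℝ) :
    IsPull₁ A (fun i => s * v i) (fun a => s * v' a) := fun a => by
  simp only [hv a, Finset.mul_sum, mul_left_comm s]

theorem IsPull₂.add (hT : IsPull₂ A T T') (hW : IsPull₂ A W W') :
    IsPull₂ A (fun i j => T i j + W i j) (fun a b => T' a b + W' a b) := fun a b => by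
  simp only [hT a b, hW a b, mul_add, Finset.sum_add_distrib]

theorem IsPull₂.sub (hT : IsPull₂ A T T') (hW : IsPull₂ A W W') :
    IsPull₂ A (fun i j => T i j - W i j) (fun a b => T' a b - W' a b) := fun a b => by
  simp only [hT a b, hW a b, mul_sub, Finset.sum_sub_distrib]

theorem IsPull₂.const_mul (hT : IsPull₂ A T T') (s : ℝ) :
    IsPull₂ A (fun i j => s * T i j) (fun a b => s * T' a b) := fun a b => by
  simp only [hT a b, Finset.mul_sum, mul_left_comm s]

theorem IsPull₂.swap (hT : IsPull₂ A T T') :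
    IsPull₂ A (fun i j => T j i) (fun a b => T' b a) := fun a b => by
  beta_reduce
  rw [hT b a, Finset.sum_comm]
  exact Finset.sum_congr rfl fun i _ => Finset.sum_congr rfl fun j _ => by ring

theorem IsPull₃.add (hX : IsPull₃ A X X') (hZ : IsPull₃ A Z Z') :
    IsPull₃ A (fun i j k => X i j k + Z i j k) (fun a b c => X' a b c + Z' a b c) := fun a b c => by
  simp only [hX a b c, hZ a b c, mul_add, Finset.sum_add_distrib]

theorem IsPull₃.sub (hX : IsPull₃ A X X') (hZ : IsPull₃ A Z Z') :
    IsPull₃ A (fun i j k => X i j k - Z i j k) (fun a b c => X' a b c - Z' a b c) := fun a b c => by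
  simp only [hX a b c, hZ a b c, mul_sub, Finset.sum_sub_distrib]

theorem IsPull₃.const_mul (hX : IsPull₃ A X X') (s : ℝ) :
    IsPull₃ A (fun i j k => s * X i j k) (fun a b c => s * X' a b c) := fun a b c => by
  simp only [hX a b c, Finset.mul_sum, mul_left_comm s]

theorem IsPull₃.swap_left (hX : IsPull₃ A X X') :
    IsPull₃ A (fun i j k => X j i k) (fun a b c => X' b a c) := fun a b c => by
  beta_reduce
  rw [hX b a c, Finset.sum_comm]
  exact Finset.sum_congr rfl fun i _ => Finset.sum_congr rfl fun j _ =>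
    Finset.sum_congr rfl fun k _ => by ring

theorem IsPull₃.swap_right (hX : IsPull₃ A X X') :
    IsPull₃ A (fun i j k => X i k j) (fun a b c => X' a c b) := fun a b c => by
  beta_reduce
  rw [hX a c b]
  refine Finset.sum_congr rfl fun i _ => ?_
  rw [Finset.sum_comm]
  exact Finset.sum_congr rfl fun j _ => Finset.sum_congr rfl fun k _ => by ring

theorem IsPull₂.mul (hT : IsPull₂ A T T') (hv : IsPull₁ A v v') :
    IsPull₃ A (fun i j k => T i j * v k) (fun a b c => T' a b * v' c) := fun a b c => by
  beta_reduce
  rw [hT a b, hv c]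
  simp only [Finset.sum_mul]
  simp only [Finset.mul_sum]
  exact Finset.sum_congr rfl fun i _ => Finset.sum_congr rfl fun j _ =>
    Finset.sum_congr rfl fun k _ => by ring

theorem IsPush₂.sub (hQ : IsPush₂ A Q Q') (hW : IsPush₂ A W W') :
    IsPush₂ A (fun i j => Q i j - W i j) (fun a b => Q' a b - W' a b) := fun i j => by
  simp only [hQ i j, hW i j, mul_sub, Finset.sum_sub_distrib]

theorem IsPush₂.const_mul (hQ : IsPush₂ A Q Q') (s : ℝ) :
    IsPush₂ A (fun i j => s * Q i j) (fun a b => s * Q' a b) := fun i j => by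
  simp only [hQ i j, Finset.mul_sum, mul_left_comm s]

theorem IsPush₁.mul (hn : IsPush₁ A n n') :
    IsPush₂ A (fun i j => n i * n j) (fun a b => n' a * n' b) := fun i j => by
  simp only [hn i, hn j, Finset.sum_mul_sum]
  exact Finset.sum_congr rfl fun a _ => Finset.sum_congr rfl fun b _ => by ring

theorem IsPush₁.contract (hn : IsPush₁ A n n') (hv : IsPull₁ A v v') :
    ∑ a, v' a * n' a = ∑ i, v i * n i := by
  simp only [hv _, hn _, Finset.mul_sum, Finset.sum_mul]
  rw [Finset.sum_comm]
  exact Finset.sum_congr rfl fun a _ => Finset.sum_congr rfl fun i _ => by ring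

/-- Freezing one slot at a new basis vector lowers the rank; the contraction rules follow by
reduction to lower rank. -/
theorem IsPull₂.apply_left (hT : IsPull₂ A T T') (a : Fin m) :
    IsPull₁ A (fun j => ∑ i, A i a * T i j) (T' a) := fun b => by
  rw [hT a b, Finset.sum_comm]
  simp only [Finset.mul_sum]
  exact Finset.sum_congr rfl fun i _ => Finset.sum_congr rfl fun j _ => by ring

theorem IsPull₃.apply_left (hX : IsPull₃ A X X') (a : Fin m) :
    IsPull₂ A (fun j k => ∑ i, A i a * X i j k) (X' a) := fun b c => by
  rw [hX a b c, Finset.sum_comm]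
  simp only [Finset.mul_sum]
  refine Finset.sum_congr rfl fun j _ => ?_
  rw [Finset.sum_comm]
  exact Finset.sum_congr rfl fun k _ => Finset.sum_congr rfl fun i _ => by ring

theorem IsPush₁.contract₂ (hn : IsPush₁ A n n') (hT : IsPull₂ A T T') :
    IsPull₁ A (contrSnd T n) (contrSnd T' n') := fun a => by
  rw [contrSnd, hn.contract (hT.apply_left a)]
  simp only [contrSnd, Finset.mul_sum, Finset.sum_mul]
  rw [Finset.sum_comm]
  exact Finset.sum_congr rfl fun i _ => Finset.sum_congr rfl fun j _ => by ring

theorem IsPush₁.contract₃ (hn : IsPush₁ A n n') (hX : IsPull₃ A X X') :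
    IsPull₂ A (fun i j => ∑ k, X i j k * n k) (fun a b => ∑ c, X' a b c * n' c) := fun a b => by
  have h := hn.contract₂ (hX.apply_left a) b
  rw [contrSnd] at h
  beta_reduce
  rw [h, Finset.sum_comm]
  simp only [contrSnd, Finset.mul_sum, Finset.sum_mul]
  refine Finset.sum_congr rfl fun j _ => ?_
  rw [Finset.sum_comm]
  exact Finset.sum_congr rfl fun k _ => Finset.sum_congr rfl fun i _ => by ring

theorem IsPush₂.contract (hQ : IsPush₂ A Q Q') (hT : IsPull₂ A T T') :
    ∑ a, ∑ b, Q' a b * T' a b = ∑ i, ∑ j, Q i j * T i j := by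
  simp only [hQ _ _, hT _ _, Finset.mul_sum, Finset.sum_mul]
  rw [sum_swap_pairs]
  exact Finset.sum_congr rfl fun a _ => Finset.sum_congr rfl fun b _ =>
    Finset.sum_congr rfl fun i _ => Finset.sum_congr rfl fun j _ => by ring

theorem IsPush₂.contract₃ (hQ : IsPush₂ A Q Q') (hX : IsPull₃ A X X') :
    IsPull₁ A (fun k => ∑ i, ∑ j, Q i j * X i j k) (fun c => ∑ a, ∑ b, Q' a b * X' a b c) :=
  fun c => by
    have h := hQ.contract (hX.swap_right.swap_left.apply_left c)
    beta_reduce at h ⊢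
    rw [h]
    simp only [Finset.mul_sum]
    rw [Finset.sum_congr rfl fun i _ => Finset.sum_comm, Finset.sum_comm]
    exact Finset.sum_congr rfl fun k _ => Finset.sum_congr rfl fun i _ =>
      Finset.sum_congr rfl fun j _ => by ring

theorem IsPush₂.contract_IsPush₁ (hQ : IsPush₂ A Q Q') (hn : IsPush₁ A n n')
    (hX : IsPull₃ A X X') :
    ∑ b, ∑ c, ∑ d, Q' b d * n' c * X' b c d = ∑ b, ∑ c, ∑ d, Q b d * n c * X b c d := by
  have h (Q : Fin m → Fin m → ℝ) (n : Fin m → ℝ) (X : Fin m → Fin m → Fin m → ℝ) :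
       ∑ b, ∑ c, ∑ d, Q b d * n c * X b c d =
      ∑ b, ∑ d, Q b d * ∑ c, X b c d * n c := by
    refine Finset.sum_congr rfl fun b _ => ?_
    rw [Finset.sum_comm]
    simp only [Finset.mul_sum]
    exact Finset.sum_congr rfl fun d _ => Finset.sum_congr rfl fun c _ => by ring
  rw [h, h]
  exact hQ.contract (hn.contract₃ hX.swap_right)

theorem isPull₂_iff : IsPull₂ A T T' ↔
    Matrix.of T' = (Matrix.of A)ᵀ * Matrix.of T * Matrix.of A := by
  rw [← Matrix.ext_iff]
  refine forall_congr' fun a => forall_congr' fun b => ?_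
  simp only [Matrix.mul_apply, Matrix.of_apply, Matrix.transpose_apply, Finset.sum_mul]
  rw [Finset.sum_comm]
  have h : ∑ j, ∑ i, A i a * A j b * T i j = ∑ j, ∑ i, A i a * T i j * A j b :=
    Finset.sum_congr rfl fun j _ => Finset.sum_congr rfl fun i _ => by ring
  rw [h]

theorem isPush₂_iff : IsPush₂ A Q Q' ↔
    Matrix.of Q = Matrix.of A * Matrix.of Q' * (Matrix.of A)ᵀ :=
  isPull₂_iff (A := fun a i => A i a)

/-- In matrix form the tensor is `T Qᵀ T`, and the congruences by `A` compose. -/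
theorem IsPush₂.sandwich (hQ : IsPush₂ A Q Q') (hT : IsPull₂ A T T') :
    IsPull₂ A (fun i j => ∑ c, raiseSnd Q T i c * T c j)
      (fun a b => ∑ c, raiseSnd Q' T' a c * T' c b) := by
  have h (Q T : Fin m → Fin m → ℝ) : Matrix.of (fun i j => ∑ c, raiseSnd Q T i c * T c j) =
      Matrix.of T * (Matrix.of Q)ᵀ * Matrix.of T := by
    ext i j
    simp only [Matrix.mul_apply, Matrix.of_apply, Matrix.transpose_apply, raiseSnd, mul_comm]
  rw [isPull₂_iff, h, h, isPull₂_iff.1 hT, isPush₂_iff.1 hQ]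
  simp only [Matrix.transpose_mul, Matrix.transpose_transpose, Matrix.mul_assoc]

/-- Basis independence of a trace; `A'` will be the matrix of the dual basis. -/
theorem sum_trace {A' : Fin m → Fin m → ℝ}
    (hA : ∀ i j, ∑ a, A i a * A' a j = if i = j then 1 else 0) (G : Fin m → Fin m → ℝ) :
    ∑ a, ∑ i, ∑ j, G i j * A i a * A' a j = ∑ i, G i i := by
  rw [Finset.sum_comm]
  refine Finset.sum_congr rfl fun i _ => ?_
  rw [Finset.sum_comm]
  have h (j : Fin m) : ∑ a, G i j * A i a * A' a j = G i j * if i = j then 1 else 0 := by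
    rw [← hA, Finset.mul_sum]
    exact Finset.sum_congr rfl fun a _ => by ring
  simp [h]

end ChangeOfBasis

/-! ### Components of the hypersurface data in an arbitrary basis -/

section DataChangeOfBasis

variable {m : ℕ} {S : Type*} [TopologicalSpace S] [ChartedSpace (EuclideanSpace ℝ (Fin m)) S]
  {φ : OpenPartialHomeomorph S (EuclideanSpace ℝ (Fin m))} {x : EuclideanSpace ℝ (Fin m)}

/-- The matrix of a family of vectors with respect to the coordinate basis of a chart. -/
def basisMat (φ : OpenPartialHomeomorph S (EuclideanSpace ℝ (Fin m))) (p : S)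
    (e : Fin m → TangentSpace (𝓡 m) p) (i a : Fin m) : ℝ := vecComp φ p (e a) i

theorem isPull₁_form (hφ : φ ∈ IsManifold.maximalAtlas (𝓡 m) ∞ S) (hx : x ∈ φ.target)
    (α : TangentSpace (𝓡 m) (φ.symm x) →ₗ[ℝ] ℝ) (e : Fin m → TangentSpace (𝓡 m) (φ.symm x)) :
    IsPull₁ (basisMat φ _ e) (fun i => α (coordVec φ (φ.symm x) i)) (fun a => α (e a)) :=
  fun a => form_apply_eq_sum hφ (φ.map_target hx) α (e a)

theorem isPull₂_bilin (hφ : φ ∈ IsManifold.maximalAtlas (𝓡 m) ∞ S) (hx : x ∈ φ.target)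
    (T : ∀ q : S, TangentSpace (𝓡 m) q →L[ℝ] TangentSpace (𝓡 m) q →L[ℝ] ℝ)
    (e : Fin m → TangentSpace (𝓡 m) (φ.symm x)) :
    IsPull₂ (basisMat φ _ e) (bilinComp T φ x) (fun a b => T (φ.symm x) (e a) (e b)) :=
  fun a b => by
    beta_reduce
    rw [bilin_apply_eq_sum hφ (φ.map_target hx), φ.right_inv hx]
    exact Finset.sum_congr rfl fun i _ => Finset.sum_congr rfl fun j _ => by
      simp only [basisMat]; ring

theorem mfderiv_coordVec_eq_pd (hφ : φ ∈ IsManifold.maximalAtlas (𝓡 m) ∞ S) (hx : x ∈ φ.target)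
    {f : S → ℝ} (hf : MDifferentiableAt (𝓡 m) 𝓘(ℝ, ℝ) f (φ.symm x)) (a : Fin m) :
    mfderiv (𝓡 m) 𝓘(ℝ, ℝ) f (φ.symm x) (coordVec φ (φ.symm x) a) =
      pd (fun y => f (φ.symm y)) a x := by
  have h1 : MDifferentiableAt (𝓡 m) (𝓡 m) φ.symm x :=
    (mdifferentiable_of_mem_maximalAtlas hφ).mdifferentiableAt_symm hx
  rw [coordVec_symm hφ hx, pd, ← mfderiv_eq_fderiv]
  exact (DFunLike.congr_fun (mfderiv_comp x hf h1) _).symm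

theorem sum_basisMat_mul_coord (hφ : φ ∈ IsManifold.maximalAtlas (𝓡 m) ∞ S) (hx : x ∈ φ.target)
    (e : Basis (Fin m) ℝ (TangentSpace (𝓡 m) (φ.symm x))) (i j : Fin m) :
    ∑ a, basisMat φ _ e i a * e.coord a (coordVec φ (φ.symm x) j) = if i = j then 1 else 0 := by
  rw [← vecComp_coordVec hφ (φ.map_target hx)]
  have h := congrArg ((coordBasis hφ (φ.map_target hx)).coord i)
    (e.sum_repr (coordVec φ (φ.symm x) j))
  rw [map_sum] at h
  refine Eq.trans (Finset.sum_congr rfl fun a _ => ?_) h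
  rw [map_smul, smul_eq_mul, mul_comm]
  rfl

namespace MetricHypersurfaceData

variable (D : MetricHypersurfaceData m S)

theorem isPull₁_dell2 (hφ : φ ∈ IsManifold.maximalAtlas (𝓡 m) ∞ S) (hx : x ∈ φ.target)
    (e : Fin m → TangentSpace (𝓡 m) (φ.symm x)) :
    IsPull₁ (basisMat φ _ e) (fun a => pd (fun y => D.ell2 (φ.symm y)) a x)
      (fun a => mfderiv (𝓡 m) 𝓘(ℝ, ℝ) D.ell2 (φ.symm x) (e a)) := by
  have hf : MDifferentiableAt (𝓡 m) 𝓘(ℝ, ℝ) D.ell2 (φ.symm x) :=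
    D.ell2_contMDiff.contMDiffAt.mdifferentiableAt (by norm_num)
  simp only [← mfderiv_coordVec_eq_pd hφ hx hf]
  exact fun a => form_apply_eq_sum hφ (φ.map_target hx)
    (mfderiv (𝓡 m) 𝓘(ℝ, ℝ) D.ell2 (φ.symm x)).toLinearMap (e a)

theorem isPull₂_F (hx : x ∈ φ.target) (e : Fin m → TangentSpace (𝓡 m) (φ.symm x)) :
    IsPull₂ (basisMat φ _ e) (D.FComp φ x) (fun a b => D.F φ (φ.symm x) (e a) (e b)) :=
  fun a b => by
    simp only [F, φ.right_inv hx, basisMat]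
    exact Finset.sum_congr rfl fun i _ => Finset.sum_congr rfl fun j _ => by ring

theorem isPull₂_U (hx : x ∈ φ.target) (e : Fin m → TangentSpace (𝓡 m) (φ.symm x)) :
    IsPull₂ (basisMat φ _ e) (D.UComp φ x) (fun a b => D.U φ (φ.symm x) (e a) (e b)) :=
  fun a b => by
    simp only [U, φ.right_inv hx, basisMat]
    exact Finset.sum_congr rfl fun i _ => Finset.sum_congr rfl fun j _ => by ring

theorem isPull₃_covU (hx : x ∈ φ.target) (e : Fin m → TangentSpace (𝓡 m) (φ.symm x)) :
    IsPull₃ (basisMat φ _ e) (D.covBilin φ (D.UComp φ) x)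
      (fun a b c => D.covU φ (φ.symm x) (e a) (e b) (e c)) :=
  fun a b c => by
    simp only [covU, φ.right_inv hx, basisMat]
    exact Finset.sum_congr rfl fun i _ => Finset.sum_congr rfl fun j _ =>
      Finset.sum_congr rfl fun k _ => by ring

/-- The bordered matrix changes by congruence with `diag(A, 1)`, so its inverse changes
contragrediently. This yields the transformation of `P`, `n` and `n⁽²⁾` together. -/
theorem inv_coordMat_eq (hφ : φ ∈ IsManifold.maximalAtlas (𝓡 m) ∞ S) (hx : x ∈ φ.target)
    (e : Basis (Fin m) ℝ (TangentSpace (𝓡 m) (φ.symm x))) :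
    (D.coordMat φ x)⁻¹ =
      Matrix.fromBlocks (Matrix.of (basisMat φ _ e)) 0 0 1 * (D.mat (φ.symm x) e)⁻¹
        * (Matrix.fromBlocks (Matrix.of (basisMat φ _ e)) 0 0 (1 : Matrix Unit Unit ℝ))ᵀ := by
  set B : Matrix (Fin m ⊕ Unit) (Fin m ⊕ Unit) ℝ :=
    Matrix.fromBlocks (Matrix.of (basisMat φ _ e)) 0 0 1 with hB
  have h1 : D.mat (φ.symm x) e = Bᵀ * D.coordMat φ x * B := by
    have hg := isPull₂_iff.1 (isPull₂_bilin hφ hx D.gam e)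
    have hl := isPull₁_form hφ hx (D.ell (φ.symm x) : TangentSpace (𝓡 m) (φ.symm x) →ₗ[ℝ] ℝ) e
    rw [hB, coordMat, mat, mat, Matrix.fromBlocks_transpose, Matrix.fromBlocks_multiply,
      Matrix.fromBlocks_multiply]
    simp only [Matrix.transpose_zero, Matrix.transpose_one, Matrix.zero_mul, Matrix.mul_zero,
      add_zero, zero_add, Matrix.one_mul, Matrix.mul_one]
    congr 1
    · ext a b
      simp only [Matrix.of_apply, Matrix.mul_apply, Matrix.transpose_apply]
      exact hl a
    · ext a b
      simp only [Matrix.of_apply, Matrix.mul_apply]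
      exact (hl b).trans (Finset.sum_congr rfl fun i _ => mul_comm _ _)
  have h2 : B.det ≠ 0 := fun h => D.det_mat_ne_zero e (by rw [h1, Matrix.det_mul, h, mul_zero])
  have h3 : Bᵀ.det ≠ 0 := by rwa [Matrix.det_transpose]
  rw [h1, Matrix.mul_inv_rev, Matrix.mul_inv_rev, Matrix.mul_assoc, Matrix.mul_assoc,
    Matrix.mul_assoc, Matrix.nonsing_inv_mul _ (Ne.isUnit h3), Matrix.mul_one, ← Matrix.mul_assoc,
    Matrix.mul_nonsing_inv _ (Ne.isUnit h2), Matrix.one_mul]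

theorem isPush₂_P (hφ : φ ∈ IsManifold.maximalAtlas (𝓡 m) ∞ S) (hx : x ∈ φ.target)
    (e : Basis (Fin m) ℝ (TangentSpace (𝓡 m) (φ.symm x))) :
    IsPush₂ (basisMat φ _ e) (D.PComp φ x) (D.P (φ.symm x) e) := fun i j => by
  change (D.coordMat φ x)⁻¹ (Sum.inl i) (Sum.inl j) = _
  rw [D.inv_coordMat_eq hφ hx e]
  simp only [Matrix.mul_apply, Fintype.sum_sum_type, Matrix.fromBlocks_transpose,
    Matrix.fromBlocks_apply₁₁, Matrix.fromBlocks_apply₁₂, Matrix.fromBlocks_apply₂₁,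
    Matrix.transpose_apply, Matrix.zero_apply, Matrix.of_apply, zero_mul, mul_zero,
    Finset.sum_const_zero, add_zero, Finset.sum_mul]
  rw [Finset.sum_comm]
  exact Finset.sum_congr rfl fun a _ => Finset.sum_congr rfl fun b _ => by
    rw [P]; ring

theorem isPush₁_n (hφ : φ ∈ IsManifold.maximalAtlas (𝓡 m) ∞ S) (hx : x ∈ φ.target)
    (e : Basis (Fin m) ℝ (TangentSpace (𝓡 m) (φ.symm x))) :
    IsPush₁ (basisMat φ _ e) (D.nComp φ x) (D.n (φ.symm x) e) := fun i => by
  change (D.coordMat φ x)⁻¹ (Sum.inl i) (Sum.inr ()) = _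
  rw [D.inv_coordMat_eq hφ hx e]
  simp [Matrix.mul_apply, Fintype.sum_sum_type, Matrix.fromBlocks_transpose, n]

theorem n2_eq (hφ : φ ∈ IsManifold.maximalAtlas (𝓡 m) ∞ S) (hx : x ∈ φ.target)
    (e : Basis (Fin m) ℝ (TangentSpace (𝓡 m) (φ.symm x))) :
    D.n2 (φ.symm x) e = D.n2Comp φ x := by
  change _ = (D.coordMat φ x)⁻¹ (Sum.inr ()) (Sum.inr ())
  rw [D.inv_coordMat_eq hφ hx e]
  simp [Matrix.mul_apply, Fintype.sum_sum_type, Matrix.fromBlocks_transpose, n2]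

theorem curvature_eq (hx : x ∈ φ.target) (α : TangentSpace (𝓡 m) (φ.symm x) →ₗ[ℝ] ℝ)
    (e : Fin m → TangentSpace (𝓡 m) (φ.symm x)) (b c d : Fin m) :
    D.curvature φ (φ.symm x) α (e b) (e c) (e d) =
      ∑ i, α (coordVec φ (φ.symm x) i) * ∑ j, ∑ k, ∑ l, basisMat φ _ e j b * basisMat φ _ e k c
        * basisMat φ _ e l d * curvatureCoeff (D.conn φ) x i j k l := by
  simp only [curvature, φ.right_inv hx, basisMat, Finset.mul_sum]
  exact Finset.sum_congr rfl fun i _ => Finset.sum_congr rfl fun j _ =>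
    Finset.sum_congr rfl fun k _ => Finset.sum_congr rfl fun l _ => by ring

theorem isPull₃_ell_mul_curvature (hx : x ∈ φ.target)
    (e : Basis (Fin m) ℝ (TangentSpace (𝓡 m) (φ.symm x))) :
    IsPull₃ (basisMat φ _ e)
      (fun b c d => ∑ a, formComp D.ell φ x a * curvatureCoeff (D.conn φ) x a b c d)
      (fun b c d => ∑ a, D.ell (φ.symm x) (e a)
        * D.curvature φ (φ.symm x) (e.coord a) (e b) (e c) (e d)) := fun b c d => by
  -- Expansion in the dual basis removes `e` from the contracted upper index.
  have h (i : Fin m) : ∑ a, D.ell (φ.symm x) (e a) * e.coord a (coordVec φ (φ.symm x) i) =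
      formComp D.ell φ x i := by
    have h := congrArg (D.ell (φ.symm x)) (e.sum_repr (coordVec φ (φ.symm x) i))
    rw [map_sum] at h
    refine Eq.trans (Finset.sum_congr rfl fun a _ => ?_) h
    rw [map_smul, smul_eq_mul, mul_comm]
    rfl
  have h' : ∑ a, D.ell (φ.symm x) (e a)
        * D.curvature φ (φ.symm x) (e.coord a) (e b) (e c) (e d) =
      ∑ i, formComp D.ell φ x i * ∑ j, ∑ k, ∑ l, basisMat φ _ e j b * basisMat φ _ e k c
        * basisMat φ _ e l d * curvatureCoeff (D.conn φ) x i j k l := by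
    simp only [← h, D.curvature_eq hx, Finset.sum_mul]
    rw [Finset.sum_comm]
    refine Finset.sum_congr rfl fun a _ => ?_
    rw [Finset.mul_sum]
    exact Finset.sum_congr rfl fun i _ => (mul_assoc _ _ _).symm
  refine h'.trans ?_
  simp only [Finset.mul_sum]
  rw [Finset.sum_comm]
  refine Finset.sum_congr rfl fun j _ => ?_
  rw [Finset.sum_comm]
  refine Finset.sum_congr rfl fun k _ => ?_
  rw [Finset.sum_comm]
  exact Finset.sum_congr rfl fun l _ => Finset.sum_congr rfl fun i _ => by ring

theorem isPull₂_ricci (hφ : φ ∈ IsManifold.maximalAtlas (𝓡 m) ∞ S) (hx : x ∈ φ.target)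
    (e : Basis (Fin m) ℝ (TangentSpace (𝓡 m) (φ.symm x))) :
    IsPull₂ (basisMat φ _ e)
      (fun b d => ∑ c, curvatureCoeff (D.conn φ) x c b c d)
      (fun b d => ∑ c, D.curvature φ (φ.symm x) (e.coord c) (e b) (e c) (e d)) := fun b d => by
  have h1 (c : Fin m) : D.curvature φ (φ.symm x) (e.coord c) (e b) (e c) (e d) =
      ∑ k, ∑ i, (∑ j, ∑ l, basisMat φ _ e j b * basisMat φ _ e l d
          * curvatureCoeff (D.conn φ) x i j k l) * basisMat φ _ e k c
        * e.coord c (coordVec φ (φ.symm x) i) := by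
    rw [D.curvature_eq hx, Finset.sum_comm]
    refine Finset.sum_congr rfl fun i _ => ?_
    rw [Finset.sum_comm, Finset.mul_sum]
    simp only [Finset.mul_sum, Finset.sum_mul]
    exact Finset.sum_congr rfl fun k _ => Finset.sum_congr rfl fun j _ =>
      Finset.sum_congr rfl fun l _ => by ring
  -- The trace is over the upper index and the second lower one; the slots `b`, `d` are spectators.
  have h2 := sum_trace (sum_basisMat_mul_coord hφ hx e) fun k i =>
    ∑ j, ∑ l, basisMat φ _ e j b * basisMat φ _ e l d * curvatureCoeff (D.conn φ) x i j k l
  simp only [h1]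
  refine h2.trans ?_
  simp only [Finset.mul_sum]
  rw [Finset.sum_comm]
  refine Finset.sum_congr rfl fun j _ => ?_
  rw [Finset.sum_comm]

end MetricHypersurfaceData

namespace HypersurfaceData

variable (D : HypersurfaceData m S)

theorem sum_covDivField (hφ : φ ∈ IsManifold.maximalAtlas (𝓡 m) ∞ S) (hx : x ∈ φ.target)
    (e : Basis (Fin m) ℝ (TangentSpace (𝓡 m) (φ.symm x))) :
    ∑ d, D.covDivField φ (φ.symm x) (e d) (e.coord d) =
      ∑ d, D.covVec φ (D.divFieldComp φ) x d d := by
  simp only [covDivField, φ.right_inv hx]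
  exact sum_trace (sum_basisMat_mul_coord hφ hx e) _

theorem isPull₁_covDivTensor (hφ : φ ∈ IsManifold.maximalAtlas (𝓡 m) ∞ S) (hx : x ∈ φ.target)
    (e : Basis (Fin m) ℝ (TangentSpace (𝓡 m) (φ.symm x))) :
    IsPull₁ (basisMat φ _ e) (fun c => ∑ f, D.covEnd φ (D.divTensorComp φ) x f f c)
      (fun c => ∑ f, D.covDivTensor φ (φ.symm x) (e f) (e.coord f) (e c)) := fun c => by
  have h1 (d : Fin m) : D.covDivTensor φ (φ.symm x) (e d) (e.coord d) (e c) =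
      ∑ a, ∑ f, (∑ k, basisMat φ _ e k c * D.covEnd φ (D.divTensorComp φ) x a f k)
        * basisMat φ _ e a d * e.coord d (coordVec φ (φ.symm x) f) := by
    simp only [covDivTensor, φ.right_inv hx, basisMat, Finset.sum_mul]
    exact Finset.sum_congr rfl fun i _ => Finset.sum_congr rfl fun j _ =>
      Finset.sum_congr rfl fun k _ => by ring
  simp only [h1]
  refine (sum_trace (sum_basisMat_mul_coord hφ hx e) _).trans ?_
  simp only [Finset.mul_sum]
  exact Finset.sum_comm

end HypersurfaceData

end DataChangeOfBasis

/-! ### Invariance of the two expressions under a change of basis -/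

section Invariance

variable {m : ℕ} {A P P' Y Y' F F' U U' : Fin m → Fin m → ℝ} {n n' ℓ ℓ' dl dl' : Fin m → ℝ}
  {n2 l2 : ℝ} {DU DU' : Fin m → Fin m → Fin m → ℝ} {R R' : Fin m → Fin m → Fin m → Fin m → ℝ}

/-- Each summand is a complete contraction of tensors. The divergence has its own invariance proof
and enters as the common scalar `s`. -/
theorem rigging_expr_invariant (hP : IsPush₂ A P P') (hn : IsPush₁ A n n')
    (hdl : IsPull₁ A dl dl') (hY : IsPull₂ A Y Y') (hF : IsPull₂ A F F') (hU : IsPull₂ A U U')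
    (hDU : IsPull₃ A DU DU')
    (hR : IsPull₂ A (fun b d => ∑ c, R c b c d) (fun b d => ∑ c, R' c b c d))
    (hℓR : IsPull₃ A (fun b c d => ∑ a, ℓ a * R a b c d) (fun b c d => ∑ a, ℓ' a * R' a b c d))
    (sP : ∀ a b, P a b = P b a) (sP' : ∀ a b, P' a b = P' b a)
    (sY : ∀ a b, Y a b = Y b a) (sY' : ∀ a b, Y' a b = Y' b a) (s : ℝ) :
      (1 / 2) * (∑ b, ∑ c, ∑ d, R' c b c d * P' b d)
      + (1 / 2) * (∑ a, ∑ b, ∑ c, ∑ d, ℓ' a * R' a b c d * P' b d * n' c)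
      + s
      + (1 / 2) * n2 * (∑ a, ∑ b, ∑ c, ∑ d,
          P' b d * P' a c * (Y' b c * Y' d a - Y' b d * Y' c a))
      + (1 / 2) * (∑ b, ∑ c, ∑ d, (P' b d * n' c - P' b c * n' d) *
          (l2 * DU' d b c + (U' b c + n2 * Y' b c) * dl' d
            + 2 * Y' b c * ∑ f, (F' d f - Y' d f) * n' f)) =
      (1 / 2) * (∑ b, ∑ c, ∑ d, R c b c d * P b d)
      + (1 / 2) * (∑ a, ∑ b, ∑ c, ∑ d, ℓ a * R a b c d * P b d * n c)
      + s
      + (1 / 2) * n2 * (∑ a, ∑ b, ∑ c, ∑ d,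
          P b d * P a c * (Y b c * Y d a - Y b d * Y c a))
      + (1 / 2) * (∑ b, ∑ c, ∑ d, (P b d * n c - P b c * n d) *
          (l2 * DU d b c + (U b c + n2 * Y b c) * dl d
            + 2 * Y b c * ∑ f, (F d f - Y d f) * n f)) := by
  have h1 (R : Fin m → Fin m → Fin m → Fin m → ℝ) (P : Fin m → Fin m → ℝ) :
      ∑ b, ∑ c, ∑ d, R c b c d * P b d = ∑ b, ∑ d, P b d * ∑ c, R c b c d := by
    refine Finset.sum_congr rfl fun b _ => ?_
    rw [Finset.sum_comm]
    simp only [Finset.mul_sum, mul_comm]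
  have h2 (ℓ n : Fin m → ℝ) (R : Fin m → Fin m → Fin m → Fin m → ℝ) (P : Fin m → Fin m → ℝ) :
      ∑ a, ∑ b, ∑ c, ∑ d, ℓ a * R a b c d * P b d * n c =
      ∑ b, ∑ c, ∑ d, P b d * n c * ∑ a, ℓ a * R a b c d := by
    simp only [Finset.mul_sum]
    rw [Finset.sum_comm]
    refine Finset.sum_congr rfl fun b _ => ?_
    rw [Finset.sum_comm]
    refine Finset.sum_congr rfl fun c _ => ?_
    rw [Finset.sum_comm]
    exact Finset.sum_congr rfl fun d _ => Finset.sum_congr rfl fun a _ => by ring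
  -- The quadratic term is a trace of `Y P Y` minus the square of the trace of `Y`.
  have h3 (P Y : Fin m → Fin m → ℝ) (sP : ∀ a b, P a b = P b a) (sY : ∀ a b, Y a b = Y b a) :
      ∑ a, ∑ b, ∑ c, ∑ d, P b d * P a c * (Y b c * Y d a - Y b d * Y c a) =
      (∑ b, ∑ d, P b d * ∑ c, raiseSnd P Y d c * Y c b)
      - (∑ b, ∑ d, P b d * Y d b) * ∑ b, ∑ d, P b d * Y d b := by
    rw [sum_quadratic sY sP]
    congr 1
    refine Finset.sum_congr rfl fun b _ => ?_
    rw [Finset.sum_comm]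
    simp only [Finset.mul_sum]
  have h4 (P : Fin m → Fin m → ℝ) (n : Fin m → ℝ) (X : Fin m → Fin m → Fin m → ℝ) :
      ∑ b, ∑ c, ∑ d, (P b d * n c - P b c * n d) * X b c d =
      (∑ b, ∑ c, ∑ d, P b d * n c * X b c d) - ∑ b, ∑ c, ∑ d, P b d * n c * X b d c := by
    simp only [sub_mul, Finset.sum_sub_distrib]
    congr 1
    exact Finset.sum_congr rfl fun b _ => Finset.sum_comm
  have hX : IsPull₃ A (fun b c d => l2 * DU d b c + (U b c + n2 * Y b c) * dl d
        + 2 * Y b c * ∑ f, (F d f - Y d f) * n f)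
      (fun b c d => l2 * DU' d b c + (U' b c + n2 * Y' b c) * dl' d
        + 2 * Y' b c * ∑ f, (F' d f - Y' d f) * n' f) :=
    ((hDU.swap_left.swap_right.const_mul l2).add ((hU.add (hY.const_mul n2)).mul hdl)).add
      ((hY.const_mul 2).mul (hn.contract₂ (hF.sub hY)))
  have e4 := hP.contract (hP.sandwich hY).swap
  have e5 := hP.contract hY.swap
  beta_reduce at e4 e5
  rw [h1, h1, h2, h2, h3 _ _ sP sY, h3 _ _ sP' sY',
    h4 P' n' (fun b c d => l2 * DU' d b c + (U' b c + n2 * Y' b c) * dl' d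
        + 2 * Y' b c * ∑ f, (F' d f - Y' d f) * n' f),
    h4 P n (fun b c d => l2 * DU d b c + (U b c + n2 * Y b c) * dl d
        + 2 * Y b c * ∑ f, (F d f - Y d f) * n f), hP.contract hR, hP.contract_IsPush₁ hn hℓR,
    hP.contract_IsPush₁ hn hX, hP.contract_IsPush₁ hn hX.swap_right, e4, e5]

/-- The divergence again enters as a given covector `s`. The other terms are first rewritten as
contractions covered by the transformation rules. -/
theorem isPull₁_flux_expr (hP : IsPush₂ A P P') (hn : IsPush₁ A n n')
    (hdl : IsPull₁ A dl dl') (hY : IsPull₂ A Y Y') (hF : IsPull₂ A F F') (hU : IsPull₂ A U U')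
    (hDU : IsPull₃ A DU DU')
    (hℓR : IsPull₃ A (fun b c d => ∑ a, ℓ a * R a b c d) (fun b c d => ∑ a, ℓ' a * R' a b c d))
    {s s' : Fin m → ℝ} (hs : IsPull₁ A s s') :
    IsPull₁ A
      (fun c => - (∑ a, ∑ b, ∑ d, ℓ a * R a b c d * n b * n d) + s c
      + (∑ b, ∑ d, (P b d - l2 * n b * n d) * (DU d b c - DU c b d))
      + (∑ b, ∑ d, (n2 * P b d - n b * n d) *
          ((1 / 2) * (U b c + n2 * Y b c) * dl d - (1 / 2) * (U b d + n2 * Y b d) * dl c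
            + ∑ f, (Y b c * F d f - Y b d * F c f) * n f))
      + (∑ b, ∑ d, ∑ f, (P b d * n f - P b f * n d) * Y b d * U c f)
      + (∑ b, ∑ d, ∑ f, P b d * n f * (U b c * F d f - U b d * F c f)))
      (fun c => - (∑ a, ∑ b, ∑ d, ℓ' a * R' a b c d * n' b * n' d) + s' c
      + (∑ b, ∑ d, (P' b d - l2 * n' b * n' d) * (DU' d b c - DU' c b d))
      + (∑ b, ∑ d, (n2 * P' b d - n' b * n' d) *
          ((1 / 2) * (U' b c + n2 * Y' b c) * dl' d - (1 / 2) * (U' b d + n2 * Y' b d) * dl' c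
            + ∑ f, (Y' b c * F' d f - Y' b d * F' c f) * n' f))
      + (∑ b, ∑ d, ∑ f, (P' b d * n' f - P' b f * n' d) * Y' b d * U' c f)
      + (∑ b, ∑ d, ∑ f, P' b d * n' f * (U' b c * F' d f - U' b d * F' c f))) := by
  have h1 (ℓ n : Fin m → ℝ) (R : Fin m → Fin m → Fin m → Fin m → ℝ) (c : Fin m) :
      - (∑ a, ∑ b, ∑ d, ℓ a * R a b c d * n b * n d) =
      -1 * ∑ b, ∑ d, n b * n d * ∑ a, ℓ a * R a b c d := by
    rw [neg_one_mul]
    simp only [Finset.mul_sum]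
    rw [Finset.sum_comm]
    refine congrArg _ (Finset.sum_congr rfl fun b _ => ?_)
    rw [Finset.sum_comm]
    exact Finset.sum_congr rfl fun d _ => Finset.sum_congr rfl fun a _ => by ring
  have h2 (Y F : Fin m → Fin m → ℝ) (n : Fin m → ℝ) (b d c : Fin m) :
      ∑ f, (Y b c * F d f - Y b d * F c f) * n f =
      Y b c * contrSnd F n d - Y b d * contrSnd F n c := by
    simp only [contrSnd, Finset.mul_sum, ← Finset.sum_sub_distrib]
    exact Finset.sum_congr rfl fun f _ => by ring
  have h3 (P Y U : Fin m → Fin m → ℝ) (n : Fin m → ℝ) (c : Fin m) :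
      ∑ b, ∑ d, ∑ f, (P b d * n f - P b f * n d) * Y b d * U c f =
      ∑ b, ∑ d, P b d * (Y b d * contrSnd U n c - U c d * contrSnd Y n b) := by
    refine Finset.sum_congr rfl fun b _ => ?_
    simp only [sub_mul, mul_sub, Finset.sum_sub_distrib]
    congr 1
    · simp only [contrSnd, Finset.mul_sum]
      exact Finset.sum_congr rfl fun d _ => Finset.sum_congr rfl fun f _ => by ring
    · rw [Finset.sum_comm]
      simp only [contrSnd, Finset.mul_sum]
      exact Finset.sum_congr rfl fun d _ => Finset.sum_congr rfl fun f _ => by ring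
  have h4 (P U F : Fin m → Fin m → ℝ) (n : Fin m → ℝ) (c : Fin m) :
      ∑ b, ∑ d, ∑ f, P b d * n f * (U b c * F d f - U b d * F c f) =
      ∑ b, ∑ d, P b d * (U b c * contrSnd F n d - U b d * contrSnd F n c) := by
    simp only [← h2, Finset.mul_sum]
    exact Finset.sum_congr rfl fun b _ => Finset.sum_congr rfl fun d _ =>
      Finset.sum_congr rfl fun f _ => by ring
  simp only [h1, h2, h3, h4, mul_assoc l2]
  have hQ := hP.sub (hn.mul.const_mul l2)
  have hM := (hP.const_mul n2).sub hn.mul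
  have hK := (hU.add (hY.const_mul n2)).const_mul (1 / 2)
  have hUn := hn.contract₂ hU
  have hYn := hn.contract₂ hY
  have hFn := hn.contract₂ hF
  refine ((((((hn.mul.contract₃ hℓR.swap_right).const_mul (-1)).add hs).add
    (hQ.contract₃ (hDU.swap_left.sub ?_))).add
    (hM.contract₃ (((hK.mul hdl).swap_right.sub (hK.mul hdl)).add
      ((hY.mul hFn).swap_right.sub (hY.mul hFn))))).add
    (hP.contract₃ ((hY.mul hUn).sub ?_))).add
    (hP.contract₃ ((hU.mul hFn).swap_right.sub (hU.mul hFn)))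
  · exact hDU.swap_left.swap_right
  · exact (hU.mul hYn).swap_left.swap_right.swap_left

end Invariance

/-! ### Transfer to an arbitrary basis -/

theorem MetricHypersurfaceData.inv_mat_symm {m : ℕ} {S : Type*} [TopologicalSpace S]
    [ChartedSpace (EuclideanSpace ℝ (Fin m)) S] (D : MetricHypersurfaceData m S) (p : S)
    (e : Fin m → TangentSpace (𝓡 m) p) (A B : Fin m ⊕ Unit) :
    (D.mat p e)⁻¹ A B = (D.mat p e)⁻¹ B A := by
  have h1 : (D.mat p e)ᵀ = D.mat p e := Matrix.ext fun A B => D.mat_symm _ _ _ _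
  have : ((D.mat p e)⁻¹)ᵀ = (D.mat p e)⁻¹ := by rw [Matrix.transpose_nonsing_inv, h1]
  exact congrFun (congrFun this B) A

theorem vecComp_add {k : ℕ} {X : Type*} [TopologicalSpace X]
    [ChartedSpace (EuclideanSpace ℝ (Fin k)) X]
    (φ : OpenPartialHomeomorph X (EuclideanSpace ℝ (Fin k))) {q : X}
    (v w : TangentSpace (𝓡 k) q) (a : Fin k) :
    vecComp φ q (v + w) a = vecComp φ q v a + vecComp φ q w a :=
  (congrArg (EuclideanSpace.proj a : EuclideanSpace ℝ (Fin k) →L[ℝ] ℝ)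
    (map_add (mfderiv (𝓡 k) (𝓡 k) φ q) v w)).trans (map_add _ _ _)

theorem vecComp_smul {k : ℕ} {X : Type*} [TopologicalSpace X]
    [ChartedSpace (EuclideanSpace ℝ (Fin k)) X]
    (φ : OpenPartialHomeomorph X (EuclideanSpace ℝ (Fin k))) {q : X}
    (s : ℝ) (v : TangentSpace (𝓡 k) q) (a : Fin k) :
    vecComp φ q (s • v) a = s * vecComp φ q v a :=
  (congrArg (EuclideanSpace.proj a : EuclideanSpace ℝ (Fin k) →L[ℝ] ℝ)
    (map_smul (mfderiv (𝓡 k) (𝓡 k) φ q) s v)).trans (map_smul _ _ _)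

/-- The Einstein tensor is linear in its vector slot, so the flux is a covector on the hypersurface.
-/
theorem isPull₁_einstein_tangent {m : ℕ} {S M : Type*}
    [TopologicalSpace S] [ChartedSpace (EuclideanSpace ℝ (Fin m)) S]
    [TopologicalSpace M] [ChartedSpace (EuclideanSpace ℝ (Fin (m + 1))) M]
    {φ : OpenPartialHomeomorph S (EuclideanSpace ℝ (Fin m))} {x : EuclideanSpace ℝ (Fin m)}
    (hφ : φ ∈ IsManifold.maximalAtlas (𝓡 m) ∞ S) (hx : x ∈ φ.target) (g : SpacetimeMetric m M)
    (Φ : S → M) (ν : TangentSpace (𝓡 (m + 1)) (Φ (φ.symm x)) →L[ℝ] ℝ)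
    (e : Fin m → TangentSpace (𝓡 m) (φ.symm x)) :
    IsPull₁ (basisMat φ _ e)
      (fun c => g.einstein (Φ (φ.symm x)) ν
        (mfderiv (𝓡 m) (𝓡 (m + 1)) Φ (φ.symm x) (coordVec φ (φ.symm x) c)))
      (fun c => g.einstein (Φ (φ.symm x)) ν
        (mfderiv (𝓡 m) (𝓡 (m + 1)) Φ (φ.symm x) (e c))) := by
  let L : TangentSpace (𝓡 (m + 1)) (Φ (φ.symm x)) →ₗ[ℝ] ℝ :=
    { toFun := g.einstein (Φ (φ.symm x)) ν
      map_add' := fun v w => by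
        simp only [SpacetimeMetric.einstein, vecComp_add, mul_add, Finset.sum_add_distrib]
      map_smul' := fun s v => by
        simp only [SpacetimeMetric.einstein, vecComp_smul, smul_eq_mul, Finset.mul_sum,
          RingHom.id_apply, mul_left_comm s] }
  exact isPull₁_form hφ hx (L ∘ₗ (mfderiv (𝓡 m) (𝓡 (m + 1)) Φ (φ.symm x)).toLinearMap) e

end

/-- Here `R a b c d = R°^a_{bcd}`, `DU a b c = ∇°_a U_{bc}`, and all the other objects are likewise
the components at `p` in the basis `e`. -/
theorem theorem2 {m : ℕ} {S M : Type*}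
    [TopologicalSpace S] [ChartedSpace (EuclideanSpace ℝ (Fin m)) S] [IsManifold (𝓡 m) ∞ S]
    [TopologicalSpace M] [ChartedSpace (EuclideanSpace ℝ (Fin (m + 1))) M]
    [IsManifold (𝓡 (m + 1)) ∞ M]
    (g : SpacetimeMetric m M) (D : HypersurfaceData m S) (Φ : S → M)
    (l : ∀ p : S, TangentSpace (𝓡 (m + 1)) (Φ p)) (hD : D.IsEmbedded g Φ l)
    (φ : OpenPartialHomeomorph S (EuclideanSpace ℝ (Fin m)))
    (hφ : φ ∈ IsManifold.maximalAtlas (𝓡 m) ∞ S) (p : S) (hp : p ∈ φ.source)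
    (e : Module.Basis (Fin m) ℝ (TangentSpace (𝓡 m) p))
    (ν : TangentSpace (𝓡 (m + 1)) (Φ p) →L[ℝ] ℝ) (hν : IsNormalForm Φ l p ν) :
    let P : Fin m → Fin m → ℝ := D.P p e
    let n : Fin m → ℝ := D.n p e
    let n2 : ℝ := D.n2 p e
    let ℓ : Fin m → ℝ := fun a => D.ell p (e a)
    let ℓ2 : ℝ := D.ell2 p
    let dℓ2 : Fin m → ℝ := fun a => mfderiv (𝓡 m) 𝓘(ℝ, ℝ) D.ell2 p (e a)
    let Y : Fin m → Fin m → ℝ := fun a b => D.Y p (e a) (e b)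
    let F : Fin m → Fin m → ℝ := fun a b => D.F φ p (e a) (e b)
    let U : Fin m → Fin m → ℝ := fun a b => D.U φ p (e a) (e b)
    let DU : Fin m → Fin m → Fin m → ℝ := fun a b c => D.covU φ p (e a) (e b) (e c)
    let R : Fin m → Fin m → Fin m → Fin m → ℝ := fun a b c d =>
      D.curvature φ p (e.coord a) (e b) (e c) (e d)
    (- g.einstein (Φ p) ν (l p) =
      (1 / 2) * (∑ b, ∑ c, ∑ d, R c b c d * P b d)
      + (1 / 2) * (∑ a, ∑ b, ∑ c, ∑ d, ℓ a * R a b c d * P b d * n c)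
      + (∑ d, D.covDivField φ p (e d) (e.coord d))
      + (1 / 2) * n2 * (∑ a, ∑ b, ∑ c, ∑ d,
          P b d * P a c * (Y b c * Y d a - Y b d * Y c a))
      + (1 / 2) * (∑ b, ∑ c, ∑ d, (P b d * n c - P b c * n d) *
          (ℓ2 * DU d b c + (U b c + n2 * Y b c) * dℓ2 d
            + 2 * Y b c * ∑ f, (F d f - Y d f) * n f)))
    ∧ ∀ c, g.einstein (Φ p) ν (mfderiv (𝓡 m) (𝓡 (m + 1)) Φ p (e c)) =
      - (∑ a, ∑ b, ∑ d, ℓ a * R a b c d * n b * n d)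
      + (∑ f, D.covDivTensor φ p (e f) (e.coord f) (e c))
      + (∑ b, ∑ d, (P b d - ℓ2 * n b * n d) * (DU d b c - DU c b d))
      + (∑ b, ∑ d, (n2 * P b d - n b * n d) *
          ((1 / 2) * (U b c + n2 * Y b c) * dℓ2 d - (1 / 2) * (U b d + n2 * Y b d) * dℓ2 c
            + ∑ f, (Y b c * F d f - Y b d * F c f) * n f))
      + (∑ b, ∑ d, ∑ f, (P b d * n f - P b f * n d) * Y b d * U c f)
      + (∑ b, ∑ d, ∑ f, P b d * n f * (U b c * F d f - U b d * F c f)) := by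
  -- The point is replaced by `φ.symm x`, the form in which the coordinate identities are stated.
  obtain ⟨x, hx, rfl⟩ : ∃ x ∈ φ.target, φ.symm x = p := ⟨φ p, φ.map_source hp, φ.left_inv hp⟩
  intro P n n2 ℓ ℓ2 dℓ2 Y F U DU R
  have hP : IsPush₂ (basisMat φ _ e) (D.PComp φ x) P := D.isPush₂_P hφ hx e
  have hn : IsPush₁ (basisMat φ _ e) (D.nComp φ x) n := D.isPush₁_n hφ hx e
  have hn2 : n2 = D.n2Comp φ x := D.n2_eq hφ hx e
  have hdl : IsPull₁ (basisMat φ _ e) (D.dell2Comp φ x) dℓ2 := D.isPull₁_dell2 hφ hx e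
  have hY : IsPull₂ (basisMat φ _ e) (bilinComp D.Y φ x) Y := isPull₂_bilin hφ hx D.Y e
  have hF : IsPull₂ (basisMat φ _ e) (D.FComp φ x) F := D.isPull₂_F hx e
  have hU : IsPull₂ (basisMat φ _ e) (D.UComp φ x) U := D.isPull₂_U hx e
  have hDU : IsPull₃ (basisMat φ _ e) (D.covBilin φ (D.UComp φ) x) DU := D.isPull₃_covU hx e
  have hℓR : IsPull₃ (basisMat φ _ e)
      (fun b c d => ∑ a, formComp D.ell φ x a * curvatureCoeff (D.conn φ) x a b c d)
      (fun b c d => ∑ a, ℓ a * R a b c d) := D.isPull₃_ell_mul_curvature hx e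
  have hR : IsPull₂ (basisMat φ _ e) (fun b d => ∑ c, curvatureCoeff (D.conn φ) x c b c d)
      (fun b d => ∑ c, R c b c d) := D.isPull₂_ricci hφ hx e
  have sP (a b) : P a b = P b a := D.inv_mat_symm _ _ _ _
  have sY (a b) : Y a b = Y b a := D.Y_symm _ _ _
  constructor
  · rw [hD.einstein_rigging_coord hφ hx hν rfl rfl hn2 rfl rfl rfl rfl rfl rfl rfl rfl,
      D.sum_covDivField hφ hx e]
    exact (rigging_expr_invariant hP hn hdl hY hF hU hDU hR hℓR D.PComp_symm sP D.YComp_symm sY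
      _).symm
  · intro c
    -- Both sides are covectors, so agreement on the coordinate basis implies agreement on `e`.
    refine (isPull₁_einstein_tangent hφ hx g Φ ν e c).trans (Eq.trans
      (Finset.sum_congr rfl fun k _ => congrArg _ ?_)
      (isPull₁_flux_expr hP hn hdl hY hF hU hDU hℓR (D.isPull₁_covDivTensor hφ hx e) c).symm)
    exact hD.einstein_tangent_coord hφ hx hν rfl rfl hn2 rfl rfl rfl rfl rfl rfl rfl rfl k
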